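/- Let $p$ be a prime. An instance of the group-constraint problem GC on an elementary Abelian $p$-group consists of a finite set $A=\{0,\dots,n-1\}$, permutations $g_1,\dots,g_m$ of $A$ such that the generated group $G=\langle g_1,\dots,g_m\rangle$ is Abelian with all non-trivial elements of order $p$, and a constraint $C:A\to 2^A$; a solution is a $g\in G$ with $a^g\in C(a)$ for all $a\in A$, where $a^g$ denotes the image of $a$ under $g$. The search problem asks for a solution if there is one. For a $G$-orbit $O$ let $G|_O=\{g|_O : g\in G\}$, where $g|_O$ acts as $g$ on $O$ and fixes $A\setminus O$. The super-space $F$ is the permutation group generated by all the $G|_O$; it is an elementary Abelian $p$-group, and it is viewed additively as an $\mathbb F_p$-vector space. For $a$ in the orbit $O$ let $C(a)-a=\{u\in G|_O : a^u\in C(a)\}$, and let $V_O=\bigcap_{a\in O}(C(a)-a)$. The constraint $C$ is linear if $\sum_O V_O$ (sum over all $G$-orbits) is empty or a linear variety $w+E$ of $F$ ($w\in F$, $E$ a subspace of $F$). For an orbit $O$ and a point $a\in O$ let $\mathbf f_O=\mathrm B([g_1|_O,\dots,g_m|_O],[\,],\bot)$, where $\bot$ is the partition into singletons and, for lists $l,\mathbf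 h$ of permutations and a partition $Q$, $\mathrm B([\,],\mathbf h,Q)=\mathbf h$, while $\mathrm B([u]@l,\mathbf h,Q)$ is $\mathrm B(l,\mathbf h,Q)$ if $a^u$ and $a$ lie in the same class of $Q$, and is $\mathrm B(l,[u]@\mathbf h,\mathrm{orb}(u)\sqcup Q)$ otherwise; here $\mathrm{orb}(u)$ is the partition into orbits of $u$, $\sqcup$ is the join of partitions, and $@$ is concatenation. Theorem. For every prime $p$ there are an algorithm and a polynomial $q$ such that, on every such instance whose constraint $C$ is linear, the algorithm computes in time at most $q(n+m)$: 1. a basis $\mathbf f=(f_1,\dots,f_d)$ of $F$, which is a concatenation of the lists $\mathbf f_O$ in some order of the $G$-orbits $O$ (for some choice of one point $a$ in each orbit); 2. a system $Mx=b$ of linear equations over $\mathbb F_p$ in $d$ unknowns that is equivalent to the instance: a permutation $g$ of $A$ is a solution of the instance if and only if $g\in F$ and the column $x$ of the coordinates of $g$ in $\mathbf f$ satisfies $Mx=b$; 3. the solution of this system: the answer that it is inconsistent (and then the instance has no solution), or else a particular solution $x^0$ and a basis of the direction of the affine space of all its solutions, together with the permutation $g=\sum_i x^0_i f_i$, which is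 a solution of the instance. (Time is the number of elementary steps of a program in a language with structured control flow over binary trees, in which every executed instruction is charged $1$ plus the size of the tree it is executed on. Numbers are written in unary, permutations as tables of values, sets as tables of characteristic functions.) -/

import Mathlib

/-! ### Machine model: structured programs over binary trees, with a step count -/

/-- Binary trees, the data of the programming language (as in Jones's `WHILE` language). -/
inductive Dat : Type
  | nil : Dat
  | cons : Dat → Dat → Dat

/-- The number of nodes of a tree. -/
def Dat.size : Dat → ℕ
  | Dat.nil => 1
  | Dat.cons x y => x.size + y.size + 1

/-- Programs.  Every program is a finite piece of text transforming one tree into another one;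
the only primitive operations are the constructors and destructors of trees. -/
inductive Prog : Type
  | skip : Prog
  | nil : Prog
  | hd : Prog
  | tl : Prog
  | cons : Prog → Prog → Prog
  | seq : Prog → Prog → Prog
  | cond : Prog → Prog → Prog → Prog
  | loop : Prog → Prog → Prog

/-- `Runs P x y t`: the program `P`, started on `x`, halts with result `y` after time `t`.
Every instruction that is executed is charged `1` plus the size of the tree it is executed on
(so that copying, reading or discarding this tree is paid for); time is the sum of all charges.
* `skip` returns its input, `nil` returns the empty tree, `hd` and `tl` the two subtrees;
* `cons P Q` runs `P` and `Q` on the same input and joins the two results;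
* `seq P Q` runs `P` and then `Q`;
* `cond B P Q` tests whether the result of `B` is not `nil`, and runs `P` if so, `Q` otherwise;
* `loop B P` runs `P` as long as the result of `B` is not `nil`. -/
inductive Runs : Prog → Dat → Dat → ℕ → Prop
  | skip (x : Dat) : Runs Prog.skip x x (x.size + 1)
  | nil (x : Dat) : Runs Prog.nil x Dat.nil (x.size + 1)
  | hd_nil : Runs Prog.hd Dat.nil Dat.nil (Dat.nil.size + 1)
  | hd_cons (x y : Dat) : Runs Prog.hd (Dat.cons x y) x ((Dat.cons x y).size + 1)
  | tl_nil : Runs Prog.tl Dat.nil Dat.nil (Dat.nil.size + 1)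
  | tl_cons (x y : Dat) : Runs Prog.tl (Dat.cons x y) y ((Dat.cons x y).size + 1)
  | cons {P Q : Prog} {x y z : Dat} {s t : ℕ} :
      Runs P x y s → Runs Q x z t → Runs (Prog.cons P Q) x (Dat.cons y z) (s + t + (x.size + 1))
  | seq {P Q : Prog} {x y z : Dat} {s t : ℕ} :
      Runs P x y s → Runs Q y z t → Runs (Prog.seq P Q) x z (s + t + (x.size + 1))
  | cond_true {B P Q : Prog} {x u v y : Dat} {s t : ℕ} :
      Runs B x (Dat.cons u v) s → Runs P x y t →
        Runs (Prog.cond B P Q) x y (s + t + (x.size + 1))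
  | cond_false {B P Q : Prog} {x y : Dat} {s t : ℕ} :
      Runs B x Dat.nil s → Runs Q x y t → Runs (Prog.cond B P Q) x y (s + t + (x.size + 1))
  | loop_done {B P : Prog} {x : Dat} {s : ℕ} :
      Runs B x Dat.nil s → Runs (Prog.loop B P) x x (s + (x.size + 1))
  | loop_step {B P : Prog} {x u v y z : Dat} {s t r : ℕ} :
      Runs B x (Dat.cons u v) s → Runs P x y t → Runs (Prog.loop B P) y z r →
        Runs (Prog.loop B P) x z (s + t + r + (x.size + 1))

/-! ### Encodings of the inputs and outputs as trees -/

/-- Natural numbers are written in unary. -/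
def encNat : ℕ → Dat
  | 0 => Dat.nil
  | k + 1 => Dat.cons Dat.nil (encNat k)

def encList {α : Type} (e : α → Dat) : List α → Dat
  | [] => Dat.nil
  | a :: l => Dat.cons (e a) (encList e l)

/-- A finite family is written as the list of its values. -/
def encFun {α : Type} (e : α → Dat) {k : ℕ} (v : Fin k → α) : Dat :=
  encList e (List.ofFn v)

def encOption {α : Type} (e : α → Dat) : Option α → Dat
  | none => Dat.nil
  | some a => Dat.cons (e a) Dat.nil

/-- A permutation is written as the table of its values. -/
def encPerm {n : ℕ} (g : Equiv.Perm (Fin n)) : Dat :=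
  encFun encNat fun i => (g i : ℕ)

/-- A set of points is written as the table of its characteristic function. -/
def encSet {n : ℕ} (X : Finset (Fin n)) : Dat :=
  encFun encNat fun i => if i ∈ X then 1 else 0

/-- An integer modulo `p` is written as its representative in `{0, ..., p - 1}`. -/
def encZMod {p : ℕ} (x : ZMod p) : Dat := encNat x.val

/-! ### Group constraints -/

/-- `G` is an elementary Abelian `p`-group. -/
def IsElementaryAbelian (p : ℕ) {X : Type} [Group X] (G : Subgroup X) : Prop :=
  (∀ g ∈ G, ∀ h ∈ G, g * h = h * g) ∧ ∀ g ∈ G, g ≠ 1 → orderOf g = p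

/-- The restriction of the permutation `g` to a set `O` stable by `g`, considered as a permutation
of the whole of `A` that fixes every point outside `O`. -/
noncomputable def restrictPerm {A : Type} (g : Equiv.Perm A) (O : Set A) : Equiv.Perm A := by
  classical
  exact if h : ∀ x, g x ∈ O ↔ x ∈ O then Equiv.Perm.ofSubtype (g.subtypePerm h) else 1

/-- An instance of the group-constraint problem on an elementary Abelian `p`-group of permutations
of `A`: generators `g₁, ..., gₘ` and a constraint `C : A → 2^A`. -/
structure GroupConstraint (p : ℕ) (A : Type) where
  gens : List (Equiv.Perm A)
  C : A → Finset A
  elementary : IsElementaryAbelian p (Subgroup.closure {g | g ∈ gens})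

namespace GroupConstraint

variable {p : ℕ} {A : Type}

/-- The group `G` generated by the given permutations. -/
def group (I : GroupConstraint p A) : Subgroup (Equiv.Perm A) :=
  Subgroup.closure {g | g ∈ I.gens}

/-- The orbit `a^G`. -/
def orbit (I : GroupConstraint p A) (a : A) : Set A := MulAction.orbit I.group a

/-- `g` solves the instance: it belongs to `G` and maps every `a` into `C a`. -/
def IsSolution (I : GroupConstraint p A) (g : Equiv.Perm A) : Prop :=
  g ∈ I.group ∧ ∀ a, g a ∈ I.C a

/-- The transitive constituent `G|_O`, as a set of permutations of `A`. -/
def constituent (I : GroupConstraint p A) (O : Set A) : Set (Equiv.Perm A) :=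
  {w | ∃ g ∈ I.group, w = restrictPerm g O}

/-- The super-space `F`, generated by the transitive constituents of `G`. -/
def superGroup (I : GroupConstraint p A) : Subgroup (Equiv.Perm A) :=
  Subgroup.closure (⋃ a, I.constituent (I.orbit a))

theorem apply_mem_orbit_iff (I : GroupConstraint p A) {g : Equiv.Perm A} (hg : g ∈ I.group)
    (a x : A) : g x ∈ I.orbit a ↔ x ∈ I.orbit a := by
  constructor
  · intro h
    have := MulAction.mem_orbit_of_mem_orbit (⟨g, hg⟩ : I.group)⁻¹ h
    simpa [Subgroup.smul_def, orbit] using this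
  · exact fun h => MulAction.mem_orbit_of_mem_orbit (⟨g, hg⟩ : I.group) h

open scoped Classical in
theorem restrictPerm_apply (I : GroupConstraint p A) {g : Equiv.Perm A} (hg : g ∈ I.group)
    (a x : A) : restrictPerm g (I.orbit a) x = if x ∈ I.orbit a then g x else x := by
  have h : ∀ x, g x ∈ I.orbit a ↔ x ∈ I.orbit a := I.apply_mem_orbit_iff hg a
  unfold restrictPerm
  rw [dif_pos h]
  by_cases hx : x ∈ I.orbit a
  · rw [if_pos hx]
    exact Equiv.Perm.ofSubtype_apply_of_mem (g.subtypePerm h) hx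
  · rw [if_neg hx]
    exact Equiv.Perm.ofSubtype_apply_of_not_mem (g.subtypePerm h) hx

theorem restrictPerm_comm (I : GroupConstraint p A) {g h : Equiv.Perm A} (hg : g ∈ I.group)
    (hh : h ∈ I.group) (a b : A) :
    restrictPerm g (I.orbit a) * restrictPerm h (I.orbit b) =
      restrictPerm h (I.orbit b) * restrictPerm g (I.orbit a) := by
  classical
  have e : g * h = h * g := I.elementary.1 g hg h hh
  ext x
  have e' : g (h x) = h (g x) := by simpa using congrArg (fun u => u x) e
  simp only [Equiv.Perm.mul_apply, I.restrictPerm_apply hg, I.restrictPerm_apply hh]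
  by_cases ha : x ∈ I.orbit a <;> by_cases hb : x ∈ I.orbit b <;>
    simp [ha, hb, I.apply_mem_orbit_iff hg, I.apply_mem_orbit_iff hh, e']

theorem pow_eq_one (I : GroupConstraint p A) {g : Equiv.Perm A} (hg : g ∈ I.group) :
    g ^ p = 1 := by
  by_cases h : g = 1
  · simp [h]
  · rw [← I.elementary.2 g hg h, pow_orderOf_eq_one]

theorem restrictPerm_pow (I : GroupConstraint p A) {g : Equiv.Perm A} (hg : g ∈ I.group) (a : A) :
    restrictPerm g (I.orbit a) ^ p = 1 := by
  classical
  have key : ∀ (k : ℕ) (x : A), (restrictPerm g (I.orbit a) ^ k) x =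
      if x ∈ I.orbit a then (g ^ k) x else x := by
    intro k
    induction k with
    | zero => intro x; simp
    | succ k ih =>
      intro x
      rw [pow_succ, Equiv.Perm.mul_apply, ih, I.restrictPerm_apply hg]
      by_cases hx : x ∈ I.orbit a <;> simp [hx, I.apply_mem_orbit_iff hg, pow_succ]
  ext x
  rw [key, I.pow_eq_one hg]
  simp

theorem superGroup_comm (I : GroupConstraint p A) (u v : I.superGroup) : u * v = v * u := by
  have hc : ∀ x ∈ ⋃ a, I.constituent (I.orbit a), ∀ y ∈ ⋃ a, I.constituent (I.orbit a),
      x * y = y * x := by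
    intro x hx y hy
    obtain ⟨a, g, hg, rfl⟩ := Set.mem_iUnion.1 hx
    obtain ⟨b, h, hh, rfl⟩ := Set.mem_iUnion.1 hy
    exact I.restrictPerm_comm hg hh a b
  exact Subtype.ext (Subgroup.closure_induction₂ (p := fun x y _ _ => x * y = y * x)
    (fun x y hx hy => hc x hx y hy) (fun x _ => by simp) (fun x _ => by simp)
    (fun x y z _ _ _ h1 h2 => (show Commute (x * y) z from Commute.mul_left h1 h2).eq)
    (fun x y z _ _ _ h1 h2 => (show Commute z (x * y) from Commute.mul_right h1 h2).eq)
    (fun x y _ _ h => (show Commute x⁻¹ y from Commute.inv_left h).eq)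
    (fun x y _ _ h => (show Commute x y⁻¹ from Commute.inv_right h).eq) u.2 v.2)

theorem superGroup_pow (I : GroupConstraint p A) (u : I.superGroup) : u ^ p = 1 := by
  have h : ∀ (w : Equiv.Perm A) (hw : w ∈ I.superGroup), (⟨w, hw⟩ : I.superGroup) ^ p = 1 := by
    intro w hw
    refine Subgroup.closure_induction
      (p := fun w hw => (⟨w, hw⟩ : I.superGroup) ^ p = 1) ?_ ?_ ?_ ?_ hw
    · intro x hx
      obtain ⟨a, g, hg, rfl⟩ := Set.mem_iUnion.1 hx
      exact Subtype.ext (I.restrictPerm_pow hg a)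
    · exact one_pow p
    · intro x y hx hy h1 h2
      have hxy : Commute (⟨x, hx⟩ : I.superGroup) ⟨y, hy⟩ := I.superGroup_comm _ _
      have := hxy.mul_pow p
      rw [h1, h2, mul_one] at this
      exact this
    · intro x hx h1
      have := inv_pow (⟨x, hx⟩ : I.superGroup) p
      rw [h1, inv_one] at this
      exact this
  exact h u.1 u.2

instance instCommGroupSuper (I : GroupConstraint p A) : CommGroup I.superGroup :=
  { (inferInstance : Group I.superGroup) with mul_comm := I.superGroup_comm }

/-- The super-space `F` in additive notation. -/
abbrev Super (I : GroupConstraint p A) : Type := Additive I.superGroup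

/-- `F` is an `𝔽_p`-vector space, the external product being induced by multiplication by
integers. -/
noncomputable instance instModuleSuper (I : GroupConstraint p A) : Module (ZMod p) I.Super :=
  AddCommGroup.zmodModule fun u => I.superGroup_pow u.toMul

/-- A vector of `F` as a permutation of `A`. -/
def toPerm (I : GroupConstraint p A) (u : I.Super) : Equiv.Perm A := (u.toMul : I.superGroup)

/-- The set of vectors `C(a) - a`, i.e., of those `u ∈ G|_O`, where `O` is the orbit of `a`, such
that `a + u = a^u` belongs to `C(a)`. -/
def diffSet (I : GroupConstraint p A) (a : A) : Set I.Super :=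
  {u | I.toPerm u ∈ I.constituent (I.orbit a) ∧ I.toPerm u a ∈ I.C a}

/-- The set `𝒫` of `G`-orbits. -/
abbrev Orbits (I : GroupConstraint p A) : Type := MulAction.orbitRel.Quotient I.group A

/-- `V_O` is the intersection of the `C(a) - a` for `a ∈ O`. -/
def V (I : GroupConstraint p A) (O : I.Orbits) : Set I.Super :=
  ⋂ a ∈ O.orbit, I.diffSet a

/-- The sum of the sets `V_O` over all orbits `O`. -/
noncomputable def sumV (I : GroupConstraint p A) [Finite A] : Set I.Super :=
  letI : Fintype I.Orbits := Fintype.ofFinite _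
  {u | ∃ v : I.Orbits → I.Super, (∀ O, v O ∈ I.V O) ∧ u = ∑ O, v O}

/-- The constraint is linear: the sum of the `V_O` is empty or a linear variety of `F`. -/
def IsLinear (I : GroupConstraint p A) [Finite A] : Prop :=
  I.sumV = ∅ ∨
    ∃ (w : I.Super) (E : Submodule (ZMod p) I.Super), I.sumV = {u | ∃ e ∈ E, u = w + e}

end GroupConstraint

/-! ### The computed basis -/

open scoped Classical in
/-- The function `B(l, h, Q)` that extracts a basis from the list `l` of permutations acting on the
orbit of `a`: `h` is the list of vectors extracted so far and `Q` its orbit partition. -/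
noncomputable def buildBasis {A : Type} (a : A) :
    List (Equiv.Perm A) → List (Equiv.Perm A) → Setoid A → List (Equiv.Perm A)
  | [], h, _ => h
  | u :: l, h, Q =>
    if Q a (u a) then buildBasis a l h Q
    else buildBasis a l (u :: h) (Equiv.Perm.SameCycle.setoid u ⊔ Q)

/-- `f` is a concatenation, in some order of the orbits `O`, of the lists `f_O` computed by
`buildBasis` from the restrictions to `O` of the generators; `l` is the list of the points, one in
each orbit, that are used in these computations. -/
def GroupConstraint.IsComputedBasis {p : ℕ} {A : Type} (I : GroupConstraint p A)
    (f : List (Equiv.Perm A)) : Prop :=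
  ∃ l : List A, l.Pairwise (fun a b => I.orbit a ≠ I.orbit b) ∧
    (∀ a, ∃ b ∈ l, I.orbit a = I.orbit b) ∧
    f = l.flatMap fun a => buildBasis a (I.gens.map fun g => restrictPerm g (I.orbit a)) [] ⊥

/-! ### What the algorithm computes -/

/-- The tree encoding an instance on the set `{0, ..., n - 1}`. -/
def encInstance {p n : ℕ} (I : GroupConstraint p (Fin n)) : Dat :=
  Dat.cons (encNat n) (Dat.cons (encList encPerm I.gens) (encFun encSet I.C))

/-- The general solution of a system of linear equations in `d` unknowns, as a particular solution
and a family of directions, together with a permutation. -/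
structure SolutionData (p n d : ℕ) where
  x : Fin d → ZMod p
  e : ℕ
  dir : Fin e → Fin d → ZMod p
  g : Equiv.Perm (Fin n)

/-- The output: a family `f` of `d` permutations, a system `M x = b` of `r` linear equations over
`𝔽_p` in `d` unknowns, and its solution, if there is one. -/
structure OutputData (p n : ℕ) where
  d : ℕ
  f : Fin d → Equiv.Perm (Fin n)
  r : ℕ
  M : Matrix (Fin r) (Fin d) (ZMod p)
  b : Fin r → ZMod p
  sol : Option (SolutionData p n d)

def encSolution {p n d : ℕ} (s : SolutionData p n d) : Dat :=
  Dat.cons (encFun encZMod s.x) (Dat.cons (encFun (encFun encZMod) s.dir) (encPerm s.g))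

def encOutput {p n : ℕ} (o : OutputData p n) : Dat :=
  Dat.cons (encFun encPerm o.f)
    (Dat.cons (encFun (encFun encZMod) o.M)
      (Dat.cons (encFun encZMod o.b) (encOption encSolution o.sol)))

/-- `sol` is the outcome of solving `M x = b`: it is `none` if there is no solution, and otherwise
it holds a particular solution and a basis of the direction of the set of all solutions. -/
def SolvesSystem {p n d r : ℕ} (M : Matrix (Fin r) (Fin d) (ZMod p)) (b : Fin r → ZMod p) :
    Option (SolutionData p n d) → Prop
  | none => ∀ x, M.mulVec x ≠ b
  | some s => LinearIndependent (ZMod p) s.dir ∧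
      ∀ x, M.mulVec x = b ↔ x - s.x ∈ Submodule.span (ZMod p) (Set.range s.dir)

/-- `sol` answers the search problem `I`: it is `none` if `I` has no solution, and otherwise its
permutation is a solution of `I`. -/
def SolvesConstraint {p n d : ℕ} (I : GroupConstraint p (Fin n)) :
    Option (SolutionData p n d) → Prop
  | none => ∀ g, ¬ I.IsSolution g
  | some s => I.IsSolution s.g

/-!
The algorithm is written as a function on lists of natural numbers and of scalars, and two things are
shown about it: it is computed by a program in polynomial time, and it does what is claimed.

*Running time.*  `PolyTime f` says that `f` is computed by a program in time polynomial in the size of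
the encoded argument.  The class of these functions is closed under composition, pairing, case
distinctions, and under folds of lists whose accumulators stay of polynomial size
(`PolyTime.foldl_of_polyBdd`); `map`, `filter`, the arithmetic of `ZMod p` etc. follow.  Only three
folds of the algorithm need a size estimate of their own: the elimination in `solve`, the extraction
of a basis in `spanTable`, and the final product of powers in `combTable`.

*Correctness.*  A transitive constituent `G|_O` is Abelian and transitive, hence regular, so it has only
`|O|` elements and can be enumerated.  `spanTable` runs through the generators and adds `u` to the
basis if `a ^ u` is not yet the image of `a` under a linear combination of the vectors extracted so
far; the class of `a` in the partition of `buildBasis` consists of just these images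
(`spanTable_spec`).  As permutations with disjoint supports are independent, the bases of all
constituents together form a basis of `F` (`GroupConstraint.basisSuper`).

Linear algebra enters only through `solve`, which intersects an affine space with one hyperplane after
another, keeping a particular solution and a basis of the direction.  Applied to homogeneous systems
it computes annihilators, and the double annihilator of a list of vectors is its span
(`forall_mem_annihilator_iff`).  So the equations of `G` in `F` are the annihilator of the coordinates
of the generators, and the equations `y ⬝ x = β` of the affine hull of `V_O` are the linear forms
`(β, y)` that vanish on all `(-1, v)` with `v ∈ V_O`.  For a linear constraint every `V_O` is equal to its
affine hull unless some `V_O` is empty (`GroupConstraint.exists_submodule_of_isLinear`); in this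
exceptional case the equations of the empty `V_O` contain `0 = 1`.  Hence the system is equivalent to
the instance (`GroupConstraint.forall_equations_iff`).
-/

/-! ### Polynomial-time functions between encoded types -/

/-- A type whose elements are written as binary trees. -/
class Enc (α : Type) where
  /-- The tree that represents an element. -/
  enc : α → Dat

open Enc (enc)

/-- The size of the tree that represents `a`. -/
def sz {α : Type} [Enc α] (a : α) : ℕ := (enc a).size

instance : Enc ℕ := ⟨encNat⟩
instance {p : ℕ} : Enc (ZMod p) := ⟨encZMod⟩
instance : Enc Unit := ⟨fun _ => Dat.nil⟩
instance : Enc Bool := ⟨fun b => cond b (Dat.cons Dat.nil Dat.nil) Dat.nil⟩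
instance {α : Type} [Enc α] : Enc (List α) := ⟨encList enc⟩
instance {α : Type} [Enc α] : Enc (Option α) := ⟨encOption enc⟩
instance {α β : Type} [Enc α] [Enc β] : Enc (α × β) := ⟨fun x => Dat.cons (enc x.1) (enc x.2)⟩

section Sizes

variable {α β : Type} [Enc α] [Enc β]

@[simp] theorem sz_prod (a : α × β) : sz a = sz a.1 + sz a.2 + 1 := rfl

@[simp] theorem sz_nil : sz ([] : List α) = 1 := rfl

@[simp] theorem sz_cons (a : α) (l : List α) : sz (a :: l) = sz a + sz l + 1 := rfl

@[simp] theorem sz_none : sz (none : Option α) = 1 := rfl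

@[simp] theorem sz_some (a : α) : sz (some a) = sz a + 1 + 1 := rfl

@[simp] theorem sz_nat (k : ℕ) : sz k = 2 * k + 1 := by
  induction k with
  | zero => rfl
  | succ k ih =>
    have : sz (k + 1) = 1 + sz k + 1 := rfl
    omega

theorem sz_append (l l' : List α) : sz (l ++ l') + 1 = sz l + sz l' := by
  induction l with
  | nil => simp; omega
  | cons a l ih => simp; omega

theorem sz_le_of_mem {a : α} {l : List α} (h : a ∈ l) : sz a ≤ sz l := by
  induction l with
  | nil => simp at h
  | cons b l ih =>
    rcases List.mem_cons.1 h with rfl | h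
    · simp; omega
    · have := ih h
      simp; omega

theorem length_le_sz (l : List α) : l.length ≤ sz l := by
  induction l with
  | nil => simp
  | cons b l ih => simp; omega

theorem sz_list_le {l : List α} {B : ℕ} (h : ∀ a ∈ l, sz a ≤ B) :
    sz l ≤ l.length * (B + 1) + 1 := by
  induction l with
  | nil => simp
  | cons a l ih =>
    have h1 := h a (by simp)
    have h2 := ih fun b hb => h b (by simp [hb])
    simp only [sz_cons, List.length_cons, Nat.add_mul, one_mul]
    omega

theorem sz_zmod_le {p : ℕ} [NeZero p] (x : ZMod p) : sz x ≤ 2 * p + 1 := by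
  have h1 : sz x = sz x.val := rfl
  have := ZMod.val_lt x
  rw [h1, sz_nat]; omega

/-- Every instruction pays for the tree it works on, so a result cannot be larger than the time
spent on it. -/
theorem Runs.size_le {P : Prog} {x y : Dat} {t : ℕ} (h : Runs P x y t) : y.size ≤ t := by
  induction h <;> (try simp only [Dat.size] at *) <;> omega

end Sizes

/-- `f` is bounded by a polynomial in the size of the argument. -/
@[fun_prop] def PolyBdd {α : Type} [Enc α] (f : α → ℕ) : Prop :=
  ∃ q : Polynomial ℕ, ∀ a, f a ≤ q.eval (sz a)

theorem Polynomial.eval_mono_nat (q : Polynomial ℕ) {x y : ℕ} (h : x ≤ y) :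
    q.eval x ≤ q.eval y := by
  rw [Polynomial.eval_eq_sum, Polynomial.eval_eq_sum]
  exact Finset.sum_le_sum fun i _ => Nat.mul_le_mul_left _ (Nat.pow_le_pow_left h i)

namespace PolyBdd

variable {α β : Type} [Enc α] [Enc β] {f g : α → ℕ}

theorem mono (hg : PolyBdd g) (h : ∀ a, f a ≤ g a) : PolyBdd f := by
  obtain ⟨q, hq⟩ := hg
  exact ⟨q, fun a => (h a).trans (hq a)⟩

@[fun_prop] theorem const (k : ℕ) : PolyBdd fun _ : α => k := ⟨Polynomial.C k, fun a => by simp⟩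

@[fun_prop] theorem size : PolyBdd fun a : α => sz a := ⟨Polynomial.X, fun a => by simp⟩

@[fun_prop] theorem add (hf : PolyBdd f) (hg : PolyBdd g) : PolyBdd fun a => f a + g a := by
  obtain ⟨q, hq⟩ := hf
  obtain ⟨r, hr⟩ := hg
  exact ⟨q + r, fun a => by simpa using Nat.add_le_add (hq a) (hr a)⟩

@[fun_prop] theorem mul (hf : PolyBdd f) (hg : PolyBdd g) : PolyBdd fun a => f a * g a := by
  obtain ⟨q, hq⟩ := hf
  obtain ⟨r, hr⟩ := hg
  exact ⟨q * r, fun a => by simpa using Nat.mul_le_mul (hq a) (hr a)⟩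

theorem comp {f : β → ℕ} {u : α → β} (hf : PolyBdd f) (hu : PolyBdd fun a => sz (u a)) :
    PolyBdd fun a => f (u a) := by
  obtain ⟨q, hq⟩ := hf
  obtain ⟨r, hr⟩ := hu
  refine ⟨q.comp r, fun a => (hq _).trans ?_⟩
  rw [Polynomial.eval_comp]
  exact q.eval_mono_nat (hr a)

end PolyBdd

/-- `f` is computed by a program within polynomial time. -/
@[fun_prop] def PolyTime {α β : Type} [Enc α] [Enc β] (f : α → β) : Prop :=
  ∃ (P : Prog) (T : α → ℕ), PolyBdd T ∧ ∀ a, ∃ t ≤ T a, Runs P (enc a) (enc (f a)) t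

namespace PolyTime

variable {α β γ δ σ τ : Type} [Enc α] [Enc β] [Enc γ] [Enc δ] [Enc σ] [Enc τ]

/-- The output of a polynomial-time function has polynomial size. -/
theorem polyBdd_sz {f : α → β} (hf : PolyTime f) : PolyBdd fun a => sz (f a) := by
  obtain ⟨P, T, hT, h⟩ := hf
  refine hT.mono fun a => ?_
  obtain ⟨t, ht, hr⟩ := h a
  exact hr.size_le.trans ht

@[fun_prop] theorem id : PolyTime fun a : α => a :=
  ⟨Prog.skip, fun a => sz a + 1, by fun_prop, fun a => ⟨_, le_rfl, Runs.skip _⟩⟩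

@[fun_prop] theorem comp {g : β → γ} {f : α → β} (hg : PolyTime g) (hf : PolyTime f) :
    PolyTime fun a => g (f a) := by
  have hs := hf.polyBdd_sz
  obtain ⟨P, T, hT, h⟩ := hf
  obtain ⟨Q, S, hS, k⟩ := hg
  refine ⟨Prog.seq P Q, fun a => T a + S (f a) + (sz a + 1), ?_, fun a => ?_⟩
  · exact (hT.add (hS.comp hs)).add (by fun_prop)
  · obtain ⟨t, ht, hr⟩ := h a
    obtain ⟨s, hs, hq⟩ := k (f a)
    exact ⟨_, by dsimp only [sz]; omega, Runs.seq hr hq⟩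

/-- A function that does not change the encoding costs nothing more than `skip`. -/
theorem of_enc_eq {f : α → β} (h : ∀ a, enc (f a) = enc a) : PolyTime f :=
  ⟨Prog.skip, fun a => sz a + 1, by fun_prop,
    fun a => ⟨_, le_rfl, by rw [h]; exact Runs.skip _⟩⟩

@[fun_prop] theorem const (b : β) : PolyTime fun _ : α => b := by
  have key : ∀ y : Dat, ∃ (P : Prog) (k : ℕ), ∀ x : Dat, ∃ t ≤ k * (x.size + 1), Runs P x y t := by
    intro y
    induction y with
    | nil => exact ⟨Prog.nil, 1, fun x => ⟨_, by omega, Runs.nil x⟩⟩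
    | cons y z hy hz =>
      obtain ⟨P, k, hP⟩ := hy
      obtain ⟨Q, l, hQ⟩ := hz
      refine ⟨Prog.cons P Q, k + l + 1, fun x => ?_⟩
      obtain ⟨s, hs, h1⟩ := hP x
      obtain ⟨t, ht, h2⟩ := hQ x
      refine ⟨_, ?_, Runs.cons h1 h2⟩
      rw [Nat.add_mul, Nat.add_mul]
      omega
  obtain ⟨P, k, h⟩ := key (enc b)
  exact ⟨P, fun a => k * (sz a + 1), by fun_prop, fun a => h _⟩

@[fun_prop] theorem prodMk {f : α → β} {g : α → γ} (hf : PolyTime f) (hg : PolyTime g) :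
    PolyTime fun a => (f a, g a) := by
  obtain ⟨P, T, hT, h⟩ := hf
  obtain ⟨Q, S, hS, k⟩ := hg
  refine ⟨Prog.cons P Q, fun a => T a + S a + (sz a + 1), by fun_prop, fun a => ?_⟩
  obtain ⟨t, ht, hr⟩ := h a
  obtain ⟨s, hs, hq⟩ := k a
  exact ⟨_, by dsimp only [sz]; omega, Runs.cons hr hq⟩

theorem fst' : PolyTime (Prod.fst : α × β → α) :=
  ⟨Prog.hd, fun a => sz a + 1, by fun_prop, fun a => ⟨_, le_rfl, Runs.hd_cons _ _⟩⟩

theorem snd' : PolyTime (Prod.snd : α × β → β) :=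
  ⟨Prog.tl, fun a => sz a + 1, by fun_prop, fun a => ⟨_, le_rfl, Runs.tl_cons _ _⟩⟩

@[fun_prop] theorem fst {f : α → β × γ} (hf : PolyTime f) : PolyTime fun a => (f a).1 :=
  fst'.comp hf

@[fun_prop] theorem snd {f : α → β × γ} (hf : PolyTime f) : PolyTime fun a => (f a).2 :=
  snd'.comp hf

@[fun_prop] theorem cons {f : α → β} {g : α → List β} (hf : PolyTime f) (hg : PolyTime g) :
    PolyTime fun a => f a :: g a :=
  (of_enc_eq (f := fun x : β × List β => x.1 :: x.2) fun _ => rfl).comp (hf.prodMk hg)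

@[fun_prop] theorem tail {f : α → List β} (hf : PolyTime f) : PolyTime fun a => (f a).tail := by
  refine PolyTime.comp (g := List.tail) ?_ hf
  refine ⟨Prog.tl, fun a => sz a + 1, by fun_prop, fun a => ⟨_, le_rfl, ?_⟩⟩
  cases a with
  | nil => exact Runs.tl_nil
  | cons a l => exact Runs.tl_cons _ _

/-- Branching on whether the tree of the value of `b` is a single leaf. -/
theorem ite_nil {b : α → β} {f g h : α → γ} (hb : PolyTime b) (hf : PolyTime f) (hg : PolyTime g)
    (h1 : ∀ a, enc (b a) = Dat.nil → h a = f a) (h2 : ∀ a, enc (b a) ≠ Dat.nil → h a = g a) :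
    PolyTime h := by
  obtain ⟨P, T, hT, k1⟩ := hb
  obtain ⟨Q, S, hS, k2⟩ := hf
  obtain ⟨R, U, hU, k3⟩ := hg
  refine ⟨Prog.cond P R Q, fun a => T a + S a + U a + (sz a + 1), by fun_prop, fun a => ?_⟩
  obtain ⟨t, ht, hr⟩ := k1 a
  obtain ⟨s, hs, hq⟩ := k2 a
  obtain ⟨u, hu, hv⟩ := k3 a
  by_cases e : enc (b a) = Dat.nil
  · rw [e] at hr
    rw [h1 a e]
    exact ⟨_, by dsimp only [sz]; omega, Runs.cond_false hr hq⟩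
  · rw [h2 a e]
    cases e' : enc (b a) with
    | nil => exact absurd e' e
    | cons y z =>
      rw [e'] at hr
      exact ⟨_, by dsimp only [sz]; omega, Runs.cond_true hr hv⟩

@[fun_prop] theorem bcond {b : α → Bool} {f g : α → γ} (hb : PolyTime b) (hf : PolyTime f)
    (hg : PolyTime g) : PolyTime fun a => cond (b a) (f a) (g a) := by
  refine ite_nil hb hg hf (fun a h => ?_) (fun a h => ?_) <;> cases e : b a <;>
    simp_all [enc]

@[fun_prop] theorem some {f : α → β} (hf : PolyTime f) : PolyTime fun a => some (f a) :=
  (of_enc_eq (α := β × Unit) (f := fun x => Option.some x.1) fun _ => rfl).comp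
    (hf.prodMk (const ()))

@[fun_prop] theorem optionElim {o : α → Option β} {b : α → γ} {f : α → β → γ} (ho : PolyTime o)
    (hb : PolyTime b) (hf : PolyTime fun x : α × β => f x.1 x.2) :
    PolyTime fun a => (o a).elim (b a) (f a) := by
  have e : PolyTime fun x : α × Option β => x.2.elim (b x.1) (f x.1) := by
    obtain ⟨P, T, hT, k1⟩ := hb.comp (fst' (α := α) (β := Option β))
    obtain ⟨Q, S, hS, k2⟩ := hf
    refine ⟨Prog.cond Prog.tl (Prog.seq (Prog.cons Prog.hd (Prog.seq Prog.tl Prog.hd)) Q) P,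
      fun x => T x + x.2.elim 0 (fun y => S (x.1, y)) + 10 * (sz x + 1), ?_, fun x => ?_⟩
    · obtain ⟨q, hq⟩ := hS
      have : PolyBdd fun x : α × Option β => x.2.elim 0 (fun y => S (x.1, y)) := by
        refine ⟨q, fun x => ?_⟩
        rcases x with ⟨a, _ | y⟩
        · simp
        · exact (hq _).trans (q.eval_mono_nat (by simp; omega))
      fun_prop
    · rcases x with ⟨a, _ | y⟩
      · obtain ⟨t, ht, hr⟩ := k1 (a, none)
        refine ⟨_, ?_, Runs.cond_false (Runs.tl_cons _ _) hr⟩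
        simp only [sz, enc, encOption, Dat.size, Option.elim] at *
        omega
      · obtain ⟨t, ht, hr⟩ := k2 (a, y)
        refine ⟨_, ?_, Runs.cond_true (Runs.tl_cons _ _)
          (Runs.seq (Runs.cons (Runs.hd_cons _ _)
            (Runs.seq (Runs.tl_cons _ _) (Runs.hd_cons _ _))) hr)⟩
        simp only [sz, enc, encOption, Dat.size, Option.elim] at *
        omega
  exact e.comp (id.prodMk ho)

theorem head?' : PolyTime (List.head? : List α → Option α) := by
  have e : PolyTime fun l : List α => l.head?.elim (none : Option α) Option.some := by
    -- The tree of a nonempty list has its head as left subtree.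
    refine ⟨Prog.cond Prog.skip (Prog.cons Prog.hd Prog.nil) Prog.nil, fun a => 6 * (sz a + 1),
      by fun_prop, fun l => ?_⟩
    cases l with
    | nil =>
      refine ⟨_, ?_, Runs.cond_false (Runs.skip _) (Runs.nil _)⟩
      simp [sz, enc, encList, Dat.size]
    | cons a l =>
      refine ⟨_, ?_, Runs.cond_true (Runs.skip _) (Runs.cons (Runs.hd_cons _ _) (Runs.nil _))⟩
      simp only [sz, enc, encList, Dat.size]
      omega
  convert e using 2 with l
  cases l.head? <;> rfl

@[fun_prop] theorem head? {f : α → List β} (hf : PolyTime f) : PolyTime fun a => (f a).head? :=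
  head?'.comp hf

@[fun_prop] theorem succ {f : α → ℕ} (hf : PolyTime f) : PolyTime fun a => f a + 1 :=
  (of_enc_eq (α := Unit × ℕ) (f := fun x => x.2 + 1) fun _ => rfl).comp ((const ()).prodMk hf)

/-- A number in unary and a list of as many trivial entries have the same encoding, so that lists
can be used as counters of loops. -/
theorem replicateUnit {f : α → ℕ} (hf : PolyTime f) :
    PolyTime fun a => List.replicate (f a) () := by
  have h : PolyTime fun k : ℕ => List.replicate k () := of_enc_eq fun k => by
    induction k with
    | zero => rfl
    | succ k ih => exact congrArg (Dat.cons Dat.nil) ih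
  exact h.comp hf

@[fun_prop] theorem pred {f : α → ℕ} (hf : PolyTime f) : PolyTime fun a => (f a).pred := by
  have h : PolyTime fun l : List Unit => l.length := of_enc_eq fun k => by
    induction k with
    | nil => rfl
    | cons _ k ih => exact congrArg (Dat.cons Dat.nil) ih
  simpa using h.comp (tail (replicateUnit hf))

/-- The loop that runs through a list and updates an accumulator by means of `P`.  It works on the
triple of a context, the rest of the list, and the accumulator. -/
def foldProg (P : Prog) : Prog :=
  Prog.loop (Prog.seq Prog.tl Prog.hd)
    (Prog.cons Prog.hd (Prog.cons (Prog.seq Prog.tl (Prog.seq Prog.hd Prog.tl))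
      (Prog.seq (Prog.cons Prog.hd (Prog.cons (Prog.seq Prog.tl Prog.tl)
        (Prog.seq Prog.tl (Prog.seq Prog.hd Prog.hd)))) P)))

/-- The loop computes a fold.  Here `S` bounds the sizes of all accumulators, `L` that of the list, and
`W` the time for one round; the factor `50` is a generous bound for the number of instructions that
only move data. -/
theorem loop_foldl {step : α → σ → τ → σ} {P : Prog} {Ts : α × σ × τ → ℕ}
    (hP : ∀ x, ∃ t ≤ Ts x, Runs P (enc x) (enc (step x.1 x.2.1 x.2.2)) t) (c : α) (S L W : ℕ)
    (l : List τ) (s : σ) (hL : sz l ≤ L)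
    (hS : ∀ l', l' <+: l → sz (l'.foldl (step c) s) ≤ S)
    (hW : ∀ s x, sz s ≤ S → x ∈ l → Ts (c, s, x) + 50 * (sz c + L + S + 1) ≤ W) :
    ∃ t ≤ l.length * W + 50 * (sz c + L + S + 1),
      Runs (foldProg P)
        (enc (c, l, s)) (enc (c, ([] : List τ), l.foldl (step c) s)) t := by
  induction l generalizing s with
  | nil =>
    refine ⟨_, ?_, Runs.loop_done (Runs.seq (Runs.tl_cons _ _) (Runs.hd_cons _ _))⟩
    have h1 := hS [] (by simp)
    simp only [sz, enc, encList, Dat.size, List.foldl, List.length_nil] at *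
    omega
  | cons x l ih =>
    have h0 : sz s ≤ S := hS [] (by simp)
    obtain ⟨t, ht, hr⟩ := hP (c, s, x)
    have hl : sz x + sz l + 1 ≤ L := by simpa using hL
    obtain ⟨t', ht', hr'⟩ := ih (step c s x) (by omega)
      (fun l' hl' => by simpa using hS (x :: l') (by simpa using hl'))
      (fun s' y h h' => hW s' y h (by simp [h']))
    refine ⟨_, ?_, Runs.loop_step (Runs.seq (Runs.tl_cons _ _) (Runs.hd_cons _ _))
      (Runs.cons (Runs.hd_cons _ _) (Runs.cons
        (Runs.seq (Runs.tl_cons _ _) (Runs.seq (Runs.hd_cons _ _) (Runs.tl_cons _ _)))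
        (Runs.seq (Runs.cons (Runs.hd_cons _ _) (Runs.cons
          (Runs.seq (Runs.tl_cons _ _) (Runs.tl_cons _ _))
          (Runs.seq (Runs.tl_cons _ _) (Runs.seq (Runs.hd_cons _ _) (Runs.hd_cons _ _))))) hr)))
      hr'⟩
    have hw := hW s x h0 (by simp)
    simp only [sz, enc, encList, Dat.size, List.length_cons, Nat.add_mul] at *
    omega

/-- Folding a list is polynomial if the step is and if all intermediate accumulators have
polynomial size. -/
theorem foldl_of_polyBdd {step : α → σ → τ → σ} {l : α → List τ} {init : α → σ}
    (hl : PolyTime l) (hi : PolyTime init)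
    (hs : PolyTime fun x : α × σ × τ => step x.1 x.2.1 x.2.2) {B : α → ℕ} (hB : PolyBdd B)
    (h : ∀ c l', l' <+: l c → sz (l'.foldl (step c) (init c)) ≤ B c) :
    PolyTime fun c => (l c).foldl (step c) (init c) := by
  have e : PolyTime fun c => (c, l c, init c) := by fun_prop
  have hlb := hl.polyBdd_sz
  suffices H : ∃ (Q : Prog) (T : α → ℕ), PolyBdd T ∧ ∀ c, ∃ t ≤ T c,
      Runs Q (enc (c, l c, init c)) (enc (c, ([] : List τ), (l c).foldl (step c) (init c))) t by
    obtain ⟨Q, T, hT, hQ⟩ := H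
    obtain ⟨P, U, hU, hP⟩ := e
    refine ⟨Prog.seq P (Prog.seq Q (Prog.seq Prog.tl Prog.tl)),
      fun c => U c + T c + 10 * (sz c + (sz c + sz (l c) + B c + 5) + B c + 10), by fun_prop,
      fun c => ?_⟩
    obtain ⟨t, ht, hr⟩ := hP c
    obtain ⟨u, hu, hq⟩ := hQ c
    refine ⟨_, ?_, Runs.seq hr (Runs.seq hq (Runs.seq (Runs.tl_cons _ _) (Runs.tl_cons _ _)))⟩
    have h0 := h c [] (by simp)
    have h1 := h c (l c) (by simp)
    simp only [sz, enc, encList, Dat.size, List.foldl] at *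
    omega
  obtain ⟨P, Ts, hT, hP⟩ := hs
  obtain ⟨q, hq⟩ := hT
  refine ⟨foldProg P, fun c => sz (l c) * (q.eval (sz c + B c + sz (l c) + 2)
      + 50 * (sz c + sz (l c) + B c + 1)) + 50 * (sz c + sz (l c) + B c + 1), ?_, fun c => ?_⟩
  · have : PolyBdd fun c => q.eval (sz c + B c + sz (l c) + 2) := by
      obtain ⟨r, hr⟩ : PolyBdd fun c => sz c + B c + sz (l c) + 2 := by fun_prop
      refine ⟨q.comp r, fun c => ?_⟩
      rw [Polynomial.eval_comp]
      exact q.eval_mono_nat (hr c)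
    fun_prop
  · obtain ⟨t, ht, hr⟩ := loop_foldl hP c (B c) (sz (l c))
      (q.eval (sz c + B c + sz (l c) + 2) + 50 * (sz c + sz (l c) + B c + 1)) (l c) (init c) le_rfl
      (h c) (fun s x hs hx => by
        refine Nat.add_le_add_right ((hq _).trans (q.eval_mono_nat ?_)) _
        have := sz_le_of_mem hx
        simp; omega)
    refine ⟨t, ht.trans ?_, hr⟩
    exact Nat.add_le_add_right (Nat.mul_le_mul_right _ (length_le_sz _)) _

/-- A fold in which the accumulator grows by a bounded amount in each step. -/
theorem foldl_of_growth {step : α → σ → τ → σ} {l : α → List τ} {init : α → σ}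
    (hl : PolyTime l) (hi : PolyTime init)
    (hs : PolyTime fun x : α × σ × τ => step x.1 x.2.1 x.2.2) {B : α → ℕ} (hB : PolyBdd B)
    (h : ∀ c s x, x ∈ l c → sz (step c s x) ≤ sz s + B c) :
    PolyTime fun c => (l c).foldl (step c) (init c) := by
  have hlb := hl.polyBdd_sz
  have hib := hi.polyBdd_sz
  refine foldl_of_polyBdd hl hi hs (B := fun c => sz (init c) + sz (l c) * B c) (by fun_prop) ?_
  intro c l' hl'
  have key : ∀ (l' : List τ) (s : σ), (∀ x ∈ l', x ∈ l c) →
      sz (l'.foldl (step c) s) ≤ sz s + l'.length * B c := by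
    intro l'
    induction l' with
    | nil => intro s _; simp
    | cons x l' ih =>
      intro s hx
      have h1 := ih (step c s x) fun y hy => hx y (by simp [hy])
      have h2 := h c s x (hx x (by simp))
      simp only [List.foldl_cons, List.length_cons, Nat.add_mul, one_mul]
      omega
  refine (key l' _ fun x hx => hl'.subset hx).trans (Nat.add_le_add_left ?_ _)
  exact Nat.mul_le_mul_right _ (hl'.length_le.trans (length_le_sz _))

end PolyTime

/-! ### A library of polynomial-time functions -/

namespace PolyTime

variable {α β γ δ σ τ : Type} [Enc α] [Enc β] [Enc γ] [Enc δ] [Enc σ] [Enc τ]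

@[fun_prop] theorem band {f g : α → Bool} (hf : PolyTime f) (hg : PolyTime g) :
    PolyTime fun a => f a && g a := by
  have : PolyTime fun a => cond (f a) (g a) false := by fun_prop
  convert this using 2 with a
  cases f a <;> rfl

@[fun_prop] theorem bor {f g : α → Bool} (hf : PolyTime f) (hg : PolyTime g) :
    PolyTime fun a => f a || g a := by
  have : PolyTime fun a => cond (f a) true (g a) := by fun_prop
  convert this using 2 with a
  cases f a <;> rfl

@[fun_prop] theorem bnot {f : α → Bool} (hf : PolyTime f) : PolyTime fun a => !(f a) := by
  have : PolyTime fun a => cond (f a) false true := by fun_prop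
  convert this using 2 with a
  cases f a <;> rfl

@[fun_prop] theorem reverse {l : α → List β} (hl : PolyTime l) :
    PolyTime fun a => (l a).reverse := by
  have : PolyTime fun l : List β => l.foldl (fun s x => x :: s) [] := by
    refine foldl_of_growth (step := fun _ s x => x :: s) (B := fun l => sz l + 1) id (const _)
      (by fun_prop) (by fun_prop) fun c s x hx => ?_
    have := sz_le_of_mem hx
    simp; omega
  simpa using this.comp hl

@[fun_prop] theorem append {l l' : α → List β} (hl : PolyTime l) (hl' : PolyTime l') :
    PolyTime fun a => l a ++ l' a := by
  have : PolyTime fun x : List β × List β => x.1.reverse.foldl (fun s x => x :: s) x.2 := by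
    refine foldl_of_growth (step := fun _ s x => x :: s) (B := fun l => sz l + 1) (by fun_prop)
      (by fun_prop) (by fun_prop) (by fun_prop) fun c s x hx => ?_
    have := sz_le_of_mem (List.mem_reverse.1 hx)
    simp; omega
  simpa using this.comp (hl.prodMk hl')

@[fun_prop] theorem map {f : α → β → γ} {l : α → List β}
    (hf : PolyTime fun x : α × β => f x.1 x.2) (hl : PolyTime l) :
    PolyTime fun a => (l a).map (f a) := by
  have hb := hf.polyBdd_sz
  obtain ⟨q, hq⟩ := hb
  have hlb := hl.polyBdd_sz
  have : PolyTime fun a => (l a).foldl (fun s x => f a x :: s) [] := by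
    refine foldl_of_growth (step := fun a s x => f a x :: s)
      (B := fun a => q.eval (sz a + sz (l a) + 1) + 1) hl (const _)
      ?_ ?_ fun c s x hx => ?_
    · have : PolyTime fun x : α × List γ × β => f x.1 x.2.2 :=
        hf.comp (f := fun x : α × List γ × β => (x.1, x.2.2)) (by fun_prop)
      fun_prop
    · obtain ⟨r, hr⟩ : PolyBdd fun c => sz c + sz (l c) + 1 := by fun_prop
      refine PolyBdd.add ⟨q.comp r, fun c => ?_⟩ (by fun_prop)
      rw [Polynomial.eval_comp]
      exact q.eval_mono_nat (hr c)
    · have h1 := sz_le_of_mem hx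
      have h2 := (hq (c, x)).trans (q.eval_mono_nat (y := sz c + sz (l c) + 1) (by simp; omega))
      simp at h2 ⊢; omega
  convert this.reverse using 2 with a
  have key : ∀ (l : List β) (s : List γ),
      l.foldl (fun s x => f a x :: s) s = (l.map (f a)).reverse ++ s := by
    intro l
    induction l with
    | nil => simp
    | cons x l ih => simp [ih]
  simp [key]

@[fun_prop] theorem flatten {l : α → List (List β)} (hl : PolyTime l) :
    PolyTime fun a => (l a).flatten := by
  have : PolyTime fun l : List (List β) => l.foldl (fun s x => s ++ x) [] := by
    refine foldl_of_growth (step := fun _ s x => s ++ x) (B := fun l => sz l) id (const _)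
      (by fun_prop) (by fun_prop) fun c s x hx => ?_
    have := sz_le_of_mem hx
    have := sz_append s x
    omega
  have e : (fun l : List (List β) => l.foldl (fun s x => s ++ x) []) = List.flatten := by
    funext l
    have key : ∀ (l : List (List β)) (s : List β), l.foldl (fun s x => s ++ x) s
        = s ++ l.flatten := by
      intro l
      induction l with
      | nil => simp
      | cons x l ih => simp [ih]
    simp [key]
  rw [e] at this
  exact this.comp hl

@[fun_prop] theorem flatMap {f : α → β → List γ} {l : α → List β}
    (hf : PolyTime fun x : α × β => f x.1 x.2) (hl : PolyTime l) :
    PolyTime fun a => (l a).flatMap (f a) := by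
  simp only [List.flatMap_def]
  fun_prop

@[fun_prop] theorem filter {f : α → β → Bool} {l : α → List β}
    (hf : PolyTime fun x : α × β => f x.1 x.2) (hl : PolyTime l) :
    PolyTime fun a => (l a).filter (f a) := by
  have : PolyTime fun a => (l a).flatMap fun x => cond (f a x) [x] [] := by fun_prop
  convert this using 2 with a
  induction l a with
  | nil => rfl
  | cons x l ih => cases h : f a x <;> simp [h, ih]

@[fun_prop] theorem find? {f : α → β → Bool} {l : α → List β}
    (hf : PolyTime fun x : α × β => f x.1 x.2) (hl : PolyTime l) :
    PolyTime fun a => (l a).find? (f a) := by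
  simp only [← List.head?_filter]
  fun_prop

@[fun_prop] theorem isNone {o : α → Option β} (ho : PolyTime o) :
    PolyTime fun a => (o a).isNone := by
  have : PolyTime fun a => (o a).elim true fun _ => false := by fun_prop
  convert this using 2 with a
  cases o a <;> rfl

@[fun_prop] theorem any {f : α → β → Bool} {l : α → List β}
    (hf : PolyTime fun x : α × β => f x.1 x.2) (hl : PolyTime l) :
    PolyTime fun a => (l a).any (f a) := by
  have : PolyTime fun a => !((l a).find? (f a)).isNone := by fun_prop
  convert this using 2 with a
  rw [Bool.eq_iff_iff]
  simp

@[fun_prop] theorem all {f : α → β → Bool} {l : α → List β}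
    (hf : PolyTime fun x : α × β => f x.1 x.2) (hl : PolyTime l) :
    PolyTime fun a => (l a).all (f a) := by
  simp only [List.all_eq_not_any_not]
  fun_prop

@[fun_prop] theorem length {l : α → List β} (hl : PolyTime l) : PolyTime fun a => (l a).length := by
  have : PolyTime fun l : List β => l.foldl (fun s _ => s + 1) 0 := by
    refine foldl_of_growth (step := fun _ s _ => s + 1) (B := fun _ => 2) id (const _)
      (by fun_prop) (by fun_prop) fun c s x _ => ?_
    simp; omega
  simpa using this.comp hl

@[fun_prop] theorem replicate {f : α → ℕ} {g : α → β} (hf : PolyTime f) (hg : PolyTime g) :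
    PolyTime fun a => List.replicate (f a) (g a) := by
  have : PolyTime fun a => (List.replicate (f a) ()).map fun _ => g a :=
    map (hg.comp (by fun_prop)) (replicateUnit hf)
  simpa using this

@[fun_prop] theorem range {f : α → ℕ} (hf : PolyTime f) : PolyTime fun a => List.range (f a) := by
  have : PolyTime fun k : ℕ =>
      (List.replicate k ()).foldl (fun s _ => s ++ [s.length]) ([] : List ℕ) := by
    have e : ∀ (l : List Unit) (k : ℕ), l.foldl (fun s _ => s ++ [s.length]) (List.range k) =
        List.range (k + l.length) := by
      intro l
      induction l with
      | nil => simp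
      | cons x l ih =>
        intro k
        have := ih (k + 1)
        rw [List.range_succ] at this
        simp only [List.foldl_cons, List.length_range, this, List.length_cons]
        congr 1; omega
    -- The accumulators have at most `k` entries, each smaller than `k`.
    refine foldl_of_polyBdd (step := fun _ s _ => s ++ [s.length])
      (B := fun k => (sz k) * (2 * sz k + 1 + 1) + 1) (by fun_prop) (by fun_prop) (by fun_prop)
      (by fun_prop) fun k l' hl' => ?_
    have hk : l'.length ≤ k := by simpa using hl'.length_le
    have e' := e l' 0
    simp only [List.range_zero] at e'
    rw [e']
    refine (sz_list_le (B := 2 * sz k + 1) fun a ha => ?_).trans ?_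
    · simp at ha ⊢; omega
    · simp only [List.length_range, sz_nat]
      exact Nat.add_le_add_right (Nat.mul_le_mul_right _ (by omega)) _
  have e : (fun k : ℕ =>
      (List.replicate k ()).foldl (fun s _ => s ++ [s.length]) ([] : List ℕ)) = List.range := by
    funext k
    induction k with
    | zero => rfl
    | succ k ih => rw [List.replicate_succ', List.foldl_append, ih]; simp [List.range_succ]
  rw [e] at this
  exact this.comp hf

@[fun_prop] theorem sub {f g : α → ℕ} (hf : PolyTime f) (hg : PolyTime g) :
    PolyTime fun a => f a - g a := by
  have : PolyTime fun x : ℕ × ℕ =>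
      (List.replicate x.2 ()).foldl (fun s _ => s.pred) x.1 := by
    refine foldl_of_growth (step := fun _ (s : ℕ) _ => s.pred) (B := fun _ => 0) (by fun_prop)
      (by fun_prop) (by fun_prop) (by fun_prop) fun c s x _ => ?_
    simp only [sz_nat]
    have := Nat.pred_le s
    omega
  have e : (fun x : ℕ × ℕ => (List.replicate x.2 ()).foldl (fun s _ => s.pred) x.1) =
      fun x => x.1 - x.2 := by
    funext ⟨i, j⟩
    induction j with
    | zero => rfl
    | succ j ih =>
      dsimp only at ih ⊢
      rw [List.replicate_succ', List.foldl_append, ih]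
      rfl
  rw [e] at this
  exact this.comp (hf.prodMk hg)

@[fun_prop] theorem eq_zero {f : α → ℕ} (hf : PolyTime f) : PolyTime fun a => decide (f a = 0) := by
  refine ite_nil hf (const true) (const false) (fun a h => ?_) (fun a h => ?_) <;>
    cases e : f a <;> simp_all [enc, encNat]

@[fun_prop] theorem decide_eq {f g : α → ℕ} (hf : PolyTime f) (hg : PolyTime g) :
    PolyTime fun a => decide (f a = g a) := by
  have : PolyTime fun a => decide (f a - g a = 0) && decide (g a - f a = 0) := by fun_prop
  convert this using 2 with a
  rw [Bool.eq_iff_iff]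
  simp; omega

@[fun_prop] theorem decide_le {f g : α → ℕ} (hf : PolyTime f) (hg : PolyTime g) :
    PolyTime fun a => decide (f a ≤ g a) := by
  have : PolyTime fun a => decide (f a - g a = 0) := by fun_prop
  convert this using 2 with a
  simp; omega

@[fun_prop] theorem drop {f : α → ℕ} {l : α → List β} (hf : PolyTime f) (hl : PolyTime l) :
    PolyTime fun a => (l a).drop (f a) := by
  have : PolyTime fun x : ℕ × List β =>
      (List.replicate x.1 ()).foldl (fun s _ => s.tail) x.2 := by
    refine foldl_of_growth (step := fun _ (s : List β) _ => s.tail) (B := fun _ => 0) (by fun_prop)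
      (by fun_prop) (by fun_prop) (by fun_prop) fun c s x _ => ?_
    cases s <;> simp; omega
  have e : (fun x : ℕ × List β => (List.replicate x.1 ()).foldl (fun s _ => s.tail) x.2) =
      fun x => x.2.drop x.1 := by
    funext ⟨i, j⟩
    induction i with
    | zero => rfl
    | succ i ih =>
      dsimp only at ih ⊢
      rw [List.replicate_succ', List.foldl_append, ih]
      simp [List.tail_drop]
  rw [e] at this
  exact this.comp (hf.prodMk hl)

@[fun_prop] theorem optionGetD {o : α → Option β} {b : α → β} (ho : PolyTime o)
    (hb : PolyTime b) : PolyTime fun a => (o a).getD (b a) := by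
  have : PolyTime fun a => (o a).elim (b a) fun x => x := by fun_prop
  convert this using 2 with a
  cases o a <;> rfl

@[fun_prop] theorem getD {f : α → ℕ} {l : α → List β} {b : α → β} (hl : PolyTime l)
    (hf : PolyTime f) (hb : PolyTime b) : PolyTime fun a => (l a).getD (f a) (b a) := by
  have : PolyTime fun a => ((l a).drop (f a)).head?.getD (b a) := by fun_prop
  simpa [List.head?_drop, List.getD] using this

@[fun_prop] theorem optionMap {f : α → β → γ} {o : α → Option β}
    (hf : PolyTime fun x : α × β => f x.1 x.2) (ho : PolyTime o) :
    PolyTime fun a => (o a).map (f a) := by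
  have : PolyTime fun a => (o a).elim none fun x => Option.some (f a x) := by fun_prop
  convert this using 2 with a
  cases o a <;> rfl

@[fun_prop] theorem optionBind {f : α → β → Option γ} {o : α → Option β}
    (hf : PolyTime fun x : α × β => f x.1 x.2) (ho : PolyTime o) :
    PolyTime fun a => (o a).bind (f a) := by
  have : PolyTime fun a => (o a).elim none (f a) := by fun_prop
  convert this using 2 with a
  cases o a <;> rfl

@[fun_prop] theorem zip {l : α → List β} {l' : α → List γ} (hl : PolyTime l) (hl' : PolyTime l') :
    PolyTime fun a => (l a).zip (l' a) := by
  -- The accumulator holds the rest of the second list and the pairs met so far.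
  have : PolyTime fun x : List β × List γ => (x.1.foldl (fun (s : List γ × List (β × γ)) b =>
      s.1.head?.elim s fun c => (s.1.tail, s.2 ++ [(b, c)])) (x.2, [])).2 := by
    refine snd (foldl_of_growth (step := fun _ (s : List γ × List (β × γ)) b =>
      s.1.head?.elim s fun c => (s.1.tail, s.2 ++ [(b, c)])) (B := fun x => sz x + 2) fst' ?_ ?_ ?_
      fun c s b hb => ?_)
    · fun_prop
    · fun_prop
    · fun_prop
    · have h1 := sz_le_of_mem hb
      rcases s with ⟨_ | ⟨x, r⟩, s⟩
      · simp
      · have := sz_append s [(b, x)]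
        simp at this ⊢; omega
  have key : ∀ (l : List β) (l' : List γ) (s : List (β × γ)),
      (l.foldl (fun (s : List γ × List (β × γ)) b =>
        s.1.head?.elim s fun c => (s.1.tail, s.2 ++ [(b, c)])) (l', s)).2 = s ++ l.zip l' := by
    intro l
    induction l with
    | nil => simp
    | cons b l ih =>
      rintro (_ | ⟨x, r⟩) s
      · have := ih [] s
        simpa using this
      · simp [ih]
  simp only [key, List.nil_append] at this
  exact this.comp (hl.prodMk hl')

@[fun_prop] theorem zipWith {f : α → β → γ → δ} {l : α → List β} {l' : α → List γ}
    (hf : PolyTime fun x : α × β × γ => f x.1 x.2.1 x.2.2) (hl : PolyTime l)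
    (hl' : PolyTime l') : PolyTime fun a => List.zipWith (f a) (l a) (l' a) := by
  have : PolyTime fun a => ((l a).zip (l' a)).map fun x => f a x.1 x.2 := by fun_prop
  simpa [List.zip, List.map_zipWith] using this

/-- A case distinction by a number, with a fixed number of cases.  The last case `k` also serves all
larger numbers, so that no bound on the values of `i` has to be assumed. -/
theorem natCases (k : ℕ) {i : α → ℕ} (hi : PolyTime i) {f : ℕ → α → β}
    (hf : ∀ j, PolyTime (f j)) : PolyTime fun a => f (min (i a) k) a := by
  induction k generalizing i f with
  | zero => simpa using hf 0
  | succ k ih =>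
    refine ite_nil hi (hf 0) (ih (pred hi) (f := fun j => f (j + 1)) fun j => hf _)
      (fun a h => ?_) (fun a h => ?_) <;> cases e : i a <;> simp_all [enc, encNat]

@[fun_prop] theorem zmodVal {p : ℕ} {x : α → ZMod p} (hx : PolyTime x) : PolyTime fun a => (x a).val :=
  (of_enc_eq (f := fun x : ZMod p => x.val) fun _ => rfl).comp hx

section ZMod

variable {p : ℕ} [NeZero p]

theorem zmodCases {x : α → ZMod p} (hx : PolyTime x) {f : ZMod p → α → β}
    (hf : ∀ j, PolyTime (f j)) : PolyTime fun a => f (x a) a := by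
  have := natCases p (zmodVal hx) (f := fun j => f (j : ZMod p)) fun j => hf _
  convert this using 2 with a
  rw [min_eq_left (ZMod.val_lt _).le, ZMod.natCast_zmod_val]

/-- As `p` is fixed, every binary operation on `ZMod p` can be hard-wired as a table. -/
theorem zmodOp (f : ZMod p → ZMod p → β) {x y : α → ZMod p} (hx : PolyTime x) (hy : PolyTime y) :
    PolyTime fun a => f (x a) (y a) :=
  zmodCases hx (f := fun i a => f i (y a)) fun i =>
    zmodCases hy (f := fun j _ => f i j) fun j => const (f i j)

@[fun_prop] theorem zmodAdd {x y : α → ZMod p} (hx : PolyTime x) (hy : PolyTime y) :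
    PolyTime fun a => x a + y a := zmodOp (fun x y => x + y) hx hy

@[fun_prop] theorem zmodSub {x y : α → ZMod p} (hx : PolyTime x) (hy : PolyTime y) :
    PolyTime fun a => x a - y a := zmodOp (fun x y => x - y) hx hy

@[fun_prop] theorem zmodMul {x y : α → ZMod p} (hx : PolyTime x) (hy : PolyTime y) :
    PolyTime fun a => x a * y a := zmodOp (fun x y => x * y) hx hy

@[fun_prop] theorem zmodInv {x : α → ZMod p} (hx : PolyTime x) : PolyTime fun a => (x a)⁻¹ :=
  zmodOp (fun x _ => x⁻¹) hx hx

@[fun_prop] theorem zmodDecideEq {x y : α → ZMod p} (hx : PolyTime x) (hy : PolyTime y) :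
    PolyTime fun a => decide (x a = y a) := zmodOp (fun x y => decide (x = y)) hx hy

@[fun_prop] theorem zmodSum {l : α → List (ZMod p)} (hl : PolyTime l) :
    PolyTime fun a => (l a).sum := by
  have : PolyTime fun l : List (ZMod p) => l.foldl (fun s x => s + x) 0 := by
    refine foldl_of_growth (step := fun _ s x => s + x) (B := fun _ => 2 * p + 1) id (const _)
      (by fun_prop) (by fun_prop) fun c s x _ => ?_
    have := sz_zmod_le (s + x)
    omega
  simp only [← List.sum_eq_foldl] at this
  exact this.comp hl

end ZMod

end PolyTime

/-! ### The algorithm -/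

section Algorithm

variable {p : ℕ}

/-- The scalar product of two lists of scalars. -/
def dot (r v : List (ZMod p)) : ZMod p := (List.zipWith (fun x y => x * y) r v).sum

/-- The vector `w - c v`. -/
def subMul (w : List (ZMod p)) (c : ZMod p) (v : List (ZMod p)) : List (ZMod p) :=
  List.zipWith (fun x y => x - c * y) w v

/-- The affine space `s.1 + ⟨s.2⟩` (or nothing) is cut down by the equation `e.1 ⬝ x = e.2`: if the
direction contains a basis vector `v` on which the linear form `e.1` does not vanish, the other
generators are made to vanish by subtracting multiples of `v`, and `v` is dropped. -/
def cutStep (s : Option (List (ZMod p) × List (List (ZMod p)))) (e : List (ZMod p) × ZMod p) :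
    Option (List (ZMod p) × List (List (ZMod p))) :=
  s.bind fun s => (s.2.filter fun v => !decide (dot e.1 v = 0)).head?.elim
    (cond (decide (dot e.1 s.1 = e.2)) (some s) none) fun v =>
      some (subMul s.1 ((dot e.1 s.1 - e.2) * (dot e.1 v)⁻¹) v,
        (s.2.filter fun v => decide (dot e.1 v = 0)) ++
          (s.2.filter fun v => !decide (dot e.1 v = 0)).tail.map fun w =>
            subMul w (dot e.1 w * (dot e.1 v)⁻¹) v)

/-- The standard basis of `𝔽_p ^ d`. -/
def stdBasis (p d : ℕ) : List (List (ZMod p)) :=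
  (List.range d).map fun i => (List.range d).map fun j => cond (decide (i = j)) 1 0

/-- The solution of a system of linear equations in `d` unknowns: a particular solution and a basis
of the direction, if there is a solution. -/
def solve (d : ℕ) (E : List (List (ZMod p) × ZMod p)) :
    Option (List (ZMod p) × List (List (ZMod p))) :=
  E.foldl cutStep (some (List.replicate d 0, stdBasis p d))

/-- A basis of the space of the linear forms that vanish on all elements of `S`. -/
def annihilator (d : ℕ) (S : List (List (ZMod p))) : List (List (ZMod p)) :=
  (solve d (S.map fun v => (v, 0))).elim [] fun s => s.2

/-- The value of a table at `b`. -/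
def app (u : List ℕ) (b : ℕ) : ℕ := u.getD b 0

/-- The image of the point `b` under the `j`-th power of the permutation with table `u`. -/
def appPow (u : List ℕ) (j : ZMod p) (b : ℕ) : ℕ := (app u)^[j.val] b

/-- The list of all elements of `ZMod p`. -/
def zmodList (p : ℕ) : List (ZMod p) := (List.range p).map fun i : ℕ => (i : ZMod p)

/-- One step of the construction of a basis for the orbit of `a`.  The state consists of the list of
vectors extracted so far, and of the list of all their linear combinations, as tables of permutations
with lists of coordinates.  The bound on the length of the latter list is
never exceeded for permutations that generate an elementary Abelian group; it keeps the list short on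
all other arguments. -/
def spanStep (n a : ℕ) (s : List (List ℕ) × List (List ℕ × List (ZMod p))) (u : List ℕ) :
    List (List ℕ) × List (List ℕ × List (ZMod p)) :=
  cond ((s.2.any fun e => decide (app e.1 a = app u a)) || decide (n + 1 ≤ s.2.length)) s
    (u :: s.1, s.2.flatMap fun e => (zmodList p).map fun j => (e.1.map (appPow u j), j :: e.2))

/-- A basis for the action of the permutations `l` of `{0, ..., n - 1}` on the orbit of `a`, and the
list of all linear combinations of this basis. -/
def spanTable (p n a : ℕ) (l : List (List ℕ)) :
    List (List ℕ) × List (List ℕ × List (ZMod p)) :=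
  l.foldl (spanStep n a) ([], [(List.range n, [])])

/-- Whether `b` is the image of `a` under one of the permutations listed in `T`. -/
def hits (T : List (List ℕ × List (ZMod p))) (a b : ℕ) : Bool :=
  T.any fun e => decide (app e.1 a = b)

/-- The coordinates of the permutation listed in `T` that maps `a` to `b`. -/
def coordsOf (T : List (List ℕ × List (ZMod p))) (a b : ℕ) : List (ZMod p) :=
  (T.find? fun e => decide (app e.1 a = b)).elim [] fun e => e.2

/-- The basis of the transitive constituent of `a`, and the table of its linear combinations. -/
def block (p n : ℕ) (l : List (List ℕ)) (a : ℕ) :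
    List (List ℕ) × List (List ℕ × List (ZMod p)) :=
  spanTable p n a (l.map fun u => (List.range n).map fun b =>
    cond (hits (spanTable p n a l).2 a b) (app u b) b)

/-- The smallest points of the orbits. -/
def reps (p n : ℕ) (l : List (List ℕ)) : List ℕ :=
  (List.range n).filter fun a => (List.range a).all fun b => !hits (spanTable p n a l).2 a b

/-- The coordinates of those elements of the transitive constituent of `a` that satisfy the
constraint `C` on the orbit of `a`. -/
def feasible (p n : ℕ) (l C : List (List ℕ)) (a : ℕ) : List (List (ZMod p)) :=
  ((block p n l a).2.filter fun e => (List.range n).all fun b =>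
    !hits (block p n l a).2 a b || decide (app (C.getD b []) (app e.1 b) = 1)).map fun e => e.2

/-- The equations, in the coordinates of all orbits, of the affine hull of `feasible`.  An affine
equation `y ⬝ x = β` is found as the linear form `(β, y)` vanishing on the vectors `(-1, x)`. -/
def blockRows (p n : ℕ) (l C : List (List ℕ)) (a : ℕ) : List (List (ZMod p) × ZMod p) :=
  (annihilator ((block p n l a).1.length + 1)
    ((feasible p n l C a).map fun v => -1 :: v)).map fun y =>
      ((reps p n l).flatMap fun a' => cond (decide (a' = a)) y.tail
        (List.replicate (block p n l a').1.length 0), y.head?.getD 0)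

/-- The computed basis of the super-space, as a list of tables of permutations. -/
def superBasis (p n : ℕ) (l : List (List ℕ)) : List (List ℕ) :=
  (reps p n l).flatMap fun a => (block p n l a).1

/-- The coordinates of the given generators. -/
def genVectors (p n : ℕ) (l : List (List ℕ)) : List (List (ZMod p)) :=
  l.map fun u => (reps p n l).flatMap fun a => coordsOf (block p n l a).2 a (app u a)

/-- All equations: those of the group `G` as a subspace of the super-space, and those of the sets of
feasible vectors. -/
def equations (p n : ℕ) (l C : List (List ℕ)) : List (List (ZMod p) × ZMod p) :=
  (annihilator (superBasis p n l).length (genVectors p n l)).map (fun y => (y, 0)) ++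
    (reps p n l).flatMap fun a => blockRows p n l C a

/-- The table of the linear combination of the permutations `f` with coefficients `x`. -/
def combTable (n : ℕ) (f : List (List ℕ)) (x : List (ZMod p)) : List ℕ :=
  (f.zip x).foldl (fun w e => w.map (appPow e.1 e.2)) (List.range n)

/-- The whole algorithm. -/
def algorithm (p : ℕ) (x : ℕ × List (List ℕ) × List (List ℕ)) :
    List (List ℕ) × List (List (ZMod p)) × List (ZMod p) ×
      Option (List (ZMod p) × List (List (ZMod p)) × List ℕ) :=
  (superBasis p x.1 x.2.1,
    (equations p x.1 x.2.1 x.2.2).map (fun e => e.1),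
    (equations p x.1 x.2.1 x.2.2).map (fun e => e.2),
    (solve (superBasis p x.1 x.2.1).length (equations p x.1 x.2.1 x.2.2)).map fun s =>
      (s.1, s.2, combTable x.1 (superBasis p x.1 x.2.1) s.1))

end Algorithm

/-! ### Running time of the algorithm -/

namespace PolyTime

variable {α : Type} [Enc α] {p : ℕ}

@[fun_prop] theorem app {u : α → List ℕ} {b : α → ℕ} (hu : PolyTime u) (hb : PolyTime b) :
    PolyTime fun a => app (u a) (b a) := by
  unfold _root_.app
  fun_prop

@[fun_prop] theorem hits {T : α → List (List ℕ × List (ZMod p))} {a b : α → ℕ} (hT : PolyTime T)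
    (ha : PolyTime a) (hb : PolyTime b) : PolyTime fun c => hits (T c) (a c) (b c) := by
  unfold _root_.hits
  fun_prop

@[fun_prop] theorem coordsOf {T : α → List (List ℕ × List (ZMod p))} {a b : α → ℕ}
    (hT : PolyTime T) (ha : PolyTime a) (hb : PolyTime b) :
    PolyTime fun c => coordsOf (T c) (a c) (b c) := by
  unfold _root_.coordsOf
  fun_prop

@[fun_prop] theorem stdBasis {d : α → ℕ} (hd : PolyTime d) :
    PolyTime fun a => stdBasis p (d a) := by
  unfold _root_.stdBasis
  fun_prop

variable [NeZero p]

@[fun_prop] theorem dot {r v : α → List (ZMod p)} (hr : PolyTime r) (hv : PolyTime v) :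
    PolyTime fun a => dot (r a) (v a) := by
  unfold _root_.dot
  fun_prop

@[fun_prop] theorem subMul {w v : α → List (ZMod p)} {c : α → ZMod p} (hw : PolyTime w)
    (hc : PolyTime c) (hv : PolyTime v) : PolyTime fun a => subMul (w a) (c a) (v a) := by
  unfold _root_.subMul
  fun_prop

theorem cutStep : PolyTime fun x : Option (List (ZMod p) × List (List (ZMod p))) ×
    (List (ZMod p) × ZMod p) => cutStep x.1 x.2 := by
  unfold _root_.cutStep
  fun_prop

end PolyTime

theorem sz_vector_le {p : ℕ} [NeZero p] {v : List (ZMod p)} {d : ℕ} (h : v.length ≤ d) :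
    sz v ≤ d * (2 * p + 1 + 1) + 1 :=
  (sz_list_le fun x _ => sz_zmod_le x).trans
    (Nat.add_le_add_right (Nat.mul_le_mul_right _ h) _)

theorem length_subMul_le {p : ℕ} (w v : List (ZMod p)) (c : ZMod p) :
    (subMul w c v).length ≤ w.length := by
  simp [subMul]

/-- All vectors in the state of `solve` have at most `d` entries, and there are at most `d` of
them. -/
theorem foldl_cutStep_bound {p d : ℕ} (E : List (List (ZMod p) × ZMod p))
    (s : Option (List (ZMod p) × List (List (ZMod p))))
    (hs : ∀ y ∈ s, y.1.length ≤ d ∧ y.2.length ≤ d ∧ ∀ v ∈ y.2, v.length ≤ d) :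
    ∀ y ∈ E.foldl cutStep s, y.1.length ≤ d ∧ y.2.length ≤ d ∧ ∀ v ∈ y.2, v.length ≤ d := by
  induction E generalizing s with
  | nil => exact hs
  | cons e E ih =>
    refine ih _ fun y hy => ?_
    rcases s with _ | s
    · simp [cutStep] at hy
    obtain ⟨h1, h2, h3⟩ := hs s rfl
    simp only [cutStep, Option.bind_some] at hy
    cases hN : s.2.filter fun v => !decide (dot e.1 v = 0) with
    | nil =>
      rw [hN] at hy
      cases hd : decide (dot e.1 s.1 = e.2) <;> simp [hd] at hy
      subst hy
      exact ⟨h1, h2, h3⟩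
    | cons v N =>
      rw [hN] at hy
      simp only [List.head?_cons, Option.elim_some, Option.mem_def, Option.some.injEq,
        List.tail_cons] at hy
      subst hy
      have hlen := List.length_eq_length_filter_add (l := s.2) fun v => decide (dot e.1 v = 0)
      rw [hN] at hlen
      have hmem : ∀ w ∈ N, w ∈ s.2 := fun w hw =>
        (List.mem_filter.1 (hN ▸ List.mem_cons_of_mem v hw)).1
      refine ⟨(length_subMul_le _ _ _).trans h1, ?_, ?_⟩
      · simp at hlen ⊢; omega
      · intro w hw
        rcases List.mem_append.1 hw with hw | hw
        · exact h3 w (List.mem_filter.1 hw).1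
        · obtain ⟨w', hw', rfl⟩ := List.mem_map.1 hw
          exact (length_subMul_le _ _ _).trans (h3 w' (hmem w' hw'))

namespace PolyTime

variable {α : Type} [Enc α] {p : ℕ} [NeZero p]

@[fun_prop] theorem solve {d : α → ℕ} {E : α → List (List (ZMod p) × ZMod p)}
    (hd : PolyTime d) (hE : PolyTime E) : PolyTime fun a => solve (d a) (E a) := by
  have hb := hd.polyBdd_sz
  unfold _root_.solve
  -- Up to `d` vectors with up to `d` entries, apart from the particular solution.
  refine foldl_of_polyBdd (step := fun _ => _root_.cutStep)
    (B := fun a => sz (d a) * (2 * p + 1 + 1) + 1 +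
      (sz (d a) * ((sz (d a) * (2 * p + 1 + 1) + 1) + 1) + 1) + 5) hE (by fun_prop)
    (cutStep.comp (by fun_prop)) (by fun_prop) fun a l' _ => ?_
  have key := foldl_cutStep_bound (d := d a) l' (Option.some (List.replicate (d a) 0,
    _root_.stdBasis p (d a))) (by
      rintro y ⟨⟩
      refine ⟨by simp, by simp [_root_.stdBasis], fun v hv => ?_⟩
      obtain ⟨i, -, rfl⟩ := List.mem_map.1 hv
      simp)
  have hda : d a ≤ sz (d a) := by simp; omega
  generalize l'.foldl _root_.cutStep _ = s at key
  rcases s with _ | s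
  · simp
  · obtain ⟨h1, h2, h3⟩ := key s rfl
    have e1 := sz_vector_le (h1.trans hda)
    have e2 := sz_list_le fun v hv => sz_vector_le ((h3 v hv).trans hda)
    have e3 := Nat.mul_le_mul_right (sz (d a) * (2 * p + 1 + 1) + 1 + 1) (h2.trans hda)
    rw [sz_some, sz_prod]
    omega

@[fun_prop] theorem annihilator {d : α → ℕ} {S : α → List (List (ZMod p))} (hd : PolyTime d)
    (hS : PolyTime S) : PolyTime fun a => annihilator (d a) (S a) := by
  unfold _root_.annihilator
  fun_prop

@[fun_prop] theorem appPow {u : α → List ℕ} {b : α → ℕ} {j : α → ZMod p} (hu : PolyTime u)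
    (hj : PolyTime j) (hb : PolyTime b) : PolyTime fun a => appPow (u a) (j a) (b a) := by
  refine zmodCases hj (f := fun i a => _root_.appPow (u a) i (b a)) fun i => ?_
  unfold _root_.appPow
  generalize i.val = k
  induction k with
  | zero => exact hb
  | succ k ih =>
    simp only [Function.iterate_succ_apply']
    fun_prop

theorem spanStep : PolyTime fun x : (ℕ × ℕ) ×
    (List (List ℕ) × List (List ℕ × List (ZMod p))) × List ℕ =>
      spanStep x.1.1 x.1.2 x.2.1 x.2.2 := by
  unfold _root_.spanStep
  fun_prop

end PolyTime

theorem app_le {u : List ℕ} {K : ℕ} (hu : sz u ≤ K) (b : ℕ) : app u b ≤ K := by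
  unfold app
  by_cases h : b < u.length
  · rw [List.getD_eq_getElem _ _ h]
    have := sz_le_of_mem (List.getElem_mem h)
    rw [sz_nat] at this
    omega
  · rw [List.getD_eq_default _ _ (by omega)]
    exact Nat.zero_le _

theorem appPow_le {p : ℕ} {u : List ℕ} {K : ℕ} (hu : sz u ≤ K) (j : ZMod p) {b : ℕ} (hb : b ≤ K) :
    appPow u j b ≤ K := by
  unfold appPow
  generalize j.val = k
  cases k with
  | zero => exact hb
  | succ k =>
    rw [Function.iterate_succ_apply']
    exact app_le hu _

theorem sz_table_le {w : List ℕ} {n K : ℕ} (hn : w.length ≤ n) (hK : ∀ x ∈ w, x ≤ K) :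
    sz w ≤ n * (2 * K + 1 + 1) + 1 :=
  (sz_list_le (B := 2 * K + 1) fun x hx => by have := hK x hx; rw [sz_nat]; omega).trans
    (Nat.add_le_add_right (Nat.mul_le_mul_right _ hn) _)

/-- The invariant that bounds the size of the state of `spanTable` after `L` steps.  The list of linear
combinations is multiplied by `p` only while it has at most `n` entries. -/
def SpanBound (p n K L : ℕ) (s : List (List ℕ) × List (List ℕ × List (ZMod p))) : Prop :=
  (s.1.length ≤ L ∧ ∀ u ∈ s.1, sz u ≤ K) ∧ s.2.length ≤ n * p + 1 ∧
    ∀ e ∈ s.2, (e.1.length ≤ n ∧ ∀ x ∈ e.1, x ≤ K) ∧ e.2.length ≤ L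

theorem SpanBound.step {p n a K L : ℕ} {s : List (List ℕ) × List (List ℕ × List (ZMod p))}
    (h : SpanBound p n K L s) {u : List ℕ} (hu : sz u ≤ K) :
    SpanBound p n K (L + 1) (spanStep n a s u) := by
  obtain ⟨⟨h1, h2⟩, h3, h4⟩ := h
  unfold spanStep
  cases hc : (s.2.any fun e => decide (app e.1 a = app u a)) || decide (n + 1 ≤ s.2.length) with
  | true =>
    exact ⟨⟨by simp; omega, h2⟩, h3, fun e he => ⟨(h4 e he).1, (h4 e he).2.trans (by omega)⟩⟩
  | false =>
    simp only [cond_false]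
    rw [Bool.or_eq_false_iff] at hc
    have hn := of_decide_eq_false hc.2
    refine ⟨⟨by simpa using h1, ?_⟩, ?_, ?_⟩
    · intro v hv
      rcases List.mem_cons.1 hv with rfl | hv
      exacts [hu, h2 v hv]
    · simp only [List.length_flatMap, List.length_map, zmodList, List.length_range, List.map_const',
        List.sum_replicate, smul_eq_mul]
      exact (Nat.mul_le_mul_right _ (by omega)).trans (Nat.le_succ _)
    · intro e he
      obtain ⟨e', he', hj⟩ := List.mem_flatMap.1 he
      obtain ⟨j, -, rfl⟩ := List.mem_map.1 hj
      obtain ⟨⟨k1, k2⟩, k3⟩ := h4 e' he'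
      refine ⟨⟨by simpa using k1, fun x hx => ?_⟩, by simpa using k3⟩
      obtain ⟨b, hb, rfl⟩ := List.mem_map.1 hx
      exact appPow_le hu j (k2 b hb)

theorem SpanBound.foldl {p n a K : ℕ} (l : List (List ℕ)) (hl : ∀ u ∈ l, sz u ≤ K) {L : ℕ}
    {s : List (List ℕ) × List (List ℕ × List (ZMod p))} (h : SpanBound p n K L s) :
    SpanBound p n K (L + l.length) (l.foldl (spanStep n a) s) := by
  induction l generalizing s L with
  | nil => exact h
  | cons u l ih =>
    have := ih (fun v hv => hl v (by simp [hv])) (h.step (a := a) (hl u (by simp)))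
    rw [List.length_cons, show L + (l.length + 1) = L + 1 + l.length by omega]
    exact this

theorem SpanBound.sz_le {p n K L : ℕ} [NeZero p]
    {s : List (List ℕ) × List (List ℕ × List (ZMod p))}
    (h : SpanBound p n K L s) : sz s ≤ L * (K + 1) + 1 + ((n * p + 1) *
      (n * (2 * K + 1 + 1) + 1 + (L * (2 * p + 1 + 1) + 1) + 1 + 1) + 1) + 1 := by
  obtain ⟨⟨h1, h2⟩, h3, h4⟩ := h
  rw [sz_prod]
  refine Nat.add_le_add_right (Nat.add_le_add ?_ ?_) _
  · exact (sz_list_le h2).trans (Nat.add_le_add_right (Nat.mul_le_mul_right _ h1) _)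
  · refine (sz_list_le fun e he => ?_).trans
      (Nat.add_le_add_right (Nat.mul_le_mul_right _ h3) _)
    obtain ⟨⟨k1, k2⟩, k3⟩ := h4 e he
    exact Nat.add_le_add_right (Nat.add_le_add (sz_table_le k1 k2) (sz_vector_le k3)) _

namespace PolyTime

variable {α : Type} [Enc α] {p : ℕ} [NeZero p]

@[fun_prop] theorem spanTable {n a : α → ℕ} {l : α → List (List ℕ)} (hn : PolyTime n)
    (ha : PolyTime a) (hl : PolyTime l) :
    PolyTime fun c => spanTable p (n c) (a c) (l c) := by
  have hnb := hn.polyBdd_sz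
  have hlb := hl.polyBdd_sz
  unfold _root_.spanTable
  refine foldl_of_polyBdd (step := fun c => _root_.spanStep (n c) (a c))
    (B := fun c => sz (l c) * (sz (n c) + sz (l c) + 1) + 1 + ((sz (n c) * p + 1) *
      (sz (n c) * (2 * (sz (n c) + sz (l c)) + 1 + 1) + 1 +
        (sz (l c) * (2 * p + 1 + 1) + 1) + 1 + 1) + 1) + 1) hl (by fun_prop)
    (spanStep.comp (f := fun x : α ×
      (List (List ℕ) × List (List ℕ × List (ZMod p))) × List ℕ => ((n x.1, a x.1), x.2)) (by fun_prop)) (by fun_prop)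
    fun c l' hl' => ?_
  have hnc : n c ≤ sz (n c) := by simp; omega
  have h0 : SpanBound p (n c) (sz (n c) + sz (l c)) 0
      ([], [(List.range (n c), [])]) := by
    refine ⟨by simp, by simp, fun e he => ?_⟩
    rw [List.mem_singleton.1 he]
    refine ⟨⟨by simp, fun x hx => ?_⟩, le_rfl⟩
    have := List.mem_range.1 hx
    omega
  have hlen : l'.length ≤ sz (l c) := hl'.length_le.trans (length_le_sz _)
  have := (SpanBound.foldl (a := a c) l' (fun u hu => ?_) h0).sz_le
  · refine this.trans ?_
    rw [Nat.zero_add]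
    gcongr
  · have := sz_le_of_mem (hl'.subset hu)
    omega

@[fun_prop] theorem combTable {n : α → ℕ} {f : α → List (List ℕ)} {x : α → List (ZMod p)}
    (hn : PolyTime n) (hf : PolyTime f) (hx : PolyTime x) :
    PolyTime fun c => combTable (n c) (f c) (x c) := by
  have hnb := hn.polyBdd_sz
  have hfb := hf.polyBdd_sz
  unfold _root_.combTable
  refine foldl_of_polyBdd (step := fun c (w : List ℕ) (e : List ℕ × ZMod p) =>
      w.map (_root_.appPow e.1 e.2))
    (B := fun c => sz (n c) * (2 * (sz (n c) + sz (f c)) + 1 + 1) + 1)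
    (by fun_prop) (by fun_prop) (by fun_prop) (by fun_prop) fun c l' hl' => ?_
  have hnc : n c ≤ sz (n c) := by simp; omega
  have key : ∀ (l' : List (List ℕ × ZMod p)) (w : List ℕ),
      (∀ e ∈ l', sz e.1 ≤ sz (n c) + sz (f c)) →
      (w.length ≤ sz (n c) ∧ ∀ b ∈ w, b ≤ sz (n c) + sz (f c)) →
      sz (l'.foldl (fun (w : List ℕ) (e : List ℕ × ZMod p) =>
        w.map (_root_.appPow e.1 e.2)) w) ≤
        sz (n c) * (2 * (sz (n c) + sz (f c)) + 1 + 1) + 1 := by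
    intro l'
    induction l' with
    | nil => exact fun w _ hw => sz_table_le hw.1 hw.2
    | cons e l' ih =>
      intro w h hw
      refine ih _ (fun e' he' => h e' (by simp [he'])) ⟨by simpa using hw.1, fun b hb => ?_⟩
      obtain ⟨b', hb', rfl⟩ := List.mem_map.1 hb
      exact appPow_le (h e (by simp)) _ (hw.2 b' hb')
  refine key l' _ (fun e he => ?_) ⟨by simpa using hnc, fun b hb => ?_⟩
  · have := sz_le_of_mem (List.of_mem_zip (hl'.subset he)).1
    omega
  · have := List.mem_range.1 hb
    omega

@[fun_prop] theorem block {n a : α → ℕ} {l : α → List (List ℕ)} (hn : PolyTime n)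
    (hl : PolyTime l) (ha : PolyTime a) : PolyTime fun c => block p (n c) (l c) (a c) := by
  unfold _root_.block
  fun_prop

@[fun_prop] theorem reps {n : α → ℕ} {l : α → List (List ℕ)} (hn : PolyTime n)
    (hl : PolyTime l) : PolyTime fun c => reps p (n c) (l c) := by
  unfold _root_.reps
  fun_prop

@[fun_prop] theorem feasible {n a : α → ℕ} {l C : α → List (List ℕ)} (hn : PolyTime n)
    (hl : PolyTime l) (hC : PolyTime C) (ha : PolyTime a) :
    PolyTime fun c => feasible p (n c) (l c) (C c) (a c) := by
  unfold _root_.feasible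
  fun_prop

@[fun_prop] theorem blockRows {n a : α → ℕ} {l C : α → List (List ℕ)} (hn : PolyTime n)
    (hl : PolyTime l) (hC : PolyTime C) (ha : PolyTime a) :
    PolyTime fun c => blockRows p (n c) (l c) (C c) (a c) := by
  unfold _root_.blockRows
  fun_prop

@[fun_prop] theorem superBasis {n : α → ℕ} {l : α → List (List ℕ)} (hn : PolyTime n)
    (hl : PolyTime l) : PolyTime fun c => superBasis p (n c) (l c) := by
  unfold _root_.superBasis
  fun_prop

@[fun_prop] theorem genVectors {n : α → ℕ} {l : α → List (List ℕ)} (hn : PolyTime n)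
    (hl : PolyTime l) : PolyTime fun c => genVectors p (n c) (l c) := by
  unfold _root_.genVectors
  fun_prop

@[fun_prop] theorem equations {n : α → ℕ} {l C : α → List (List ℕ)} (hn : PolyTime n)
    (hl : PolyTime l) (hC : PolyTime C) :
    PolyTime fun c => equations p (n c) (l c) (C c) := by
  unfold _root_.equations
  fun_prop

theorem algorithm : PolyTime (algorithm p) := by
  unfold _root_.algorithm
  fun_prop

end PolyTime

/-! ### Correctness of the solution of linear systems -/

section ListIndependence

variable {K V : Type} [Field K] [AddCommGroup V] [Module K V]

theorem linearIndependent_get_cons {v : V} {l : List V} :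
    LinearIndependent K (v :: l).get ↔
      LinearIndependent K l.get ∧ v ∉ Submodule.span K {w | w ∈ l} := by
  have e : (v :: l).get = Fin.cons v l.get := by
    funext i
    exact Fin.cases rfl (fun _ => rfl) i
  rw [e, linearIndependent_finCons, Set.range_list_get]

theorem linearIndependent_get_perm {l l' : List V} (h : l.Perm l') :
    LinearIndependent K l.get → LinearIndependent K l'.get := by
  induction h with
  | nil => exact fun h => h
  | cons x h ih =>
    rw [linearIndependent_get_cons, linearIndependent_get_cons]
    rintro ⟨h1, h2⟩
    refine ⟨ih h1, ?_⟩
    simpa only [h.mem_iff] using h2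
  | swap x y l =>
    have e : ∀ z : V, {w | w ∈ z :: l} = insert z {w | w ∈ l} := fun z => by ext; simp
    simp only [linearIndependent_get_cons, e]
    rintro ⟨⟨h1, h2⟩, h3⟩
    refine ⟨⟨h1, fun h => h3 (Submodule.span_mono (Set.subset_insert _ _) h)⟩, fun h => h3 ?_⟩
    exact mem_span_insert_exchange h h2
  | trans _ _ ih1 ih2 => exact fun h => ih2 (ih1 h)

theorem linearIndependent_get_map_sub (c : V → K) {v : V} {l : List V}
    (h : LinearIndependent K (v :: l).get) :
    LinearIndependent K (l.map fun w => w - c w • v).get := by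
  induction l with
  | nil =>
    have : IsEmpty (Fin ([] : List V).length) := inferInstanceAs (IsEmpty (Fin 0))
    exact (linearIndependent_empty_type : LinearIndependent K ([] : List V).get)
  | cons w l ih =>
    obtain ⟨h1, h2⟩ :=
      linearIndependent_get_cons.1 (linearIndependent_get_perm (List.Perm.swap w v l) h)
    refine linearIndependent_get_cons.2 ⟨ih h1, fun h3 => h2 ?_⟩
    have hv : v ∈ Submodule.span K {x | x ∈ v :: l} := Submodule.subset_span (by simp)
    have h4 : Submodule.span K {x | x ∈ l.map fun w => w - c w • v} ≤
        Submodule.span K {x | x ∈ v :: l} := by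
      refine Submodule.span_le.2 fun x hx => ?_
      obtain ⟨y, hy, rfl⟩ := List.mem_map.1 hx
      exact Submodule.sub_mem _ (Submodule.subset_span (by simp [hy]))
        (Submodule.smul_mem _ _ hv)
    have := Submodule.add_mem _ (h4 h3) (Submodule.smul_mem _ (c w) hv)
    simpa using this

/-- The intersection of the span of `v` and `S` with a hyperplane that does not contain `v`. -/
theorem mem_span_insert_and_eq_zero_iff (f : V →ₗ[K] K) {v : V} (hv : f v ≠ 0) (S : Set V)
    (y : V) : y ∈ Submodule.span K (insert v S) ∧ f y = 0 ↔
      y ∈ Submodule.span K ((fun w => w - (f w * (f v)⁻¹) • v) '' S) := by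
  -- The projection onto the hyperplane along `v`.
  let F : V →ₗ[K] V := LinearMap.id - (f.smulRight ((f v)⁻¹ • v))
  have hF : ∀ w, F w = w - (f w * (f v)⁻¹) • v := fun w => by simp [F, mul_smul]
  have hFv : F v = 0 := by rw [hF, mul_inv_cancel₀ hv, one_smul, sub_self]
  have hfF : ∀ w, f (F w) = 0 := fun w => by rw [hF]; simp [hv]
  have e : (fun w => w - (f w * (f v)⁻¹) • v) = F := by funext w; rw [hF]
  rw [e]
  constructor
  · rintro ⟨h1, h2⟩
    have h3 : F y ∈ (Submodule.span K (insert v S)).map F := Submodule.mem_map_of_mem h1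
    rw [Submodule.map_span, Set.image_insert_eq, hFv, Submodule.span_insert_zero] at h3
    rwa [hF, h2, zero_mul, zero_smul, sub_zero] at h3
  · intro h
    have hle : Submodule.span K (F '' S) ≤
        Submodule.span K (insert v S) ⊓ LinearMap.ker f := by
      refine Submodule.span_le.2 ?_
      rintro _ ⟨w, hw, rfl⟩
      refine ⟨?_, hfF w⟩
      rw [hF]
      exact Submodule.sub_mem _ (Submodule.subset_span (Set.mem_insert_of_mem _ hw))
        (Submodule.smul_mem _ _ (Submodule.subset_span (Set.mem_insert _ _)))
    exact hle h

end ListIndependence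

section Solve

variable {p d : ℕ}

/-- A list of scalars as a vector of `𝔽_p ^ d`; missing entries are zero. -/
def vec (d : ℕ) (v : List (ZMod p)) : Fin d → ZMod p := fun i => v.getD i 0

theorem ofFn_vec {v : List (ZMod p)} (h : v.length = d) : List.ofFn (vec d v) = v := by
  subst h
  refine List.ext_getElem (by simp) fun i h1 h2 => ?_
  simp [vec, h2]

theorem vec_ofFn (x : Fin d → ZMod p) : vec d (List.ofFn x) = x := by
  funext i
  simp [vec]

theorem zipWith_eq_ofFn {r v : List (ZMod p)} (hr : r.length = d) (hv : v.length = d)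
    (f : ZMod p → ZMod p → ZMod p) :
    List.zipWith f r v = List.ofFn fun i => f (vec d r i) (vec d v i) := by
  refine List.ext_getElem (by simp [hr, hv]) fun i h1 h2 => ?_
  simp only [List.length_zipWith] at h1
  have h3 : i < r.length := by omega
  have h4 : i < v.length := by omega
  simp [vec, h3, h4]

theorem dot_eq_dotProduct {r v : List (ZMod p)} (hr : r.length = d) (hv : v.length = d) :
    dot r v = vec d r ⬝ᵥ vec d v := by
  rw [dot, zipWith_eq_ofFn hr hv, List.sum_ofFn]
  rfl

theorem vec_subMul {w v : List (ZMod p)} (hw : w.length = d) (hv : v.length = d) (c : ZMod p) :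
    vec d (subMul w c v) = vec d w - c • vec d v := by
  rw [subMul, zipWith_eq_ofFn hw hv, vec_ofFn]
  rfl

theorem length_subMul {w v : List (ZMod p)} (hw : w.length = d) (hv : v.length = d) (c : ZMod p) :
    (subMul w c v).length = d := by
  simp [subMul, hw, hv]

/-- `s` is a description of the set of the vectors with the property `X`: by a particular element
and a basis of the direction, or `none` if there is no such vector. -/
def Describes (d : ℕ) (X : (Fin d → ZMod p) → Prop) :
    Option (List (ZMod p) × List (List (ZMod p))) → Prop
  | none => ∀ x, ¬ X x
  | some s => (s.1.length = d ∧ ∀ v ∈ s.2, v.length = d) ∧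
      LinearIndependent (ZMod p) (s.2.map (vec d)).get ∧
      ∀ x, X x ↔ x - vec d s.1 ∈ Submodule.span (ZMod p) {y | y ∈ s.2.map (vec d)}

variable [Fact p.Prime]

theorem Describes.cutStep {X : (Fin d → ZMod p) → Prop}
    {s : Option (List (ZMod p) × List (List (ZMod p)))} (h : Describes d X s)
    {e : List (ZMod p) × ZMod p} (he : e.1.length = d) :
    Describes d (fun x => X x ∧ vec d e.1 ⬝ᵥ x = e.2) (cutStep s e) := by
  rcases s with _ | ⟨x₀, D⟩
  · exact fun x hx => h x hx.1
  obtain ⟨r, β⟩ := e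
  obtain ⟨⟨h0, hD⟩, hind, hX⟩ := h
  dsimp only at h0 hD hind hX he
  let f : (Fin d → ZMod p) →ₗ[ZMod p] ZMod p :=
    { toFun := fun x => vec d r ⬝ᵥ x
      map_add' := fun x y => dotProduct_add _ _ _
      map_smul' := fun c x => by simp }
  have hf : ∀ x, vec d r ⬝ᵥ x = f x := fun _ => rfl
  have hdot : ∀ v : List (ZMod p), v.length = d → dot r v = f (vec d v) := fun v hv =>
    dot_eq_dotProduct he hv
  have hperm := List.filter_append_perm (fun v => decide (dot r v = 0)) D
  simp only [_root_.cutStep, Option.bind_some]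
  cases hN : D.filter fun v => !decide (dot r v = 0) with
  | nil =>
    have hz : ∀ v ∈ D, f (vec d v) = 0 := by
      intro v hv
      rw [← hdot v (hD v hv)]
      by_contra hne
      have : v ∈ D.filter fun v => !decide (dot r v = 0) := by simp [hv, hne]
      rw [hN] at this
      simp at this
    have hfX : ∀ x, X x → f x = f (vec d x₀) := by
      intro x hx
      have hle : Submodule.span (ZMod p) {y | y ∈ D.map (vec d)} ≤ LinearMap.ker f := by
        refine Submodule.span_le.2 fun y hy => ?_
        obtain ⟨v, hv, rfl⟩ := List.mem_map.1 hy
        exact hz v hv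
      have := hle ((hX x).1 hx)
      rwa [LinearMap.mem_ker, map_sub, sub_eq_zero] at this
    simp only [List.head?_nil, Option.elim_none]
    by_cases hβ : dot r x₀ = β
    · simp only [hβ, decide_true, cond_true]
      refine ⟨⟨h0, hD⟩, hind, fun x => ⟨fun hx => (hX x).1 hx.1, fun hx => ?_⟩⟩
      have hx := (hX x).2 hx
      refine ⟨hx, ?_⟩
      rw [hf, hfX x hx, ← hdot _ h0, hβ]
    · simp only [hβ, decide_false, cond_false]
      intro x hx
      apply hβ
      rw [hdot _ h0, ← hfX x hx.1]
      exact hx.2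
  | cons v N =>
    rw [hN] at hperm
    have hvD : v ∈ D ∧ dot r v ≠ 0 := by
      have : v ∈ D.filter fun v => !decide (dot r v = 0) := by rw [hN]; simp
      simpa using this
    have hND : ∀ w ∈ N, w.length = d := fun w hw => hD w
      (List.mem_filter.1 (hN ▸ List.mem_cons_of_mem v hw : w ∈ D.filter _)).1
    have hvl := hD v hvD.1
    have hfv : f (vec d v) ≠ 0 := hdot v hvl ▸ hvD.2
    simp only [List.head?_cons, Option.elim_some, List.tail_cons]
    set Z := D.filter fun v => decide (dot r v = 0) with hZ
    have hZD : ∀ w ∈ Z, w.length = d ∧ f (vec d w) = 0 := by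
      intro w hw
      have hw' := List.mem_filter.1 hw
      refine ⟨hD w hw'.1, ?_⟩
      rw [← hdot w (hD w hw'.1)]
      simpa using hw'.2
    -- Subtracting multiples of `v` does not change the elements of `Z`.
    have e : (Z ++ N.map fun w => subMul w (dot r w * (dot r v)⁻¹) v).map (vec d) =
        ((Z ++ N).map (vec d)).map
          fun y => y - (f y * (f (vec d v))⁻¹) • vec d v := by
      simp only [List.map_append, List.map_map]
      congr 1
      · refine List.map_congr_left fun w hw => ?_
        simp [(hZD w hw).2]
      · refine List.map_congr_left fun w hw => ?_
        simp only [Function.comp]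
        rw [vec_subMul (hND w hw) hvl, hdot w (hND w hw), hdot v hvl]
    have hperm' : (D.map (vec d)).Perm (vec d v :: (Z ++ N).map (vec d)) :=
      (hperm.symm.trans List.perm_middle).map (vec d)
    refine ⟨⟨length_subMul h0 hvl _, fun w hw => ?_⟩, ?_, fun x => ?_⟩
    · rcases List.mem_append.1 hw with hw | hw
      · exact (hZD w hw).1
      · obtain ⟨w', hw', rfl⟩ := List.mem_map.1 hw
        exact length_subMul (hND w' hw') hvl _
    · dsimp only
      rw [e]
      exact linearIndependent_get_map_sub _ (linearIndependent_get_perm hperm' hind)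
    · dsimp only
      have hset : {y | y ∈ D.map (vec d)} = insert (vec d v) {y | y ∈ (Z ++ N).map (vec d)} := by
        ext y
        simp only [Set.mem_ofPred_eq, Set.mem_insert_iff, hperm'.mem_iff, List.mem_cons]
      have himg : {y | y ∈ (Z ++ N.map fun w => subMul w (dot r w * (dot r v)⁻¹) v).map (vec d)} =
          (fun y => y - (f y * (f (vec d v))⁻¹) • vec d v) '' {y | y ∈ (Z ++ N).map (vec d)} := by
        ext y
        rw [e]
        simp only [Set.mem_ofPred_eq, Set.mem_image, List.mem_map]
      rw [himg, ← mem_span_insert_and_eq_zero_iff f hfv, ← hset, hX, vec_subMul h0 hvl,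
        hdot _ h0, hdot _ hvl, hf]
      have hvs : vec d v ∈ Submodule.span (ZMod p) {y | y ∈ D.map (vec d)} :=
        Submodule.subset_span (List.mem_map_of_mem hvD.1)
      set c := (f (vec d x₀) - β) * (f (vec d v))⁻¹ with hc
      have e1 : x - (vec d x₀ - c • vec d v) = (x - vec d x₀) + c • vec d v := by abel
      have e2 : f (x - (vec d x₀ - c • vec d v)) = f x - β := by
        have : c * f (vec d v) = f (vec d x₀) - β := by
          rw [hc, mul_assoc, inv_mul_cancel₀ hfv, mul_one]
        simp only [map_sub, map_smul, smul_eq_mul, this]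
        ring
      rw [e2, sub_eq_zero, e1]
      exact and_congr_left fun _ =>
        (Submodule.add_mem_iff_left _ (Submodule.smul_mem _ _ hvs)).symm

theorem vec_stdBasis : (stdBasis p d).map (vec d) =
    List.ofFn fun i : Fin d => (Pi.single i 1 : Fin d → ZMod p) := by
  refine List.ext_getElem (by simp [stdBasis]) fun i h1 h2 => ?_
  have hi : i < d := by simpa using h2
  funext j
  have e : (stdBasis p d)[i]'(by simpa [stdBasis] using hi) =
      (List.range d).map fun j => cond (decide (i = j)) 1 0 := by simp [stdBasis]
  rw [List.getElem_map, e, List.getElem_ofFn, vec, List.getD_eq_getElem _ _ (by simp)]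
  simp only [List.getElem_map, List.getElem_range]
  by_cases h : i = j
  · subst h; simp
  · rw [Pi.single_eq_of_ne (fun h' => h (by rw [h']))]
    simp [h]

theorem describes_solve {E : List (List (ZMod p) × ZMod p)} (hE : ∀ e ∈ E, e.1.length = d) :
    Describes d (fun x => ∀ e ∈ E, vec d e.1 ⬝ᵥ x = e.2) (solve d E) := by
  have key : ∀ (E : List (List (ZMod p) × ZMod p)) (X : (Fin d → ZMod p) → Prop)
      (s : Option (List (ZMod p) × List (List (ZMod p)))), (∀ e ∈ E, e.1.length = d) →
      Describes d X s →
      Describes d (fun x => X x ∧ ∀ e ∈ E, vec d e.1 ⬝ᵥ x = e.2) (E.foldl cutStep s) := by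
    intro E
    induction E with
    | nil => intro X s _ h; simpa using h
    | cons e E ih =>
      intro X s hE h
      have := ih _ _ (fun e he => hE e (by simp [he])) (h.cutStep (hE e (by simp)))
      simpa [and_assoc] using this
  have := key E (fun _ => True) _ hE
    (show Describes d (fun _ => True) (some (List.replicate d 0, stdBasis p d)) from ?_)
  · simpa [solve] using this
  refine ⟨⟨by simp, fun v hv => ?_⟩, ?_, fun x => ?_⟩
  · obtain ⟨i, -, rfl⟩ := List.mem_map.1 hv
    simp
  · dsimp only
    rw [vec_stdBasis]
    have := (Pi.basisFun (ZMod p) (Fin d)).linearIndependent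
    have e : (List.ofFn fun i : Fin d => (Pi.single i 1 : Fin d → ZMod p)).get =
        (Pi.basisFun (ZMod p) (Fin d)) ∘ (Fin.cast (by simp)) := by
      funext i
      simp
      rfl
    rw [e]
    exact this.comp _ (Fin.cast_injective _)
  · dsimp only
    rw [vec_stdBasis]
    have e : {y | y ∈ List.ofFn fun i : Fin d => (Pi.single i 1 : Fin d → ZMod p)} =
        Set.range (Pi.basisFun (ZMod p) (Fin d)) := by
      ext y
      simp [List.mem_ofFn]
    rw [e, (Pi.basisFun (ZMod p) (Fin d)).span_eq]
    simp

/-- A vector on which all linear forms vanish that vanish on `S` is a linear combination of `S`. -/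
theorem mem_span_iff_forall_dotProduct (S : Set (Fin d → ZMod p)) (x : Fin d → ZMod p) :
    x ∈ Submodule.span (ZMod p) S ↔
      ∀ y : Fin d → ZMod p, (∀ s ∈ S, s ⬝ᵥ y = 0) → y ⬝ᵥ x = 0 := by
  constructor
  · intro hx y hy
    induction hx using Submodule.span_induction with
    | mem s hs => rw [dotProduct_comm]; exact hy s hs
    | zero => simp
    | add a b _ _ ha hb => rw [dotProduct_add, ha, hb, add_zero]
    | smul c a _ ha => rw [dotProduct_smul, ha, smul_zero]
  · intro h
    by_contra hx
    obtain ⟨f, hfx, hf⟩ := Submodule.exists_le_ker_of_notMem hx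
    have hrep : ∀ z, f z = (fun i => f fun j => if i = j then 1 else 0) ⬝ᵥ z := by
      intro z
      rw [LinearMap.pi_apply_eq_sum_univ f z]
      simp only [dotProduct, smul_eq_mul, mul_comm]
    refine hfx ?_
    rw [hrep]
    refine h _ fun s hs => ?_
    rw [dotProduct_comm, ← hrep]
    exact hf (Submodule.subset_span hs)

theorem length_of_mem_annihilator {S : List (List (ZMod p))} (hS : ∀ v ∈ S, v.length = d)
    {y : List (ZMod p)} (hy : y ∈ annihilator d S) : y.length = d := by
  have h := describes_solve (d := d) (E := S.map fun v => (v, (0 : ZMod p))) fun e he => by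
    obtain ⟨v, hv, rfl⟩ := List.mem_map.1 he
    exact hS v hv
  unfold annihilator at hy
  cases hs : solve d (S.map fun v => (v, (0 : ZMod p))) with
  | none => simp [hs] at hy
  | some s =>
    rw [hs] at hy h
    exact h.1.2 y hy

/-- The double annihilator of a list of vectors is its span. -/
theorem forall_mem_annihilator_iff {S : List (List (ZMod p))} (hS : ∀ v ∈ S, v.length = d)
    (x : Fin d → ZMod p) : (∀ y ∈ annihilator d S, vec d y ⬝ᵥ x = 0) ↔
      x ∈ Submodule.span (ZMod p) {y | y ∈ S.map (vec d)} := by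
  have h := describes_solve (d := d) (E := S.map fun v => (v, (0 : ZMod p))) fun e he => by
    obtain ⟨v, hv, rfl⟩ := List.mem_map.1 he
    exact hS v hv
  unfold annihilator
  cases hs : solve d (S.map fun v => (v, (0 : ZMod p))) with
  | none =>
    rw [hs] at h
    exact absurd (by simp) (h 0)
  | some s =>
    rw [hs] at h
    obtain ⟨-, -, h⟩ := h
    -- The system is homogeneous, so the particular solution belongs to the direction.
    have h0 : vec d s.1 ∈ Submodule.span (ZMod p) {y | y ∈ s.2.map (vec d)} := by
      have := (h 0).1 (by simp)
      simpa using this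
    have h' : ∀ y : Fin d → ZMod p, (∀ v ∈ S, vec d v ⬝ᵥ y = 0) ↔
        y ∈ Submodule.span (ZMod p) {y | y ∈ s.2.map (vec d)} := by
      intro y
      rw [← Submodule.sub_mem_iff_left _ h0, ← h y]
      simp
    rw [mem_span_iff_forall_dotProduct]
    simp only [Option.elim_some, Set.mem_ofPred_eq, List.mem_map, forall_exists_index, and_imp,
      forall_apply_eq_imp_iff₂]
    constructor
    · intro hx y hy
      replace hy := (h' y).1 hy
      induction hy using Submodule.span_induction with
      | mem z hz =>
        obtain ⟨v, hv, rfl⟩ := List.mem_map.1 hz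
        exact hx v hv
      | zero => simp
      | add a b _ _ ha hb => rw [add_dotProduct, ha, hb, add_zero]
      | smul c a _ ha => rw [smul_dotProduct, ha, smul_zero]
    · intro hx y hy
      exact hx _ ((h' _).2 (Submodule.subset_span (List.mem_map_of_mem hy)))

end Solve

/-! ### Products of powers of commuting elements of order `p` -/

section PowProd

variable {p : ℕ} {G : Type} [Group G]

theorem Subgroup.commute_of_mem_closure {S T : Set G} (h : ∀ x ∈ S, ∀ y ∈ T, Commute x y)
    {x y : G} (hx : x ∈ Subgroup.closure S) (hy : y ∈ Subgroup.closure T) : Commute x y := by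
  have h1 : Subgroup.closure S ≤ Subgroup.centralizer T :=
    (Subgroup.closure_le _).2 fun x hx => Subgroup.mem_centralizer_iff.2 fun y hy => (h x hx y hy).symm
  have h2 : Subgroup.closure T ≤ Subgroup.centralizer {x} :=
    (Subgroup.closure_le _).2 fun y hy => Subgroup.mem_centralizer_iff.2 fun z hz => by
      rw [Set.mem_singleton_iff.1 hz]
      exact (Subgroup.mem_centralizer_iff.1 (h1 hx) y hy).symm
  exact Subgroup.mem_centralizer_iff.1 (h2 hy) x rfl

/-- The elements of `l` commute and their `p`-th powers are trivial. -/
structure ElementaryList (p : ℕ) (l : List G) : Prop where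
  comm : ∀ u ∈ l, ∀ v ∈ l, Commute u v
  pow : ∀ u ∈ l, u ^ p = 1

theorem ElementaryList.mono {l l' : List G} (h : ElementaryList p l) (hl : ∀ u ∈ l', u ∈ l) :
    ElementaryList p l' :=
  ⟨fun u hu v hv => h.comm u (hl u hu) v (hl v hv), fun u hu => h.pow u (hl u hu)⟩

/-- The product of the powers `u ^ c` for corresponding elements of two lists, i.e., a linear
combination in multiplicative notation. -/
def powProd : List G → List (ZMod p) → G
  | u :: h, j :: c => u ^ j.val * powProd h c
  | _, _ => 1

theorem powProd_mem_closure (h : List G) (c : List (ZMod p)) :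
    powProd h c ∈ Subgroup.closure {u | u ∈ h} := by
  induction h generalizing c with
  | nil => exact one_mem _
  | cons u h ih =>
    cases c with
    | nil => exact one_mem _
    | cons j c =>
      exact mul_mem (pow_mem (Subgroup.subset_closure (by simp)) _)
        (Subgroup.closure_mono (fun v hv => by simp_all) (ih c))

theorem pow_val_add [NeZero p] {u : G} (hu : u ^ p = 1) (i j : ZMod p) :
    u ^ (i + j).val = u ^ i.val * u ^ j.val := by
  rw [ZMod.val_add, ← pow_eq_pow_mod _ hu, pow_add]

theorem powProd_replicate_zero (h : List G) :
    powProd h (List.replicate h.length (0 : ZMod p)) = 1 := by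
  induction h with
  | nil => rfl
  | cons u h ih => simp [List.replicate_succ, powProd, ih]

theorem ElementaryList.powProd_add [NeZero p] {h : List G} (hh : ElementaryList p h)
    {c c' : List (ZMod p)} (hc : c.length = h.length) (hc' : c'.length = h.length) :
    powProd h (List.zipWith (fun x y => x + y) c c') = powProd h c * powProd h c' := by
  induction h generalizing c c' with
  | nil => simp [powProd]
  | cons u h ih =>
    obtain _ | ⟨i, c⟩ := c
    · simp at hc
    obtain _ | ⟨j, c'⟩ := c'
    · simp at hc'
    have h1 := ih (hh.mono fun v hv => by simp [hv]) (by simpa using hc) (by simpa using hc')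
    have h2 : Commute (u ^ j.val) (powProd h c) := by
      refine (Subgroup.commute_of_mem_closure (S := {u}) (T := {v | v ∈ h}) ?_
        (Subgroup.subset_closure rfl) (powProd_mem_closure h c)).pow_left _
      rintro x rfl y hy
      exact hh.comm x (by simp) y (by simp_all)
    simp only [List.zipWith_cons_cons, powProd, h1, pow_val_add (hh.pow u (by simp))]
    rw [mul_assoc, mul_assoc, ← mul_assoc (u ^ j.val), h2.eq, mul_assoc]

/-- In an elementary Abelian group, products of powers exhaust the generated subgroup. -/
theorem ElementaryList.exists_powProd [Fact p.Prime] {h : List G} (hh : ElementaryList p h) {g : G}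
    (hg : g ∈ Subgroup.closure {u | u ∈ h}) :
    ∃ c : List (ZMod p), c.length = h.length ∧ powProd h c = g := by
  induction hg using Subgroup.closure_induction with
  | mem u hu =>
    clear hh
    induction h with
    | nil => simp at hu
    | cons v h ih =>
      by_cases e : u = v
      · exact ⟨1 :: List.replicate h.length 0, by simp, by
          simp [powProd, powProd_replicate_zero, ZMod.val_one, e]⟩
      · obtain ⟨c, hc, hcu⟩ := ih (by simpa [e] using hu)
        exact ⟨0 :: c, by simp [hc], by simp [powProd, hcu]⟩
  | one => exact ⟨_, by simp, powProd_replicate_zero h⟩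
  | mul x y _ _ hx hy =>
    obtain ⟨c, hc, rfl⟩ := hx
    obtain ⟨c', hc', rfl⟩ := hy
    exact ⟨_, by simp [hc, hc'], hh.powProd_add hc hc'⟩
  | inv x _ hx =>
    obtain ⟨c, hc, rfl⟩ := hx
    refine ⟨c.map fun x => -x, by simp [hc], eq_inv_of_mul_eq_one_left ?_⟩
    rw [← hh.powProd_add (by simp [hc]) hc, List.zipWith_map_left]
    convert powProd_replicate_zero h using 2
    rw [← hc]
    refine List.ext_getElem (by simp) fun i h1 h2 => by simp

/-- All products of powers of the elements of `h`, with the lists of the exponents. -/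
def combos (p : ℕ) : List G → List (G × List (ZMod p))
  | [] => [(1, [])]
  | u :: h => (combos p h).flatMap fun e => (zmodList p).map fun j => (u ^ j.val * e.1, j :: e.2)

theorem mem_zmodList [NeZero p] (j : ZMod p) : j ∈ zmodList p :=
  List.mem_map.2 ⟨j.val, List.mem_range.2 (ZMod.val_lt j), ZMod.natCast_zmod_val j⟩

theorem mem_combos [NeZero p] {h : List G} {e : G × List (ZMod p)} :
    e ∈ combos p h ↔ e.2.length = h.length ∧ e.1 = powProd h e.2 := by
  induction h generalizing e with
  | nil =>
    rcases e with ⟨g, _ | ⟨j, c⟩⟩ <;> simp [combos, powProd]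
  | cons u h ih =>
    rcases e with ⟨g, _ | ⟨j, c⟩⟩
    · simp [combos]
    · simp only [combos, List.mem_flatMap, List.mem_map, Prod.mk.injEq, List.cons.injEq, ih,
        List.length_cons, powProd]
      constructor
      · rintro ⟨⟨g', c'⟩, ⟨h1, h2⟩, j', -, rfl, rfl, rfl⟩
        exact ⟨by simpa using h1, by rw [← h2]⟩
      · rintro ⟨h1, rfl⟩
        exact ⟨(powProd h c, c), ⟨by simpa using h1, rfl⟩, j, mem_zmodList j, rfl, rfl, rfl⟩

theorem length_combos (h : List G) : (combos p h).length = p ^ h.length := by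
  induction h with
  | nil => rfl
  | cons u h ih =>
    simp [combos, List.length_flatMap, zmodList, ih, pow_succ]

end PowProd

/-! ### Tables of permutations -/

section Tables

variable {p n : ℕ}

/-- The table of a permutation. -/
def table (u : Equiv.Perm (Fin n)) : List ℕ := List.ofFn fun i => (u i : ℕ)

theorem app_table (u : Equiv.Perm (Fin n)) (a : Fin n) : app (table u) a = u a := by
  simp [app, table]

theorem appPow_table (u : Equiv.Perm (Fin n)) (j : ZMod p) (a : Fin n) :
    appPow (table u) j a = (u ^ j.val) a := by
  unfold appPow
  generalize j.val = k
  induction k with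
  | zero => rfl
  | succ k ih => rw [Function.iterate_succ_apply', ih, app_table, pow_succ', Equiv.Perm.mul_apply]

theorem map_appPow_table (u w : Equiv.Perm (Fin n)) (j : ZMod p) :
    (table w).map (appPow (table u) j) = table (u ^ j.val * w) := by
  simp only [table, List.map_ofFn]
  congr 1
  funext i
  exact appPow_table u j (w i)

theorem table_one : table (1 : Equiv.Perm (Fin n)) = List.range n := by
  refine List.ext_getElem (by simp [table]) fun i h1 h2 => by simp [table]

theorem table_combos_cons (u : Equiv.Perm (Fin n)) (h : List (Equiv.Perm (Fin n))) :
    ((combos p h).map fun e => (table e.1, e.2)).flatMap (fun e => (zmodList p).map fun j =>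
      (e.1.map (appPow (table u) j), j :: e.2)) =
      (combos p (u :: h)).map fun e => (table e.1, e.2) := by
  simp only [combos, List.flatMap_map, List.map_flatMap, List.map_map, Function.comp_def,
    map_appPow_table]

/-- The table of all linear combinations lists just the points of the orbit of `a`. -/
theorem hits_table [NeZero p] (h : List (Equiv.Perm (Fin n))) (a b : Fin n) :
    hits ((combos p h).map fun e => (table e.1, e.2)) a b = true ↔
      ∃ c : List (ZMod p), c.length = h.length ∧ powProd h c a = b := by
  simp only [hits, List.any_map, List.any_eq_true, Function.comp, mem_combos, app_table,
    decide_eq_true_eq, Fin.val_inj]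
  constructor
  · rintro ⟨e, ⟨h1, h2⟩, h3⟩
    exact ⟨e.2, h1, h2 ▸ h3⟩
  · rintro ⟨c, h1, h2⟩
    exact ⟨(powProd h c, c), ⟨h1, rfl⟩, h2⟩

/-- Different exponents yield different images of `a`. -/
def SeparatedAt (p : ℕ) (a : Fin n) (h : List (Equiv.Perm (Fin n))) : Prop :=
  ∀ c c' : List (ZMod p), c.length = h.length → c'.length = h.length →
    powProd h c a = powProd h c' a → c = c'

/-- This is why the bound on the length in `spanStep` is never exceeded. -/
theorem SeparatedAt.pow_length_le [NeZero p] {a : Fin n} {h : List (Equiv.Perm (Fin n))}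
    (hs : SeparatedAt p a h) : p ^ h.length ≤ n := by
  have : Function.Injective fun c : Fin h.length → ZMod p => powProd h (List.ofFn c) a :=
    fun c c' e => List.ofFn_injective (hs _ _ (by simp) (by simp) e)
  simpa using Fintype.card_le_of_injective _ this

/-- A permutation that moves `a` out of its orbit under `h` extends a basis: otherwise a power of it
with exponent prime to `p`, and hence the permutation itself, would not move `a` out of the orbit. -/
theorem SeparatedAt.cons [Fact p.Prime] {a : Fin n} {u : Equiv.Perm (Fin n)}
    {h : List (Equiv.Perm (Fin n))} (hs : SeparatedAt p a h) (he : ElementaryList p (u :: h))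
    (hu : ¬ ∃ c : List (ZMod p), c.length = h.length ∧ powProd h c a = u a) :
    SeparatedAt p a (u :: h) := by
  rintro (_ | ⟨i, c⟩) (_ | ⟨j, c'⟩) hc hc' e
  · simp at hc
  · simp at hc
  · simp at hc'
  have hcomm : ∀ g ∈ Subgroup.closure {v | v ∈ h}, Commute u g := by
    intro g hg
    refine Subgroup.commute_of_mem_closure (S := {u}) ?_ (Subgroup.subset_closure rfl) hg
    rintro x rfl y hy
    exact he.comm x (by simp) y (by simp_all)
  have hw := powProd_mem_closure h c
  have hw' := powProd_mem_closure h c'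
  have hup := he.pow u (by simp)
  simp only [powProd, Equiv.Perm.mul_apply] at e
  have hij : i = j := by
    by_contra hne
    set k := i - j with hk
    have hk0 : k ≠ 0 := sub_ne_zero.2 hne
    set g := (powProd h c)⁻¹ * powProd h c' with hg
    have hgm : g ∈ Subgroup.closure {v | v ∈ h} := mul_mem (inv_mem hw) hw'
    have e1 : (u ^ k.val) a = g a := by
      have h1 : u ^ i.val = u ^ j.val * u ^ k.val := by
        rw [← pow_val_add hup, hk]; congr 2; ring
      rw [h1, Equiv.Perm.mul_apply] at e
      have h2 := (u ^ j.val).injective e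
      rw [← Equiv.Perm.mul_apply, ((hcomm _ hw).pow_left _).eq, Equiv.Perm.mul_apply] at h2
      rw [hg, Equiv.Perm.mul_apply, ← h2, ← Equiv.Perm.mul_apply, inv_mul_cancel, Equiv.Perm.one_apply]
    have e2 : ∀ m : ℕ, ((u ^ k.val) ^ m) a = (g ^ m) a := by
      intro m
      induction m with
      | zero => rfl
      | succ m ih =>
        rw [pow_succ', Equiv.Perm.mul_apply, ih, ← Equiv.Perm.mul_apply,
          (((hcomm _ hgm).pow_left _).pow_right _).eq, Equiv.Perm.mul_apply, e1,
          ← Equiv.Perm.mul_apply, ← pow_succ]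
    have e3 : (u ^ k.val) ^ (k⁻¹).val = u := by
      rw [← pow_mul, pow_eq_pow_mod _ hup, ← ZMod.val_mul, mul_inv_cancel₀ hk0, ZMod.val_one,
        pow_one]
    have e4 := e2 (k⁻¹).val
    rw [e3] at e4
    obtain ⟨c'', h1, h2⟩ := (he.mono fun v hv => by simp [hv]).exists_powProd (pow_mem hgm (k⁻¹).val)
    exact hu ⟨c'', h1, by rw [h2, e4]⟩
  subst hij
  rw [hs c c' (by simpa using hc) (by simpa using hc') ((u ^ i.val).injective e)]

theorem mem_orbit_cons {a b : Fin n} (u : Equiv.Perm (Fin n)) {h : List (Equiv.Perm (Fin n))}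
    (hb : ∃ c : List (ZMod p), c.length = h.length ∧ powProd h c a = b) :
    ∃ c : List (ZMod p), c.length = (u :: h).length ∧ powProd (u :: h) c a = b := by
  obtain ⟨c, h1, rfl⟩ := hb
  exact ⟨0 :: c, by simp [h1], by simp [powProd]⟩

/-- The partition `Q` maintained by `buildBasis` is finer than the partition into orbits of the
extracted vectors, and has the same class of `a`.  This class consists of the images of `a` listed in
the table of `spanTable`. -/
theorem foldl_spanStep_eq [Fact p.Prime] {a : Fin n} (l h : List (Equiv.Perm (Fin n)))
    (Q : Setoid (Fin n)) (he : ElementaryList p (l ++ h)) (hs : SeparatedAt p a h)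
    (hQ : ∀ x y, Q x y → ∃ g ∈ Subgroup.closure {u | u ∈ h}, g x = y)
    (hQa : ∀ c : List (ZMod p), c.length = h.length → Q a (powProd h c a)) :
    (l.map table).foldl (spanStep n a)
        (h.map table, (combos p h).map fun e => (table e.1, e.2)) =
      ((buildBasis a l h Q).map table,
        (combos p (buildBasis a l h Q)).map fun e => (table e.1, e.2)) ∧
    (∀ u ∈ buildBasis a l h Q, u ∈ l ++ h) ∧ SeparatedAt p a (buildBasis a l h Q) ∧
    (∀ b, (∃ c : List (ZMod p), c.length = h.length ∧ powProd h c a = b) →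
      ∃ c : List (ZMod p), c.length = (buildBasis a l h Q).length ∧
        powProd (buildBasis a l h Q) c a = b) ∧
    ∀ u ∈ l, ∃ c : List (ZMod p), c.length = (buildBasis a l h Q).length ∧
        powProd (buildBasis a l h Q) c a = u a := by
  induction l generalizing h Q with
  | nil => exact ⟨rfl, by simp [buildBasis], hs, fun b hb => hb, by simp⟩
  | cons u l ih =>
    have hheh : ElementaryList p h := he.mono fun v hv => by simp [hv]
    have hiff : Q a (u a) ↔ ∃ c : List (ZMod p), c.length = h.length ∧ powProd h c a = u a := by
      constructor
      · intro hq
        obtain ⟨g, hg, hga⟩ := hQ _ _ hq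
        obtain ⟨c, h1, rfl⟩ := hheh.exists_powProd hg
        exact ⟨c, h1, hga⟩
      · rintro ⟨c, h1, h2⟩
        exact h2 ▸ hQa c h1
    have hle : decide (n + 1 ≤ ((combos p h).map fun e => (table e.1, e.2)).length) = false := by
      have := hs.pow_length_le
      simp [length_combos]; omega
    have hany : ((combos p h).map fun e => (table e.1, e.2)).any
        (fun e => decide (app e.1 a = app (table u) a)) =
        hits ((combos p h).map fun e => (table e.1, e.2)) a (u a) := by
      rw [hits, app_table]
    rw [List.map_cons, List.foldl_cons, spanStep, hle, hany, Bool.or_false]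
    by_cases hq : Q a (u a)
    · rw [(hits_table h a (u a)).2 (hiff.1 hq), cond_true]
      obtain ⟨h1, h2, h3, h4, h5⟩ := ih h Q (he.mono fun v hv => by
        simp only [List.mem_append, List.mem_cons] at hv ⊢; tauto) hs hQ hQa
      have e : buildBasis a (u :: l) h Q = buildBasis a l h Q := by
        rw [buildBasis, if_pos hq]
      rw [e]
      refine ⟨h1, fun v hv => by
        have := h2 v hv; simp only [List.mem_append, List.mem_cons] at this ⊢; tauto, h3, h4, fun v hv => ?_⟩
      rcases List.mem_cons.1 hv with rfl | hv
      · exact h4 _ (hiff.1 hq)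
      · exact h5 v hv
    · rw [Bool.eq_false_iff.2 (fun hh => hq (hiff.2 ((hits_table h a (u a)).1 hh))), cond_false,
        table_combos_cons]
      have huh : ElementaryList p (u :: h) := he.mono fun v hv => by
        simp only [List.mem_append, List.mem_cons] at hv ⊢; tauto
      have hle : Subgroup.closure {v | v ∈ h} ≤ Subgroup.closure {v | v ∈ u :: h} :=
        Subgroup.closure_mono fun v hv => by simp_all
      have huc : u ∈ Subgroup.closure {v | v ∈ u :: h} := Subgroup.subset_closure (by simp)
      have k1 : ∀ x y, (Equiv.Perm.SameCycle.setoid u ⊔ Q) x y →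
          ∃ g ∈ Subgroup.closure {v | v ∈ u :: h}, g x = y := by
        have key : Equiv.Perm.SameCycle.setoid u ⊔ Q ≤
            MulAction.orbitRel (Subgroup.closure {v | v ∈ u :: h}) (Fin n) := by
          refine sup_le (fun x y hxy => ?_) (fun x y hxy => ?_)
          · obtain ⟨i, hi⟩ := hxy
            refine Setoid.symm' _ (MulAction.orbitRel_apply.2 ⟨⟨u ^ i, zpow_mem huc i⟩, hi⟩)
          · obtain ⟨g, hg, hi⟩ := hQ x y hxy
            refine Setoid.symm' _ (MulAction.orbitRel_apply.2 ⟨⟨g, hle hg⟩, hi⟩)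
        intro x y hxy
        obtain ⟨g, hg⟩ := MulAction.orbitRel_apply.1 (Setoid.symm' _ (key hxy))
        exact ⟨g.1, g.2, hg⟩
      have k2 : ∀ c : List (ZMod p), c.length = (u :: h).length →
          (Equiv.Perm.SameCycle.setoid u ⊔ Q) a (powProd (u :: h) c a) := by
        rintro (_ | ⟨j, c⟩) hc
        · simp at hc
        · refine Setoid.trans' _ (Setoid.le_def.1 le_sup_right (hQa c (by simpa using hc))) ?_
          refine Setoid.le_def.1 le_sup_left ?_
          exact ⟨(j.val : ℤ), by rw [zpow_natCast]; rfl⟩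
      obtain ⟨h1, h2, h3, h4, h5⟩ := ih (u :: h) (Equiv.Perm.SameCycle.setoid u ⊔ Q)
        (he.mono fun v hv => by
          simp only [List.mem_append, List.mem_cons] at hv ⊢; tauto)
        (hs.cons huh fun h' => hq (hiff.2 h')) k1 k2
      have e : buildBasis a (u :: l) h Q =
          buildBasis a l (u :: h) (Equiv.Perm.SameCycle.setoid u ⊔ Q) := by
        rw [buildBasis, if_neg hq]
      rw [e]
      refine ⟨h1, fun v hv => by
          have := h2 v hv; simp only [List.mem_append, List.mem_cons] at this ⊢; tauto, h3,
        fun b hb => h4 b (mem_orbit_cons u hb), fun v hv => ?_⟩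
      rcases List.mem_cons.1 hv with rfl | hv
      · refine h4 _ ?_
        obtain ⟨c, hc, hcv⟩ := huh.exists_powProd huc
        exact ⟨c, hc, by rw [hcv]⟩
      · exact h5 v hv

/-- What `spanTable` computes for permutations that generate an elementary Abelian group. -/
theorem spanTable_spec [Fact p.Prime] (a : Fin n) {l : List (Equiv.Perm (Fin n))}
    (he : ElementaryList p l) :
    spanTable p n a (l.map table) = ((buildBasis a l [] ⊥).map table,
        (combos p (buildBasis a l [] ⊥)).map fun e => (table e.1, e.2)) ∧
    (∀ u ∈ buildBasis a l [] ⊥, u ∈ l) ∧ SeparatedAt p a (buildBasis a l [] ⊥) ∧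
    ∀ g ∈ Subgroup.closure {u | u ∈ l}, ∃ c : List (ZMod p),
      c.length = (buildBasis a l [] ⊥).length ∧ powProd (buildBasis a l [] ⊥) c a = g a := by
  have hs : SeparatedAt p a [] := fun c c' hc hc' _ => by simp_all
  obtain ⟨h1, h2, h3, -, h5⟩ := foldl_spanStep_eq l [] ⊥ (by simpa using he) hs
    (fun x y hxy => ⟨1, one_mem _, by simpa [Setoid.bot_def] using hxy⟩)
    (fun c hc => Setoid.refl' _ _)
  set h := buildBasis a l [] ⊥
  have h2' : ∀ u ∈ h, u ∈ l := fun u hu => by simpa using h2 u hu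
  refine ⟨?_, h2', h3, fun g hg => ?_⟩
  · rw [← h1, spanTable, ← table_one]; rfl
  · have hcl : ∀ x ∈ Subgroup.closure {u | u ∈ l}, ∀ y ∈ Subgroup.closure {u | u ∈ h},
        Commute x y := fun x hx y hy =>
      Subgroup.commute_of_mem_closure (fun u hu v hv => he.comm u hu v (h2' v hv)) hx hy
    suffices H : ∃ w ∈ Subgroup.closure {u | u ∈ h}, w a = g a by
      obtain ⟨w, hw, hwa⟩ := H
      obtain ⟨c, hc, rfl⟩ := (he.mono h2').exists_powProd hw
      exact ⟨c, hc, hwa⟩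
    induction hg using Subgroup.closure_induction with
    | mem u hu =>
      obtain ⟨c, hc, hcu⟩ := h5 u hu
      exact ⟨_, powProd_mem_closure h c, hcu⟩
    | one => exact ⟨1, one_mem _, rfl⟩
    | mul x y hx _ h1 h2 =>
      obtain ⟨v, hv, hva⟩ := h1
      obtain ⟨w, hw, hwa⟩ := h2
      refine ⟨w * v, mul_mem hw hv, ?_⟩
      rw [Equiv.Perm.mul_apply, hva, Equiv.Perm.mul_apply, ← hwa, ← Equiv.Perm.mul_apply,
        ← Equiv.Perm.mul_apply, (hcl x hx w hw).eq]
    | inv x hx h1 =>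
      obtain ⟨v, hv, hva⟩ := h1
      refine ⟨v⁻¹, inv_mem hv, x.injective ?_⟩
      rw [← Equiv.Perm.mul_apply, (hcl x hx _ (inv_mem hv)).eq, Equiv.Perm.mul_apply, ← hva]
      simp

end Tables

/-! ### Transitive constituents and the super-space -/

namespace GroupConstraint

variable {p : ℕ} {A : Type} (I : GroupConstraint p A)

theorem mem_group_of_mem_gens {g : Equiv.Perm A} (hg : g ∈ I.gens) : g ∈ I.group :=
  Subgroup.subset_closure hg

theorem elementaryList_gens : ElementaryList p I.gens :=
  ⟨fun u hu v hv => I.elementary.1 u (I.mem_group_of_mem_gens hu) v (I.mem_group_of_mem_gens hv),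
    fun _ hu => I.pow_eq_one (I.mem_group_of_mem_gens hu)⟩

theorem mem_orbit_iff {a b : A} : b ∈ I.orbit a ↔ ∃ g ∈ I.group, g a = b :=
  ⟨fun ⟨g, hg⟩ => ⟨g.1, g.2, hg⟩, fun ⟨g, hg, h⟩ => ⟨⟨g, hg⟩, h⟩⟩

theorem self_mem_orbit (a : A) : a ∈ I.orbit a := MulAction.mem_orbit_self a

theorem orbit_eq_of_mem {a b : A} (h : b ∈ I.orbit a) : I.orbit b = I.orbit a :=
  MulAction.orbit_eq_iff.2 h

/-- The restriction to the orbit of `a`, as a homomorphism. -/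
noncomputable def restrictHom (a : A) : I.group →* Equiv.Perm A where
  toFun g := restrictPerm g.1 (I.orbit a)
  map_one' := by
    classical
    ext x
    simp [I.restrictPerm_apply (one_mem I.group)]
  map_mul' g h := by
    classical
    ext x
    have h1 : ((g * h : I.group) : Equiv.Perm A) = g.1 * h.1 := rfl
    rw [h1, Equiv.Perm.mul_apply, I.restrictPerm_apply (mul_mem g.2 h.2),
      I.restrictPerm_apply h.2, I.restrictPerm_apply g.2]
    by_cases hx : x ∈ I.orbit a <;> simp [hx, I.apply_mem_orbit_iff h.2]

theorem mem_constituent_iff {a : A} {w : Equiv.Perm A} :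
    w ∈ I.constituent (I.orbit a) ↔ w ∈ (I.restrictHom a).range :=
  ⟨fun ⟨g, hg, h⟩ => ⟨⟨g, hg⟩, h.symm⟩, fun ⟨g, h⟩ => ⟨g.1, g.2, h.symm⟩⟩

theorem apply_of_mem_constituent {a x : A} {w : Equiv.Perm A}
    (hw : w ∈ I.constituent (I.orbit a)) (hx : x ∉ I.orbit a) : w x = x := by
  obtain ⟨g, hg, rfl⟩ := hw
  rw [I.restrictPerm_apply hg, if_neg hx]

theorem restrictPerm_apply_of_mem {a x : A} {g : Equiv.Perm A} (hg : g ∈ I.group)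
    (hx : x ∈ I.orbit a) : restrictPerm g (I.orbit a) x = g x := by
  rw [I.restrictPerm_apply hg, if_pos hx]

theorem apply_mem_orbit_of_mem_constituent {a x : A} {w : Equiv.Perm A}
    (hw : w ∈ I.constituent (I.orbit a)) (hx : x ∈ I.orbit a) : w x ∈ I.orbit a := by
  obtain ⟨g, hg, rfl⟩ := hw
  rw [I.restrictPerm_apply_of_mem hg hx, I.apply_mem_orbit_iff hg]
  exact hx

/-- A transitive constituent is regular, since it is Abelian. -/
theorem constituent_ext {a : A} {w w' : Equiv.Perm A} (hw : w ∈ I.constituent (I.orbit a))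
    (hw' : w' ∈ I.constituent (I.orbit a)) (h : w a = w' a) : w = w' := by
  ext x
  by_cases hx : x ∈ I.orbit a
  · obtain ⟨g, hg, rfl⟩ := hw
    obtain ⟨g', hg', rfl⟩ := hw'
    rw [I.restrictPerm_apply_of_mem hg (I.self_mem_orbit a),
      I.restrictPerm_apply_of_mem hg' (I.self_mem_orbit a)] at h
    rw [I.restrictPerm_apply_of_mem hg hx, I.restrictPerm_apply_of_mem hg' hx]
    obtain ⟨k, hk, rfl⟩ := I.mem_orbit_iff.1 hx
    rw [← Equiv.Perm.mul_apply, ← Equiv.Perm.mul_apply, I.elementary.1 g hg k hk,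
      I.elementary.1 g' hg' k hk, Equiv.Perm.mul_apply, Equiv.Perm.mul_apply, h]
  · rw [I.apply_of_mem_constituent hw hx, I.apply_of_mem_constituent hw' hx]

/-- The generators of the transitive constituent of `a`. -/
noncomputable def restrictedGens (a : A) : List (Equiv.Perm A) :=
  I.gens.map fun g => restrictPerm g (I.orbit a)

theorem elementaryList_restrictedGens (a : A) : ElementaryList p (I.restrictedGens a) := by
  constructor
  · intro u hu v hv
    obtain ⟨g, hg, rfl⟩ := List.mem_map.1 hu
    obtain ⟨h, hh, rfl⟩ := List.mem_map.1 hv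
    exact I.restrictPerm_comm (I.mem_group_of_mem_gens hg) (I.mem_group_of_mem_gens hh) a a
  · intro u hu
    obtain ⟨g, hg, rfl⟩ := List.mem_map.1 hu
    exact I.restrictPerm_pow (I.mem_group_of_mem_gens hg) a

theorem closure_restrictedGens (a : A) :
    Subgroup.closure {u | u ∈ I.restrictedGens a} = (I.restrictHom a).range := by
  refine le_antisymm ((Subgroup.closure_le _).2 fun u hu => ?_) ?_
  · obtain ⟨g, hg, rfl⟩ := List.mem_map.1 hu
    exact ⟨⟨g, I.mem_group_of_mem_gens hg⟩, rfl⟩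
  · rintro _ ⟨⟨g, hg⟩, rfl⟩
    refine Subgroup.closure_induction (p := fun g hg =>
      I.restrictHom a ⟨g, hg⟩ ∈ Subgroup.closure {u | u ∈ I.restrictedGens a}) ?_ ?_ ?_ ?_ hg
    · exact fun x hx => Subgroup.subset_closure (List.mem_map.2 ⟨x, hx, rfl⟩)
    · exact (map_one (I.restrictHom a)).symm ▸ one_mem _
    · intro x y hx hy h1 h2
      have := map_mul (I.restrictHom a) ⟨x, hx⟩ ⟨y, hy⟩
      exact (this ▸ mul_mem h1 h2 : I.restrictHom a (⟨x, hx⟩ * ⟨y, hy⟩) ∈ _)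
    · intro x hx h1
      have := map_inv (I.restrictHom a) ⟨x, hx⟩
      exact (this ▸ inv_mem h1 : I.restrictHom a (⟨x, hx⟩⁻¹) ∈ _)

theorem constituent_subset_superGroup (a : A) {w : Equiv.Perm A}
    (hw : w ∈ I.constituent (I.orbit a)) : w ∈ I.superGroup :=
  Subgroup.subset_closure (Set.mem_iUnion.2 ⟨a, hw⟩)

open scoped Classical in
/-- A permutation as a vector of the super-space (zero if it does not belong to it). -/
noncomputable def toSuper (w : Equiv.Perm A) : I.Super :=
  if h : w ∈ I.superGroup then Additive.ofMul ⟨w, h⟩ else 0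

theorem toPerm_toSuper {w : Equiv.Perm A} (hw : w ∈ I.superGroup) :
    I.toPerm (I.toSuper w) = w := by
  rw [toSuper, dif_pos hw]; rfl

theorem toPerm_mem (u : I.Super) : I.toPerm u ∈ I.superGroup := u.toMul.2

theorem toPerm_injective : Function.Injective I.toPerm := fun _ _ h => Subtype.ext h

theorem toSuper_toPerm (u : I.Super) : I.toSuper (I.toPerm u) = u :=
  I.toPerm_injective (I.toPerm_toSuper (I.toPerm_mem u))

@[simp] theorem toPerm_zero : I.toPerm 0 = 1 := rfl

@[simp] theorem toPerm_add (u v : I.Super) : I.toPerm (u + v) = I.toPerm u * I.toPerm v := rfl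

@[simp] theorem toPerm_neg (u : I.Super) : I.toPerm (-u) = (I.toPerm u)⁻¹ := rfl

theorem toPerm_smul [NeZero p] (c : ZMod p) (u : I.Super) :
    I.toPerm (c • u) = I.toPerm u ^ c.val := by
  have h : c • u = c.val • u := by
    conv_lhs => rw [← ZMod.natCast_zmod_val c]
    exact Nat.cast_smul_eq_nsmul (ZMod p) c.val u
  rw [h]
  generalize c.val = k
  induction k with
  | zero => simp
  | succ k ih => rw [succ_nsmul, toPerm_add, ih, pow_succ]

/-- On the orbit of `o i`, a sum of vectors that act on different orbits acts as its `i`-th term. -/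
theorem toPerm_sum_apply {ι : Type} (S : Finset ι) (o : ι → A)
    (ho : ∀ i ∈ S, ∀ j ∈ S, I.orbit (o i) = I.orbit (o j) → i = j) (w : ι → I.Super)
    (hw : ∀ i ∈ S, I.toPerm (w i) ∈ I.constituent (I.orbit (o i))) {i : ι} (hi : i ∈ S) {b : A}
    (hb : b ∈ I.orbit (o i)) : I.toPerm (∑ j ∈ S, w j) b = I.toPerm (w i) b := by
  classical
  rw [← Finset.add_sum_erase S w hi, toPerm_add, Equiv.Perm.mul_apply]
  congr 1
  refine Finset.sum_induction w (fun u => I.toPerm u b = b) (fun u v hu hv => ?_) rfl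
    fun j hj => ?_
  · rw [toPerm_add, Equiv.Perm.mul_apply, hv, hu]
  · have hjS := Finset.mem_of_mem_erase hj
    refine I.apply_of_mem_constituent (hw j hjS) fun hbj => Finset.ne_of_mem_erase hj ?_
    exact ho j hjS i hi ((I.orbit_eq_of_mem hbj).symm.trans (I.orbit_eq_of_mem hb))

theorem sum_toSuper_restrictPerm {R : Finset A}
    (hR : ∀ a ∈ R, ∀ b ∈ R, I.orbit a = I.orbit b → a = b)
    (hRA : ∀ a, ∃ b ∈ R, I.orbit a = I.orbit b) {g : Equiv.Perm A} (hg : g ∈ I.group) :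
    I.toPerm (∑ a ∈ R, I.toSuper (restrictPerm g (I.orbit a))) = g := by
  ext x
  obtain ⟨a, ha, hxa⟩ := hRA x
  have hx : x ∈ I.orbit a := hxa ▸ I.self_mem_orbit x
  have hc : ∀ b, restrictPerm g (I.orbit b) ∈ I.constituent (I.orbit b) := fun b => ⟨g, hg, rfl⟩
  have ht : ∀ b, I.toPerm (I.toSuper (restrictPerm g (I.orbit b))) =
      restrictPerm g (I.orbit b) := fun b =>
    I.toPerm_toSuper (I.constituent_subset_superGroup b (hc b))
  rw [I.toPerm_sum_apply R id hR _ (fun b _ => (ht b).symm ▸ hc b) ha hx, ht,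
    I.restrictPerm_apply_of_mem hg hx]

theorem mem_V_mk {a : A} {u : I.Super} :
    u ∈ I.V (Quotient.mk'' a) ↔ I.toPerm u ∈ I.constituent (I.orbit a) ∧
      ∀ b ∈ I.orbit a, I.toPerm u b ∈ I.C b := by
  have e : MulAction.orbitRel.Quotient.orbit (Quotient.mk'' a : I.Orbits) = I.orbit a := rfl
  simp only [V, e, Set.mem_iInter, diffSet, Set.mem_ofPred_eq]
  constructor
  · intro h
    exact ⟨(h a (I.self_mem_orbit a)).1, fun b hb => (h b hb).2⟩
  · rintro ⟨h1, h2⟩ b hb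
    exact ⟨(I.orbit_eq_of_mem hb).symm ▸ h1, h2 b hb⟩

theorem orbits_mk_eq_iff {a b : A} :
    (Quotient.mk'' a : I.Orbits) = Quotient.mk'' b ↔ I.orbit a = I.orbit b := by
  rw [Quotient.eq'']
  exact MulAction.orbitRel_apply.trans
    ⟨fun h => I.orbit_eq_of_mem h,
      fun h => (h ▸ I.self_mem_orbit a : a ∈ I.orbit b)⟩

/-- If the constraint is linear and no `V_O` is empty, then every `V_O` is the intersection of the
transitive constituent with a linear variety. -/
theorem exists_submodule_of_isLinear [Finite A] (hlin : I.IsLinear)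
    (hne : ∀ O, (I.V O).Nonempty) :
    ∃ E : Submodule (ZMod p) I.Super, ∀ (a : A), ∀ v₀ ∈ I.V (Quotient.mk'' a), ∀ x,
      x ∈ I.V (Quotient.mk'' a) ↔ I.toPerm x ∈ I.constituent (I.orbit a) ∧ x - v₀ ∈ E := by
  classical
  let _ : Fintype I.Orbits := Fintype.ofFinite _
  have hsum : ∀ u, u ∈ I.sumV ↔ ∃ v : I.Orbits → I.Super, (∀ O, v O ∈ I.V O) ∧ u = ∑ O, v O :=
    fun u => Iff.rfl
  choose t ht using hne
  have h0 : ∑ O, t O ∈ I.sumV := (hsum _).2 ⟨t, ht, rfl⟩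
  obtain he | ⟨w, E, hE⟩ := hlin
  · rw [he] at h0
    exact absurd h0 (Set.notMem_empty _)
  have hdiff : ∀ s ∈ I.sumV, ∀ s', s' ∈ I.sumV ↔ s' - s ∈ E := by
    intro s hs s'
    rw [hE] at hs ⊢
    obtain ⟨e, he, rfl⟩ := hs
    constructor
    · rintro ⟨e', he', rfl⟩
      simpa using E.sub_mem he' he
    · intro h
      exact ⟨s' - w, by simpa [sub_add] using E.add_mem h he, by abel⟩
  refine ⟨E, fun a v₀ hv₀ x => ?_⟩
  set O : I.Orbits := Quotient.mk'' a with hO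
  have hup : ∀ v ∈ I.V O, ∀ O', Function.update t O v O' ∈ I.V O' := by
    intro v hv O'
    by_cases h : O' = O
    · subst h; simpa using hv
    · simpa [h] using ht O'
  have hsub : ∀ v v', ∑ O', Function.update t O v O' - ∑ O', Function.update t O v' O' =
      v - v' := by
    intro v v'
    rw [Finset.sum_update_of_mem (Finset.mem_univ _), Finset.sum_update_of_mem (Finset.mem_univ _)]
    abel
  have hs₀ := (hsum _).2 ⟨_, hup v₀ hv₀, rfl⟩
  constructor
  · intro hx
    refine ⟨(I.mem_V_mk.1 hx).1, ?_⟩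
    rw [← hsub x v₀]
    exact (hdiff _ hs₀ _).1 ((hsum _).2 ⟨_, hup x hx, rfl⟩)
  · rintro ⟨hxc, hx⟩
    rw [← hsub x v₀, ← hdiff _ hs₀] at hx
    obtain ⟨v, hv, hxv⟩ := (hsum _).1 hx
    -- Both sums act on the orbit `O` as their terms at `O`, which are therefore equal.
    have hout : ∀ O' : I.Orbits, (Quotient.mk'' O'.out : I.Orbits) = O' := fun O' =>
      Quotient.out_eq' O'
    have ho : ∀ O' ∈ (Finset.univ : Finset I.Orbits), ∀ O'' ∈ (Finset.univ : Finset I.Orbits),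
        I.orbit O'.out = I.orbit O''.out → O' = O'' := by
      intro O' _ O'' _ h
      rw [← hout O', ← hout O'', I.orbits_mk_eq_iff.2 h]
    have haO : I.orbit O.out = I.orbit a := I.orbits_mk_eq_iff.1 ((hout O).trans hO)
    have hVc : ∀ O' v', v' ∈ I.V O' → I.toPerm v' ∈ I.constituent (I.orbit O'.out) := by
      intro O' v' h
      rw [← hout O'] at h
      exact (I.mem_V_mk.1 h).1
    have hxc' : I.toPerm x ∈ I.constituent (I.orbit O.out) := haO ▸ hxc
    have haO' : a ∈ I.orbit O.out := haO ▸ I.self_mem_orbit a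
    have e1 := I.toPerm_sum_apply Finset.univ (fun O' : I.Orbits => O'.out) ho
      (Function.update t O x) (fun O' _ => by
        by_cases h : O' = O
        · subst h; simpa using hxc'
        · simpa [h] using hVc O' _ (ht O')) (Finset.mem_univ O) haO'
    have e2 := I.toPerm_sum_apply Finset.univ (fun O' : I.Orbits => O'.out) ho v
      (fun O' _ => hVc O' _ (hv O')) (Finset.mem_univ O) haO'
    rw [hxv, e2, Function.update_self] at e1
    have : v O = x := I.toPerm_injective
      (I.constituent_ext (haO ▸ hVc O _ (hv O)) hxc e1)
    exact this ▸ hv O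

end GroupConstraint

/-! ### Linear combinations of lists -/

section LinComb

variable {K V α : Type} [Field K] [AddCommGroup V] [Module K V]

/-- The linear combination of the vectors of a list with the coefficients of another list. -/
def linComb : List V → List K → V
  | v :: l, c :: cs => c • v + linComb l cs
  | _, _ => 0

theorem linComb_append {l : List V} {c : List K} (h : c.length = l.length) (l' : List V)
    (c' : List K) : linComb (l ++ l') (c ++ c') = linComb l c + linComb l' c' := by
  induction l generalizing c with
  | nil =>
    rw [List.length_nil, List.length_eq_zero_iff] at h
    simp [h, linComb]
  | cons v l ih =>
    obtain _ | ⟨x, c⟩ := c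
    · simp at h
    · simp [linComb, ih (by simpa using h), add_assoc]

theorem linComb_flatMap (R : List α) {l : α → List V} {c : α → List K}
    (h : ∀ a ∈ R, (c a).length = (l a).length) :
    linComb (R.flatMap l) (R.flatMap c) = (R.map fun a => linComb (l a) (c a)).sum := by
  induction R with
  | nil => rfl
  | cons a R ih =>
    rw [List.flatMap_cons, List.flatMap_cons, linComb_append (h a (by simp)),
      ih fun b hb => h b (by simp [hb])]
    simp

theorem linComb_mem_span (l : List V) (c : List K) :
    linComb l c ∈ Submodule.span K {v | v ∈ l} := by
  induction l generalizing c with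
  | nil => exact Submodule.zero_mem _
  | cons v l ih =>
    obtain _ | ⟨x, c⟩ := c
    · exact Submodule.zero_mem _
    · exact Submodule.add_mem _ (Submodule.smul_mem _ _ (Submodule.subset_span (by simp)))
        (Submodule.span_mono (fun w hw => by simp_all) (ih c))

theorem linComb_eq_sum {p : ℕ} [Fact p.Prime] [Module (ZMod p) V] (l : List V)
    (c : List (ZMod p)) : linComb l c = ∑ i, vec l.length c i • l.get i := by
  induction l generalizing c with
  | nil => rfl
  | cons v l ih =>
    have e := Fin.sum_univ_succ (n := l.length)
      fun i : Fin (l.length + 1) => vec (l.length + 1) c i • (v :: l).get i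
    refine Eq.trans ?_ e.symm
    obtain _ | ⟨x, c⟩ := c
    · simp [linComb, vec]
    · simp only [linComb, ih]
      congr 1

theorem length_flatMap_congr {β γ : Type} (R : List α) {l : α → List β} {c : α → List γ}
    (h : ∀ a ∈ R, (c a).length = (l a).length) :
    (R.flatMap c).length = (R.flatMap l).length := by
  rw [List.length_flatMap, List.length_flatMap]
  exact congrArg List.sum (List.map_congr_left h)

/-- A list can be split into blocks of given lengths. -/
theorem exists_eq_flatMap {β γ : Type} {R : List α} (hR : R.Nodup) (l : α → List β)
    {x : List γ} (hx : x.length = (R.flatMap l).length) :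
    ∃ c : α → List γ, (∀ a ∈ R, (c a).length = (l a).length) ∧ x = R.flatMap c := by
  classical
  induction R generalizing x with
  | nil => exact ⟨fun _ => [], by simp, by simpa using hx⟩
  | cons a R ih =>
    obtain ⟨ha, hR⟩ := List.nodup_cons.1 hR
    rw [List.flatMap_cons, List.length_append] at hx
    obtain ⟨c, hc, hxc⟩ := ih hR (x := x.drop (l a).length)
      (by rw [List.length_drop]; omega)
    refine ⟨Function.update c a (x.take (l a).length), fun b hb => ?_, ?_⟩
    · rcases List.mem_cons.1 hb with rfl | hb
      · simp; omega
      · rw [Function.update_of_ne (ne_of_mem_of_not_mem hb ha)]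
        exact hc b hb
    · have e : R.flatMap (Function.update c a (x.take (l a).length)) = R.flatMap c :=
        List.flatMap_congr fun b hb => by
          rw [Function.update_of_ne (ne_of_mem_of_not_mem hb ha)]
      rw [List.flatMap_cons, e, ← hxc, Function.update_self, List.take_append_drop]

theorem dot_flatMap {p : ℕ} (R : List α) {r v : α → List (ZMod p)}
    (h : ∀ a ∈ R, (r a).length = (v a).length) :
    dot (R.flatMap r) (R.flatMap v) = (R.map fun a => dot (r a) (v a)).sum := by
  induction R with
  | nil => rfl
  | cons a R ih =>
    have := ih fun b hb => h b (by simp [hb])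
    simp only [dot] at this ⊢
    rw [List.flatMap_cons, List.flatMap_cons, List.zipWith_append (h a (by simp)),
      List.sum_append, this]
    simp

theorem dot_replicate_zero {p : ℕ} (k : ℕ) (v : List (ZMod p)) :
    dot (List.replicate k 0) v = 0 := by
  induction k generalizing v with
  | zero => simp [dot]
  | succ k ih =>
    cases v with
    | nil => simp [dot]
    | cons x v => simpa [dot, List.replicate_succ] using ih v

end LinComb

/-! ### The blocks of the computed basis -/

namespace GroupConstraint

section Data

variable {p n : ℕ} (I : GroupConstraint p (Fin n))

open scoped Classical in
/-- The smallest points of the orbits. -/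
noncomputable def repList : List (Fin n) :=
  (List.finRange n).filter fun a => decide (∀ b < a, b ∉ I.orbit a)

theorem nodup_repList : I.repList.Nodup := (List.nodup_finRange n).filter _

theorem eq_of_mem_repList {a b : Fin n} (ha : a ∈ I.repList) (hb : b ∈ I.repList)
    (h : I.orbit a = I.orbit b) : a = b := by
  simp only [repList, List.mem_filter, decide_eq_true_eq] at ha hb
  by_contra hne
  rcases lt_or_gt_of_ne hne with hlt | hlt
  · exact hb.2 a hlt (h ▸ I.self_mem_orbit a)
  · exact ha.2 b hlt (h ▸ I.self_mem_orbit b)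

theorem exists_mem_repList (a : Fin n) : ∃ b ∈ I.repList, I.orbit a = I.orbit b := by
  classical
  obtain ⟨b, hb, hmin⟩ := WellFounded.has_min (wellFounded_lt (α := Fin n)) (I.orbit a)
    ⟨a, I.self_mem_orbit a⟩
  have hab := I.orbit_eq_of_mem hb
  refine ⟨b, ?_, hab.symm⟩
  simp only [repList, List.mem_filter, List.mem_finRange, true_and, decide_eq_true_eq]
  intro c hc hcb
  exact hmin c (hab ▸ hcb) hc

theorem pairwise_repList : I.repList.Pairwise fun a b => I.orbit a ≠ I.orbit b :=
  I.nodup_repList.pairwise_of_forall_ne fun _ ha _ hb hne h =>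
    hne (I.eq_of_mem_repList ha hb h)

/-- The table of the constraint. -/
def constraintTable : List (List ℕ) :=
  List.ofFn fun a => List.ofFn fun b => if b ∈ I.C a then 1 else 0

theorem app_constraintTable (a b : Fin n) :
    app (I.constraintTable.getD a []) b = 1 ↔ b ∈ I.C a := by
  simp [constraintTable, app]

/-- The vectors extracted from the generators of the transitive constituent of `a`. -/
noncomputable def blockBasis (a : Fin n) : List (Equiv.Perm (Fin n)) :=
  buildBasis a (I.restrictedGens a) [] ⊥

/-- The computed basis of the transitive constituent of `a`, as a list of vectors. -/
noncomputable def superBlock (a : Fin n) : List I.Super := (I.blockBasis a).map I.toSuper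

theorem length_superBlock (a : Fin n) : (I.superBlock a).length = (I.blockBasis a).length :=
  List.length_map _

theorem toPerm_sum_repList_apply (w : Fin n → I.Super)
    (hw : ∀ a ∈ I.repList, I.toPerm (w a) ∈ I.constituent (I.orbit a)) {a b : Fin n}
    (ha : a ∈ I.repList) (hb : b ∈ I.orbit a) :
    I.toPerm ((I.repList.map w).sum) b = I.toPerm (w a) b := by
  classical
  rw [← List.sum_toFinset w I.nodup_repList]
  exact I.toPerm_sum_apply _ id
    (fun i hi j hj => I.eq_of_mem_repList (List.mem_toFinset.1 hi) (List.mem_toFinset.1 hj)) w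
    (fun i hi => hw i (List.mem_toFinset.1 hi)) (List.mem_toFinset.2 ha) hb

/-- Every element of `G` is the sum of its restrictions to the orbits. -/
theorem sum_toSuper_restrictPerm_repList {g : Equiv.Perm (Fin n)} (hg : g ∈ I.group) :
    I.toPerm ((I.repList.map fun a => I.toSuper (restrictPerm g (I.orbit a))).sum) = g := by
  classical
  rw [← List.sum_toFinset _ I.nodup_repList]
  refine I.sum_toSuper_restrictPerm (R := I.repList.toFinset) (fun a ha b hb => ?_)
    (fun a => ?_) hg
  · exact I.eq_of_mem_repList (List.mem_toFinset.1 ha) (List.mem_toFinset.1 hb)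
  · simpa using I.exists_mem_repList a

theorem group_le_superGroup : I.group ≤ I.superGroup := fun _ hg =>
  I.sum_toSuper_restrictPerm_repList hg ▸ I.toPerm_mem _

end Data

theorem toPerm_linComb {p : ℕ} [Fact p.Prime] {A : Type} (I : GroupConstraint p A)
    (f : List I.Super) (c : List (ZMod p)) :
    I.toPerm (linComb f c) = powProd (f.map I.toPerm) c := by
  induction f generalizing c with
  | nil => rfl
  | cons u f ih =>
    obtain _ | ⟨x, c⟩ := c
    · rfl
    · simp [linComb, powProd, ih, I.toPerm_smul]

variable {p n : ℕ} [Fact p.Prime] (I : GroupConstraint p (Fin n))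

theorem hits_spanTable_gens (a b : Fin n) :
    hits (spanTable p n a (I.gens.map table)).2 a b = true ↔ b ∈ I.orbit a := by
  obtain ⟨h1, h2, -, h4⟩ := spanTable_spec a I.elementaryList_gens
  rw [h1, hits_table, I.mem_orbit_iff]
  constructor
  · rintro ⟨c, -, h⟩
    exact ⟨_, Subgroup.closure_mono h2 (powProd_mem_closure _ c), h⟩
  · rintro ⟨g, hg, rfl⟩
    exact h4 g hg

theorem restricted_tables (a : Fin n) :
    ((I.gens.map table).map fun u => (List.range n).map fun b =>
      cond (hits (spanTable p n a (I.gens.map table)).2 a b) (app u b) b) =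
      (I.restrictedGens a).map table := by
  classical
  rw [restrictedGens, List.map_map, List.map_map]
  refine List.map_congr_left fun u hu => List.ext_getElem (by simp [table]) fun i h1 h2 => ?_
  have hi : i < n := by simpa using h1
  have e1 := I.hits_spanTable_gens a ⟨i, hi⟩
  have e2 := app_table u ⟨i, hi⟩
  simp only [Function.comp, table, List.getElem_map, List.getElem_range, List.getElem_ofFn,
    I.restrictPerm_apply (I.mem_group_of_mem_gens hu)]
  dsimp only [table] at e1 e2
  by_cases h : (⟨i, hi⟩ : Fin n) ∈ I.orbit a
  · rw [e1.2 h, cond_true, if_pos h, e2]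
  · rw [Bool.eq_false_iff.2 fun h' => h (e1.1 h'), cond_false, if_neg h]

theorem block_eq (a : Fin n) : block p n (I.gens.map table) a = ((I.blockBasis a).map table,
    (combos p (I.blockBasis a)).map fun e => (table e.1, e.2)) := by
  rw [block, I.restricted_tables]
  exact (spanTable_spec a (I.elementaryList_restrictedGens a)).1

theorem separatedAt_blockBasis (a : Fin n) : SeparatedAt p a (I.blockBasis a) :=
  (spanTable_spec a (I.elementaryList_restrictedGens a)).2.2.1

theorem powProd_blockBasis_mem (a : Fin n) (c : List (ZMod p)) :
    powProd (I.blockBasis a) c ∈ I.constituent (I.orbit a) := by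
  rw [mem_constituent_iff, ← closure_restrictedGens]
  exact Subgroup.closure_mono (spanTable_spec a (I.elementaryList_restrictedGens a)).2.1
    (powProd_mem_closure _ c)

theorem blockBasis_mem (a : Fin n) {u : Equiv.Perm (Fin n)} (hu : u ∈ I.blockBasis a) :
    u ∈ I.constituent (I.orbit a) := by
  rw [mem_constituent_iff, ← closure_restrictedGens]
  exact Subgroup.subset_closure ((spanTable_spec a (I.elementaryList_restrictedGens a)).2.1 u hu)

theorem exists_powProd_blockBasis (a : Fin n) {w : Equiv.Perm (Fin n)}
    (hw : w ∈ I.constituent (I.orbit a)) : ∃ c : List (ZMod p),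
      c.length = (I.blockBasis a).length ∧ powProd (I.blockBasis a) c = w := by
  obtain ⟨c, hc, hca⟩ := (spanTable_spec a (I.elementaryList_restrictedGens a)).2.2.2 w (by
    rw [closure_restrictedGens, ← mem_constituent_iff]
    exact hw)
  exact ⟨c, hc, I.constituent_ext (I.powProd_blockBasis_mem a c) hw hca⟩

theorem map_toPerm_superBlock (a : Fin n) : (I.superBlock a).map I.toPerm = I.blockBasis a := by
  rw [superBlock, List.map_map]
  conv_rhs => rw [← List.map_id (I.blockBasis a)]
  exact List.map_congr_left fun u hu =>
    I.toPerm_toSuper (I.constituent_subset_superGroup a (I.blockBasis_mem a hu))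

theorem toPerm_linComb_superBlock (a : Fin n) (c : List (ZMod p)) :
    I.toPerm (linComb (I.superBlock a) c) = powProd (I.blockBasis a) c := by
  rw [toPerm_linComb, map_toPerm_superBlock]

theorem toPerm_linComb_superBlock_mem (a : Fin n) (c : List (ZMod p)) :
    I.toPerm (linComb (I.superBlock a) c) ∈ I.constituent (I.orbit a) :=
  I.toPerm_linComb_superBlock a c ▸ I.powProd_blockBasis_mem a c

/-- The coordinates of a restriction are found by looking up the image of `a` only, since the
constituent is regular. -/
theorem coordsOf_block (a : Fin n) {g : Equiv.Perm (Fin n)} (hg : g ∈ I.group) :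
    (coordsOf (block p n (I.gens.map table) a).2 a (app (table g) a)).length =
      (I.superBlock a).length ∧
    linComb (I.superBlock a) (coordsOf (block p n (I.gens.map table) a).2 a (app (table g) a)) =
      I.toSuper (restrictPerm g (I.orbit a)) := by
  have hgc : restrictPerm g (I.orbit a) ∈ I.constituent (I.orbit a) := ⟨g, hg, rfl⟩
  obtain ⟨c, hc, hcg⟩ := I.exists_powProd_blockBasis a hgc
  have hga : restrictPerm g (I.orbit a) a = g a :=
    I.restrictPerm_apply_of_mem hg (I.self_mem_orbit a)
  rw [block_eq, coordsOf, app_table]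
  cases hf : ((combos p (I.blockBasis a)).map fun e => (table e.1, e.2)).find?
      fun e => decide (app e.1 a = g a) with
  | none =>
    have := List.find?_eq_none.1 hf (table (powProd (I.blockBasis a) c), c)
      (List.mem_map.2 ⟨(powProd (I.blockBasis a) c, c), mem_combos.2 ⟨hc, rfl⟩, rfl⟩)
    refine absurd ?_ this
    simp [app_table, hcg, hga]
  | some e =>
    have h1 := List.find?_some hf
    obtain ⟨e', he', rfl⟩ := List.mem_map.1 (List.mem_of_find?_eq_some hf)
    obtain ⟨h2, h3⟩ := mem_combos.1 he'
    simp only [app_table, decide_eq_true_eq, Fin.val_inj] at h1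
    refine ⟨by rw [length_superBlock]; exact h2, I.toPerm_injective ?_⟩
    rw [I.toPerm_toSuper (I.constituent_subset_superGroup a hgc), toPerm_linComb_superBlock]
    refine I.constituent_ext (I.powProd_blockBasis_mem a _) hgc ?_
    rw [hga, ← h1, h3]
    rfl

theorem mem_feasible (a : Fin n) (v : List (ZMod p)) :
    v ∈ feasible p n (I.gens.map table) I.constraintTable a ↔
      v.length = (I.superBlock a).length ∧
        linComb (I.superBlock a) v ∈ I.V (Quotient.mk'' a) := by
  have hhit : ∀ b : Fin n, hits (block p n (I.gens.map table) a).2 a b = true ↔ b ∈ I.orbit a := by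
    intro b
    rw [block_eq, hits_table]
    constructor
    · rintro ⟨c, -, rfl⟩
      exact I.apply_mem_orbit_of_mem_constituent (I.powProd_blockBasis_mem a c)
        (I.self_mem_orbit a)
    · intro hb
      obtain ⟨g, hg, rfl⟩ := I.mem_orbit_iff.1 hb
      obtain ⟨c, hc, hcg⟩ := I.exists_powProd_blockBasis a
        (w := restrictPerm g (I.orbit a)) ⟨g, hg, rfl⟩
      exact ⟨c, hc, by rw [hcg, I.restrictPerm_apply_of_mem hg (I.self_mem_orbit a)]⟩
  have hall : ∀ w : Equiv.Perm (Fin n), ((List.range n).all fun b =>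
      !hits (block p n (I.gens.map table) a).2 a b ||
        decide (app (I.constraintTable.getD b []) (app (table w) b) = 1)) = true ↔
      ∀ b ∈ I.orbit a, w b ∈ I.C b := by
    intro w
    rw [List.all_eq_true]
    constructor
    · intro h b hb
      have := h b (List.mem_range.2 b.2)
      rwa [(hhit b).2 hb, Bool.not_true, Bool.false_or, decide_eq_true_eq, app_table,
        I.app_constraintTable] at this
    · intro h i hi
      have hi' : i < n := List.mem_range.1 hi
      by_cases hb : (⟨i, hi'⟩ : Fin n) ∈ I.orbit a
      · have h1 := (I.app_constraintTable ⟨i, hi'⟩ _).2 (h _ hb)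
        rw [← app_table] at h1
        simp only [Bool.or_eq_true, decide_eq_true_eq]
        exact Or.inr h1
      · rw [show hits (block p n (I.gens.map table) a).2 a i = false from
          Bool.eq_false_iff.2 fun h' => hb ((hhit ⟨i, hi'⟩).1 h')]
        rfl
  have hV : ∀ v : List (ZMod p), linComb (I.superBlock a) v ∈ I.V (Quotient.mk'' a) ↔
      ∀ b ∈ I.orbit a, powProd (I.blockBasis a) v b ∈ I.C b := by
    intro v
    rw [mem_V_mk, toPerm_linComb_superBlock]
    exact and_iff_right (I.powProd_blockBasis_mem a v)
  rw [hV, length_superBlock, feasible, List.mem_map]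
  constructor
  · rintro ⟨e, he, rfl⟩
    obtain ⟨h1, h2⟩ := List.mem_filter.1 he
    rw [block_eq] at h1
    obtain ⟨e', he', rfl⟩ := List.mem_map.1 h1
    obtain ⟨h3, h4⟩ := mem_combos.1 he'
    exact ⟨h3, h4 ▸ (hall e'.1).1 h2⟩
  · rintro ⟨h1, h2⟩
    refine ⟨(table (powProd (I.blockBasis a) v), v), List.mem_filter.2 ⟨?_, (hall _).2 h2⟩, rfl⟩
    rw [block_eq]
    exact List.mem_map.2 ⟨(powProd (I.blockBasis a) v, v), mem_combos.2 ⟨h1, rfl⟩, rfl⟩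

/-! ### The representatives of the orbits -/

theorem reps_eq : reps p n (I.gens.map table) = I.repList.map Fin.val := by
  classical
  have e : List.range n = (List.finRange n).map Fin.val := by simp
  rw [reps, repList, e, List.filter_map]
  congr 1
  refine List.filter_congr fun a _ => ?_
  rw [Bool.eq_iff_iff]
  simp only [Function.comp, List.all_eq_true, List.mem_range, Bool.not_eq_true',
    decide_eq_true_eq]
  constructor
  · intro h b hb hba
    have := h b hb
    rw [(I.hits_spanTable_gens a b).2 hba] at this
    exact Bool.noConfusion this
  · intro h b hb
    refine Bool.eq_false_iff.2 fun hh => ?_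
    exact h ⟨b, hb.trans a.2⟩ hb ((I.hits_spanTable_gens a ⟨b, hb.trans a.2⟩).1 hh)

/-- The computed basis of the super-space, as a list of vectors. -/
noncomputable def superVectors : List I.Super := I.repList.flatMap I.superBlock

theorem superBasis_eq : superBasis p n (I.gens.map table) =
    (I.superVectors.map I.toPerm).map table := by
  rw [superBasis, reps_eq, List.flatMap_map, superVectors, List.map_flatMap, List.map_flatMap]
  refine List.flatMap_congr fun a _ => ?_
  rw [block_eq, map_toPerm_superBlock]

theorem isComputedBasis_superVectors : I.IsComputedBasis (I.superVectors.map I.toPerm) := by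
  refine ⟨I.repList, I.pairwise_repList, I.exists_mem_repList, ?_⟩
  rw [superVectors, List.map_flatMap]
  exact List.flatMap_congr fun a _ => I.map_toPerm_superBlock a

/-- Evaluating a vanishing linear combination at a representative `a` leaves only the block of `a`,
whose coefficients are determined by the image of `a`. -/
theorem linearIndependent_superVectors : LinearIndependent (ZMod p) I.superVectors.get := by
  rw [Fintype.linearIndependent_iff]
  intro x hx
  have h0 : linComb I.superVectors (List.ofFn x) = 0 := by
    rw [linComb_eq_sum, vec_ofFn, hx]
  obtain ⟨c, hc, hxc⟩ := exists_eq_flatMap I.nodup_repList I.superBlock (x := List.ofFn x)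
    (List.length_ofFn)
  rw [hxc, superVectors, linComb_flatMap _ hc] at h0
  have hzero : ∀ a ∈ I.repList, ∀ y ∈ c a, y = 0 := by
    intro a ha
    have e := I.toPerm_sum_repList_apply (fun a => linComb (I.superBlock a) (c a))
      (fun a _ => I.toPerm_linComb_superBlock_mem a _) ha (I.self_mem_orbit a)
    rw [h0, toPerm_linComb_superBlock, toPerm_zero,
      ← powProd_replicate_zero (p := p) (I.blockBasis a)] at e
    have hlen := hc a ha
    rw [length_superBlock] at hlen
    have := I.separatedAt_blockBasis a _ _ (by simp) hlen e
    rw [← this]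
    intro y hy
    exact List.eq_of_mem_replicate hy
  intro i
  have hi : x i ∈ List.ofFn x := List.mem_ofFn.2 ⟨i, rfl⟩
  rw [hxc] at hi
  obtain ⟨a, ha, hia⟩ := List.mem_flatMap.1 hi
  exact hzero a ha _ hia

theorem span_superVectors : ⊤ ≤ Submodule.span (ZMod p) (Set.range I.superVectors.get) := by
  rw [Set.range_list_get]
  rintro u -
  have key : ∀ w ∈ I.superGroup, I.toSuper w ∈ Submodule.span (ZMod p) {v | v ∈ I.superVectors} := by
    intro w hw
    induction hw using Subgroup.closure_induction with
    | mem w hw =>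
      obtain ⟨b, hb⟩ := Set.mem_iUnion.1 hw
      obtain ⟨a, ha, hab⟩ := I.exists_mem_repList b
      rw [hab] at hb
      obtain ⟨c, -, hc⟩ := I.exists_powProd_blockBasis a hb
      rw [← hc, ← toPerm_linComb_superBlock, toSuper_toPerm]
      exact Submodule.span_mono (fun v hv => List.mem_flatMap.2 ⟨a, ha, hv⟩)
        (linComb_mem_span _ c)
    | one =>
      rw [← toPerm_zero, toSuper_toPerm]
      exact Submodule.zero_mem _
    | mul x y hx hy h1 h2 =>
      rw [← I.toPerm_toSuper hx, ← I.toPerm_toSuper hy, ← toPerm_add, toSuper_toPerm]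
      exact Submodule.add_mem _ h1 h2
    | inv x hx h1 =>
      rw [← I.toPerm_toSuper hx, ← toPerm_neg, toSuper_toPerm]
      exact Submodule.neg_mem _ h1
  simpa only [toSuper_toPerm] using key (I.toPerm u) (I.toPerm_mem u)

/-- The computed basis of the super-space. -/
noncomputable def basisSuper : Module.Basis (Fin I.superVectors.length) (ZMod p) I.Super :=
  Module.Basis.mk I.linearIndependent_superVectors I.span_superVectors

theorem basisSuper_apply (i : Fin I.superVectors.length) :
    I.basisSuper i = I.superVectors.get i := by
  rw [basisSuper, Module.Basis.mk_apply]

theorem repr_linComb {c : List (ZMod p)} :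
    I.basisSuper.repr (linComb I.superVectors c) = vec I.superVectors.length c := by
  rw [linComb_eq_sum]
  simp only [← basisSuper_apply]
  exact I.basisSuper.repr_sum_self _

theorem linComb_ofFn_repr (u : I.Super) :
    linComb I.superVectors (List.ofFn fun i => I.basisSuper.repr u i) = u := by
  rw [linComb_eq_sum, vec_ofFn]
  simp only [← basisSuper_apply]
  exact I.basisSuper.sum_repr u

end GroupConstraint

/-! ### The equations describe the solutions -/

namespace GroupConstraint

variable {p n : ℕ} [Fact p.Prime] (I : GroupConstraint p (Fin n))

/-- The group `G` is the subspace of the super-space spanned by the generators. -/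
theorem mem_span_gens_iff (u : I.Super) :
    u ∈ Submodule.span (ZMod p) {v | v ∈ I.gens.map I.toSuper} ↔ I.toPerm u ∈ I.group := by
  constructor
  · intro h
    induction h using Submodule.span_induction with
    | mem v hv =>
      obtain ⟨g, hg, rfl⟩ := List.mem_map.1 hv
      have := I.mem_group_of_mem_gens hg
      rwa [I.toPerm_toSuper (I.group_le_superGroup this)]
    | zero => exact one_mem _
    | add x y _ _ hx hy => exact mul_mem hx hy
    | smul c x _ hx => rw [toPerm_smul]; exact pow_mem hx _
  · intro h
    have key : ∀ g ∈ I.group,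
        I.toSuper g ∈ Submodule.span (ZMod p) {v | v ∈ I.gens.map I.toSuper} := by
      intro g hg
      induction hg using Subgroup.closure_induction with
      | mem g hg => exact Submodule.subset_span (List.mem_map_of_mem hg)
      | one =>
        rw [← toPerm_zero, toSuper_toPerm]
        exact Submodule.zero_mem _
      | mul x y hx hy h1 h2 =>
        rw [← I.toPerm_toSuper (I.group_le_superGroup hx),
          ← I.toPerm_toSuper (I.group_le_superGroup hy), ← toPerm_add, toSuper_toPerm]
        exact Submodule.add_mem _ h1 h2
      | inv x hx h1 =>
        rw [← I.toPerm_toSuper (I.group_le_superGroup hx), ← toPerm_neg, toSuper_toPerm]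
        exact Submodule.neg_mem _ h1
    simpa only [toSuper_toPerm] using key _ h

theorem genVectors_eq : genVectors p n (I.gens.map table) = I.gens.map fun g =>
    I.repList.flatMap fun a : Fin n =>
      coordsOf (block p n (I.gens.map table) a).2 a (app (table g) a) := by
  rw [genVectors, List.map_map, reps_eq]
  refine List.map_congr_left fun g _ => ?_
  rw [Function.comp, List.flatMap_map]

theorem length_of_mem_genVectors {v : List (ZMod p)}
    (hv : v ∈ genVectors p n (I.gens.map table)) : v.length = I.superVectors.length := by
  rw [genVectors_eq] at hv
  obtain ⟨g, hg, rfl⟩ := List.mem_map.1 hv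
  exact length_flatMap_congr _ fun a _ => (I.coordsOf_block a (I.mem_group_of_mem_gens hg)).1

theorem map_vec_genVectors : (genVectors p n (I.gens.map table)).map (vec I.superVectors.length) =
    (I.gens.map I.toSuper).map fun v => ⇑(I.basisSuper.repr v) := by
  rw [genVectors_eq, List.map_map, List.map_map]
  refine List.map_congr_left fun g hg => ?_
  have hg := I.mem_group_of_mem_gens hg
  simp only [Function.comp]
  have e : linComb I.superVectors (I.repList.flatMap fun a : Fin n =>
      coordsOf (block p n (I.gens.map table) a).2 a (app (table g) a)) = I.toSuper g := by
    rw [superVectors, linComb_flatMap _ fun a _ => (I.coordsOf_block a hg).1]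
    simp only [(I.coordsOf_block _ hg).2]
    conv_rhs => rw [← I.sum_toSuper_restrictPerm_repList hg, toSuper_toPerm]
  rw [← repr_linComb, e]

theorem forall_annihilator_genVectors_iff (u : I.Super) :
    (∀ y ∈ annihilator I.superVectors.length (genVectors p n (I.gens.map table)),
      vec I.superVectors.length y ⬝ᵥ ⇑(I.basisSuper.repr u) = 0) ↔ I.toPerm u ∈ I.group := by
  rw [forall_mem_annihilator_iff fun v hv => I.length_of_mem_genVectors hv, map_vec_genVectors,
    ← mem_span_gens_iff]
  have e : {y | y ∈ (I.gens.map I.toSuper).map fun v => ⇑(I.basisSuper.repr v)} =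
      I.basisSuper.equivFun '' {v | v ∈ I.gens.map I.toSuper} := by
    ext y
    simp only [Set.mem_ofPred_eq, Set.mem_image, List.mem_map, Module.Basis.equivFun_apply]
  rw [e, ← Module.Basis.equivFun_apply]
  have e2 := Submodule.map_span (I.basisSuper.equivFun : I.Super →ₗ[ZMod p] (Fin I.superVectors.length → ZMod p))
    {v | v ∈ I.gens.map I.toSuper}
  rw [show (I.basisSuper.equivFun '' {v | v ∈ I.gens.map I.toSuper}) =
    (I.basisSuper.equivFun : I.Super →ₗ[ZMod p] (Fin I.superVectors.length → ZMod p)) '' {v | v ∈ I.gens.map I.toSuper} from rfl, ← e2]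
  constructor
  · rintro ⟨v, hv, hvu⟩
    exact I.basisSuper.equivFun.injective hvu ▸ hv
  · exact fun h => ⟨u, h, rfl⟩

theorem blockRows_eq (a : Fin n) :
    blockRows p n (I.gens.map table) I.constraintTable a =
      (annihilator ((I.superBlock a).length + 1)
        ((feasible p n (I.gens.map table) I.constraintTable a).map fun v => -1 :: v)).map fun y =>
          (I.repList.flatMap fun a' : Fin n => cond (decide (a' = a)) y.tail
            (List.replicate (I.superBlock a').length 0), y.head?.getD 0) := by
  have hlen : ∀ b : Fin n, (block p n (I.gens.map table) b).1.length =
      (I.superBlock b).length := fun b => by rw [block_eq, length_superBlock, List.length_map]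
  rw [blockRows, hlen, reps_eq]
  refine List.map_congr_left fun y _ => ?_
  simp only [List.flatMap_map, hlen, Fin.val_inj]

theorem length_cons_of_mem_feasible {a : Fin n} {v : List (ZMod p)}
    (hv : v ∈ (feasible p n (I.gens.map table) I.constraintTable a).map fun v => -1 :: v) :
    v.length = (I.superBlock a).length + 1 := by
  obtain ⟨w, hw, rfl⟩ := List.mem_map.1 hv
  rw [List.length_cons, ((I.mem_feasible a w).1 hw).1]

theorem length_of_mem_blockRows {a : Fin n} {e : List (ZMod p) × ZMod p}
    (he : e ∈ blockRows p n (I.gens.map table) I.constraintTable a) :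
    e.1.length = I.superVectors.length := by
  rw [blockRows_eq] at he
  obtain ⟨y, hy, rfl⟩ := List.mem_map.1 he
  have hy := length_of_mem_annihilator (fun v hv => I.length_cons_of_mem_feasible hv) hy
  refine length_flatMap_congr _ fun b _ => ?_
  by_cases h : b = a
  · subst h; simp [hy]
  · simp [h]

/-- The equations of a block say that the block `c a` of the coordinates, extended by `-1`, is a
linear combination of the feasible vectors, extended in the same way. -/
theorem forall_blockRows_iff {a : Fin n} (ha : a ∈ I.repList) (u : I.Super)
    {c : Fin n → List (ZMod p)} (hc : ∀ a ∈ I.repList, (c a).length = (I.superBlock a).length)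
    (hu : List.ofFn ⇑(I.basisSuper.repr u) = I.repList.flatMap c) :
    (∀ e ∈ blockRows p n (I.gens.map table) I.constraintTable a,
      vec I.superVectors.length e.1 ⬝ᵥ ⇑(I.basisSuper.repr u) = e.2) ↔
    vec ((I.superBlock a).length + 1) (-1 :: c a) ∈ Submodule.span (ZMod p)
      {y | y ∈ ((feasible p n (I.gens.map table) I.constraintTable a).map fun v => -1 :: v).map
        (vec ((I.superBlock a).length + 1))} := by
  have hrows := fun e he => I.length_of_mem_blockRows (a := a) (e := e) he
  rw [← forall_mem_annihilator_iff fun v hv => I.length_cons_of_mem_feasible hv]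
  rw [blockRows_eq] at hrows ⊢
  rw [List.forall_mem_map]
  rw [List.forall_mem_map] at hrows
  refine forall₂_congr fun y hy => ?_
  have hyl := length_of_mem_annihilator (fun v hv => I.length_cons_of_mem_feasible hv) hy
  have h1 := hrows y hy
  dsimp only at h1 ⊢
  rw [← vec_ofFn ⇑(I.basisSuper.repr u), ← dot_eq_dotProduct h1 List.length_ofFn, hu,
    ← dot_eq_dotProduct hyl (by simp [hc a ha])]
  obtain _ | ⟨y₀, y⟩ := y
  · simp at hyl
  rw [dot_flatMap]
  · have : (I.repList.map fun b => dot (cond (decide (b = a)) (y₀ :: y).tail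
        (List.replicate (I.superBlock b).length 0)) (c b)).sum = dot y (c a) := by
      rw [← List.sum_toFinset _ I.nodup_repList,
        Finset.sum_eq_single_of_mem a (List.mem_toFinset.2 ha)]
      · simp
      · intro b _ hb
        simp [hb, dot_replicate_zero]
    rw [this]
    have e : dot (y₀ :: y) (-1 :: c a) = dot y (c a) - y₀ := by simp [dot]; ring
    rw [e, sub_eq_zero]
    rfl
  · intro b hb
    by_cases h : b = a
    · subst h
      simpa [hc b hb] using hyl
    · simp [h, hc b hb]

/-- For a linear constraint, the affine hulls of the sets of feasible vectors contain only feasible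
vectors, unless one of these sets is empty. -/
theorem forall_mem_span_iff (hlin : I.IsLinear) {c : Fin n → List (ZMod p)}
    (hc : ∀ a ∈ I.repList, (c a).length = (I.superBlock a).length) :
    (∀ a ∈ I.repList,
      vec ((I.superBlock a).length + 1) (-1 :: c a) ∈ Submodule.span (ZMod p)
        {y | y ∈ ((feasible p n (I.gens.map table) I.constraintTable a).map fun v => -1 :: v).map
          (vec ((I.superBlock a).length + 1))}) ↔
    ∀ a ∈ I.repList, linComb (I.superBlock a) (c a) ∈ I.V (Quotient.mk'' a) := by
  constructor
  · intro h
    have hne : ∀ O, (I.V O).Nonempty := by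
      intro O
      obtain ⟨b, rfl⟩ := Quotient.exists_rep O
      obtain ⟨a, ha, hba⟩ := I.exists_mem_repList b
      by_contra hemp
      have hO : (Quotient.mk'' b : I.Orbits) = Quotient.mk'' a := I.orbits_mk_eq_iff.2 hba
      have hf : feasible p n (I.gens.map table) I.constraintTable a = [] := by
        refine List.eq_nil_iff_forall_not_mem.2 fun v hv => hemp ?_
        have := ((I.mem_feasible a v).1 hv).2
        rw [← hO] at this
        exact ⟨_, this⟩
      -- The span is trivial, but the first entry of the vector is `-1`.
      have h0 := h a ha
      rw [hf] at h0
      simp only [List.map_nil, List.not_mem_nil, Set.ofPred_false, Submodule.span_empty,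
        Submodule.mem_bot] at h0
      have := congrFun h0 0
      simp [vec] at this
    obtain ⟨E, hE⟩ := I.exists_submodule_of_isLinear hlin hne
    intro a ha
    obtain ⟨v₀, hv₀⟩ := hne (Quotient.mk'' a)
    rw [hE a v₀ hv₀]
    refine ⟨I.toPerm_linComb_superBlock_mem a _, ?_⟩
    set k := (I.superBlock a).length
    -- This map takes `(-1, x)` to the difference of `v₀` and the vector with coordinates `x`.
    let Φ : (Fin (k + 1) → ZMod p) →ₗ[ZMod p] I.Super :=
      { toFun := fun y => ∑ i : Fin k, y i.succ • (I.superBlock a).get i + y 0 • v₀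
        map_add' := fun y z => by
          simp only [Pi.add_apply, add_smul, Finset.sum_add_distrib]; abel
        map_smul' := fun c y => by
          simp only [Pi.smul_apply, smul_eq_mul, mul_smul, Finset.smul_sum, smul_add,
            RingHom.id_apply] }
    have hΦ : ∀ v, Φ (vec (k + 1) (-1 :: v)) = linComb (I.superBlock a) v - v₀ := by
      intro v
      have : Φ (vec (k + 1) (-1 :: v)) =
        ∑ i : Fin k, vec k v i • (I.superBlock a).get i + (-1 : ZMod p) • v₀ := rfl
      rw [this, linComb_eq_sum, neg_smul, one_smul, sub_eq_add_neg]
    have hle : Submodule.span (ZMod p)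
        {y | y ∈ ((feasible p n (I.gens.map table) I.constraintTable a).map fun v => -1 :: v).map
          (vec (k + 1))} ≤ E.comap Φ := by
      refine Submodule.span_le.2 fun y hy => ?_
      obtain ⟨w, hw, rfl⟩ := List.mem_map.1 hy
      obtain ⟨v, hv, rfl⟩ := List.mem_map.1 hw
      change Φ _ ∈ E
      rw [hΦ]
      exact ((hE a v₀ hv₀ _).1 ((I.mem_feasible a v).1 hv).2).2
    have := hle (h a ha)
    rwa [Submodule.mem_comap, hΦ] at this
  · intro h a ha
    refine Submodule.subset_span (List.mem_map_of_mem (List.mem_map_of_mem ?_))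
    exact (I.mem_feasible a _).2 ⟨hc a ha, h a ha⟩

theorem forall_mem_V_iff (u : I.Super) {c : Fin n → List (ZMod p)}
    (hc : ∀ a ∈ I.repList, (c a).length = (I.superBlock a).length)
    (hu : List.ofFn ⇑(I.basisSuper.repr u) = I.repList.flatMap c) :
    (∀ a ∈ I.repList, linComb (I.superBlock a) (c a) ∈ I.V (Quotient.mk'' a)) ↔
      ∀ b, I.toPerm u b ∈ I.C b := by
  have e : u = (I.repList.map fun a => linComb (I.superBlock a) (c a)).sum := by
    rw [← linComb_flatMap _ hc, ← hu]
    exact (I.linComb_ofFn_repr u).symm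
  have happ : ∀ a ∈ I.repList, ∀ b ∈ I.orbit a,
      I.toPerm u b = I.toPerm (linComb (I.superBlock a) (c a)) b := by
    intro a ha b hb
    conv_lhs => rw [e]
    exact I.toPerm_sum_repList_apply _ (fun a _ => I.toPerm_linComb_superBlock_mem a _) ha hb
  simp only [mem_V_mk]
  constructor
  · intro h b
    obtain ⟨a, ha, hba⟩ := I.exists_mem_repList b
    have hb : b ∈ I.orbit a := hba ▸ I.self_mem_orbit b
    rw [happ a ha b hb]
    exact (h a ha).2 b hb
  · intro h a ha
    refine ⟨I.toPerm_linComb_superBlock_mem a _, fun b hb => ?_⟩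
    rw [← happ a ha b hb]
    exact h b

theorem equations_eq : equations p n (I.gens.map table) I.constraintTable =
    (annihilator I.superVectors.length (genVectors p n (I.gens.map table))).map
      (fun y => (y, 0)) ++ I.repList.flatMap fun a : Fin n =>
        blockRows p n (I.gens.map table) I.constraintTable a := by
  rw [equations, superBasis_eq, List.length_map, List.length_map, reps_eq, List.flatMap_map]

theorem length_of_mem_equations {e : List (ZMod p) × ZMod p}
    (he : e ∈ equations p n (I.gens.map table) I.constraintTable) :
    e.1.length = I.superVectors.length := by
  rw [equations_eq] at he
  rcases List.mem_append.1 he with he | he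
  · obtain ⟨y, hy, rfl⟩ := List.mem_map.1 he
    exact length_of_mem_annihilator (fun v hv => I.length_of_mem_genVectors hv) hy
  · obtain ⟨a, -, ha⟩ := List.mem_flatMap.1 he
    exact I.length_of_mem_blockRows ha

/-- The system of equations is equivalent to the instance. -/
theorem forall_equations_iff (hlin : I.IsLinear) (u : I.Super) :
    (∀ e ∈ equations p n (I.gens.map table) I.constraintTable,
      vec I.superVectors.length e.1 ⬝ᵥ ⇑(I.basisSuper.repr u) = e.2) ↔
      I.IsSolution (I.toPerm u) := by
  obtain ⟨c, hc, hu⟩ := exists_eq_flatMap I.nodup_repList I.superBlock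
    (x := List.ofFn ⇑(I.basisSuper.repr u)) List.length_ofFn
  rw [equations_eq, List.forall_mem_append, List.forall_mem_map,
    I.forall_annihilator_genVectors_iff, IsSolution, ← I.forall_mem_V_iff u hc hu,
    ← I.forall_mem_span_iff hlin hc]
  refine and_congr_right fun _ => ?_
  simp only [List.mem_flatMap, forall_exists_index, and_imp]
  constructor
  · intro h a ha
    exact (I.forall_blockRows_iff ha u hc hu).1 fun e he => h e a ha he
  · intro h e a ha he
    exact (I.forall_blockRows_iff ha u hc hu).2 (h a ha) e he

theorem combTable_superVectors (x : List (ZMod p)) :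
    combTable n ((I.superVectors.map I.toPerm).map table) x =
      table (I.toPerm (linComb I.superVectors x)) := by
  have key : ∀ (f : List I.Super) (x : List (ZMod p)) (w : I.Super),
      ((((f.map I.toPerm).map table).zip x).foldl (fun w e => w.map (appPow e.1 e.2))
        (table (I.toPerm w))) = table (I.toPerm (linComb f x + w)) := by
    intro f
    induction f with
    | nil => intro x w; simp [linComb]
    | cons v f ih =>
      intro x w
      obtain _ | ⟨j, x⟩ := x
      · simp [linComb]
      · simp only [List.map_cons, List.zip_cons_cons, List.foldl_cons, map_appPow_table,
          ← toPerm_smul, ← toPerm_add, ih, linComb]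
        congr 2
        abel
  have := key I.superVectors x 0
  rwa [toPerm_zero, table_one, add_zero] at this

end GroupConstraint

/-! ### The output and its encoding -/

theorem encList_map {α β : Type} (e : β → Dat) (f : α → β) (l : List α) :
    encList e (l.map f) = encList (fun x => e (f x)) l := by
  induction l with
  | nil => rfl
  | cons a l ih => simp [encList, ih]

theorem encList_congr {α : Type} {e e' : α → Dat} {l : List α} (h : ∀ x ∈ l, e x = e' x) :
    encList e l = encList e' l := by
  induction l with
  | nil => rfl
  | cons a l ih => simp [encList, h a, ih fun x hx => h x (by simp [hx])]

theorem encFun_vec {p d : ℕ} {v : List (ZMod p)} (h : v.length = d) :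
    encFun encZMod (vec d v) = enc v := by
  rw [encFun, ofFn_vec h]
  rfl

theorem encFun_get_map {α β : Type} (e : β → Dat) (f : α → β) (l : List α) :
    encFun e (fun i => f (l.get i)) = encList (fun x => e (f x)) l := by
  rw [encFun, ← encList_map e f]
  congr 1
  exact List.map_ofFn.symm.trans (by rw [List.ofFn_get])

namespace GroupConstraint

theorem encInstance_eq {p n : ℕ} (I : GroupConstraint p (Fin n)) :
    encInstance I = enc (n, I.gens.map table, I.constraintTable) := by
  have h1 : encList encPerm I.gens = enc (I.gens.map table) :=
    (encList_map (β := List ℕ) enc table _).symm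
  have h2 : encFun encSet I.C = enc I.constraintTable := by
    have : I.constraintTable = (List.ofFn I.C).map fun X => List.ofFn fun b =>
        if b ∈ X then 1 else 0 := by
      rw [List.map_ofFn]; rfl
    rw [this]
    exact (encList_map (β := List ℕ) enc _ _).symm
  rw [encInstance, h1, h2]
  rfl

/-- The encoded instance has polynomial size: its tables have at most `n` entries, which are numbers
less than `n` for the permutations and at most `1` for the constraint. -/
theorem polyBdd_encInstance : ∃ q : Polynomial ℕ, ∀ (p n : ℕ) (I : GroupConstraint p (Fin n)),
    sz (n, I.gens.map table, I.constraintTable) ≤ q.eval (n + I.gens.length) := by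
  open Polynomial in
  refine ⟨(2 * X + 1) + ((X * ((X * (2 * X + 1 + 1) + 1) + 1) + 1) +
    (X * ((X * (2 * 1 + 1 + 1) + 1) + 1) + 1) + 1) + 1, fun p n I => ?_⟩
  set N := n + I.gens.length with hN
  have hn : n ≤ N := by omega
  have hm : I.gens.length ≤ N := by omega
  have h1 : sz (I.gens.map table) ≤ N * ((N * (2 * N + 1 + 1) + 1) + 1) + 1 := by
    refine (sz_list_le fun u hu => ?_).trans
      (Nat.add_le_add_right (Nat.mul_le_mul_right _ (by simpa using hm)) _)
    obtain ⟨g, -, rfl⟩ := List.mem_map.1 hu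
    refine sz_table_le (by simpa [table] using hn) fun x hx => ?_
    obtain ⟨i, rfl⟩ := List.mem_ofFn.1 hx
    exact (g i).2.le.trans hn
  have h2 : sz I.constraintTable ≤ N * ((N * (2 * 1 + 1 + 1) + 1) + 1) + 1 := by
    refine (sz_list_le fun u hu => ?_).trans
      (Nat.add_le_add_right (Nat.mul_le_mul_right _ (by simpa [constraintTable] using hn)) _)
    obtain ⟨a, rfl⟩ := List.mem_ofFn.1 hu
    refine sz_table_le (by simpa using hn) fun x hx => ?_
    obtain ⟨i, rfl⟩ := List.mem_ofFn.1 hx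
    split_ifs <;> omega
  simp only [sz_prod, sz_nat, Polynomial.eval_add, Polynomial.eval_mul, Polynomial.eval_X,
    Polynomial.eval_one, Polynomial.eval_ofNat]
  omega

variable {p n : ℕ} [Fact p.Prime] (I : GroupConstraint p (Fin n))

/-- The solution of the system as part of the output. -/
noncomputable def solutionData (s : List (ZMod p) × List (List (ZMod p))) :
    SolutionData p n I.superVectors.length where
  x := vec I.superVectors.length s.1
  e := (s.2.map (vec I.superVectors.length)).length
  dir := (s.2.map (vec I.superVectors.length)).get
  g := I.toPerm (∑ i, vec I.superVectors.length s.1 i • I.basisSuper i)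

/-- The output of the algorithm on the instance `I`. -/
noncomputable def output : OutputData p n where
  d := I.superVectors.length
  f i := I.toPerm (I.basisSuper i)
  r := (equations p n (I.gens.map table) I.constraintTable).length
  M i := vec I.superVectors.length
    ((equations p n (I.gens.map table) I.constraintTable).get i).1
  b i := ((equations p n (I.gens.map table) I.constraintTable).get i).2
  sol := (solve I.superVectors.length
    (equations p n (I.gens.map table) I.constraintTable)).map I.solutionData

theorem describes_solve_equations : Describes I.superVectors.length
    (fun x => ∀ e ∈ equations p n (I.gens.map table) I.constraintTable,
      vec I.superVectors.length e.1 ⬝ᵥ x = e.2)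
    (solve I.superVectors.length (equations p n (I.gens.map table) I.constraintTable)) :=
  describes_solve fun _ he => I.length_of_mem_equations he

theorem mulVec_output_iff (x : Fin I.superVectors.length → ZMod p) :
    I.output.M.mulVec x = I.output.b ↔
      ∀ e ∈ equations p n (I.gens.map table) I.constraintTable,
        vec I.superVectors.length e.1 ⬝ᵥ x = e.2 := by
  rw [funext_iff, List.forall_mem_iff_get]
  rfl

theorem ofFn_output : List.ofFn I.output.f = I.superVectors.map I.toPerm := by
  have : I.output.f = fun i => I.toPerm (I.superVectors.get i) := by
    funext i
    exact congrArg I.toPerm (I.basisSuper_apply i)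
  rw [this]
  exact (List.map_ofFn (f := I.superVectors.get) (g := I.toPerm)).symm.trans
    (by rw [List.ofFn_get])

theorem enc_algorithm :
    enc (algorithm p (n, I.gens.map table, I.constraintTable)) = encOutput I.output := by
  have h1 : encFun encPerm I.output.f = enc (superBasis p n (I.gens.map table)) := by
    rw [encFun, ofFn_output, superBasis_eq]
    exact (encList_map (β := List ℕ) enc table _).symm
  have h2 : encFun (encFun encZMod) I.output.M =
      enc ((equations p n (I.gens.map table) I.constraintTable).map fun e => e.1) := by
    refine (encFun_get_map (encFun encZMod)
      (fun e : List (ZMod p) × ZMod p => vec I.superVectors.length e.1) _).trans ?_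
    refine Eq.trans ?_ (encList_map enc _ _).symm
    exact encList_congr fun e he => encFun_vec (I.length_of_mem_equations he)
  have h3 : encFun encZMod I.output.b =
      enc ((equations p n (I.gens.map table) I.constraintTable).map fun e => e.2) :=
    (encFun_get_map encZMod (fun e : List (ZMod p) × ZMod p => e.2) _).trans
      (encList_map _ _ _).symm
  have hlen : (superBasis p n (I.gens.map table)).length = I.superVectors.length := by
    rw [superBasis_eq, List.length_map, List.length_map]
  have h4 : encOption encSolution I.output.sol =
      enc ((solve I.superVectors.length
        (equations p n (I.gens.map table) I.constraintTable)).map fun s =>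
          (s.1, s.2, combTable n (superBasis p n (I.gens.map table)) s.1)) := by
    have hd := I.describes_solve_equations
    change encOption encSolution (Option.map I.solutionData _) = _
    cases hs : solve I.superVectors.length
        (equations p n (I.gens.map table) I.constraintTable) with
    | none => rfl
    | some s =>
      rw [hs] at hd
      obtain ⟨⟨hx, hdir⟩, -, -⟩ := hd
      have e1 : encFun (encFun encZMod) (s.2.map (vec I.superVectors.length)).get = enc s.2 := by
        rw [encFun_get_map (encFun encZMod) (fun y => y), encList_map]
        exact encList_congr fun v hv => encFun_vec (hdir v hv)
      have e2 : encPerm (I.toPerm (∑ i, vec I.superVectors.length s.1 i • I.basisSuper i)) =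
          enc (combTable n (superBasis p n (I.gens.map table)) s.1) := by
        rw [superBasis_eq, combTable_superVectors, linComb_eq_sum]
        simp only [basisSuper_apply]
        rfl
      simp only [Option.map_some, encOption, encSolution, solutionData, encFun_vec hx, e1, e2]
      rfl
  rw [encOutput, h1, h2, h3, h4, ← hlen]
  rfl

end GroupConstraint

theorem mainTheorem1 (p : ℕ) (hp : p.Prime) :
    ∃ (P : Prog) (q : Polynomial ℕ), ∀ (n : ℕ) (I : GroupConstraint p (Fin n)), I.IsLinear →
      ∃ (out : OutputData p n) (t : ℕ),
        Runs P (encInstance I) (encOutput out) t ∧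
        t ≤ q.eval (n + I.gens.length) ∧
        I.IsComputedBasis (List.ofFn out.f) ∧
        ∃ f : Module.Basis (Fin out.d) (ZMod p) I.Super,
          (∀ i, I.toPerm (f i) = out.f i) ∧
          (∀ g : Equiv.Perm (Fin n), I.IsSolution g ↔
            ∃ u : I.Super, I.toPerm u = g ∧ out.M.mulVec (f.repr u) = out.b) ∧
          SolvesSystem out.M out.b out.sol ∧
          SolvesConstraint I out.sol ∧
          (∀ s ∈ out.sol, s.g = I.toPerm (∑ i, s.x i • f i)) := by
  have : Fact p.Prime := ⟨hp⟩
  obtain ⟨P, T, ⟨q, hq⟩, hP⟩ := PolyTime.algorithm (p := p)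
  obtain ⟨r, hr⟩ := GroupConstraint.polyBdd_encInstance
  refine ⟨P, q.comp r, fun n I hlin => ?_⟩
  obtain ⟨t, ht, hrun⟩ := hP (n, I.gens.map table, I.constraintTable)
  rw [I.enc_algorithm, ← I.encInstance_eq] at hrun
  have hsys : ∀ u : I.Super, I.output.M.mulVec (I.basisSuper.repr u) = I.output.b ↔
      I.IsSolution (I.toPerm u) := fun u =>
    (I.mulVec_output_iff _).trans (I.forall_equations_iff hlin u)
  have hsol : ∀ g : Equiv.Perm (Fin n), I.IsSolution g ↔
      ∃ u : I.Super, I.toPerm u = g ∧ I.output.M.mulVec (I.basisSuper.repr u) = I.output.b := by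
    intro g
    constructor
    · intro hg
      have h := I.toPerm_toSuper (I.group_le_superGroup hg.1)
      exact ⟨I.toSuper g, h, (hsys _).2 (h.symm ▸ hg)⟩
    · rintro ⟨u, rfl, hu⟩
      exact (hsys u).1 hu
  have hd := I.describes_solve_equations
  have hrest : SolvesSystem I.output.M I.output.b I.output.sol ∧
      SolvesConstraint I I.output.sol ∧
      ∀ s ∈ I.output.sol, s.g = I.toPerm (∑ i, s.x i • I.basisSuper i) := by
    cases hs : solve I.superVectors.length
        (equations p n (I.gens.map table) I.constraintTable) with
    | none =>
      rw [hs] at hd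
      have ho : I.output.sol = none := by
        change Option.map I.solutionData _ = none
        rw [hs]; rfl
      rw [ho]
      refine ⟨fun x hx => hd x ((I.mulVec_output_iff x).1 hx), fun g hg => ?_, by simp⟩
      obtain ⟨u, -, hu⟩ := (hsol g).1 hg
      exact hd _ ((I.mulVec_output_iff _).1 hu)
    | some s =>
      rw [hs] at hd
      obtain ⟨-, hind, hiff⟩ := hd
      have ho : I.output.sol = some (I.solutionData s) := by
        change Option.map I.solutionData _ = _
        rw [hs]; rfl
      rw [ho]
      refine ⟨⟨hind, fun x => ?_⟩, ?_, ?_⟩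
      · have h := hiff x
        rw [← Set.range_list_get] at h
        exact (I.mulVec_output_iff x).trans h
      · refine (hsys _).1 ((I.mulVec_output_iff _).2 ?_)
        rw [I.basisSuper.repr_sum_self]
        exact (hiff _).2 (by rw [sub_self]; exact Submodule.zero_mem _)
      · rintro _ ⟨⟩
        rfl
  refine ⟨I.output, t, hrun, ?_, I.ofFn_output ▸ I.isComputedBasis_superVectors, I.basisSuper,
    fun i => rfl, hsol, hrest⟩
  rw [Polynomial.eval_comp]
  exact (ht.trans (hq _)).trans (q.eval_mono_nat (hr p n I))
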